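/- Let $1\le k<n$, and let $\mathbb{S}^n$ be the unit sphere of $\mathbb{R}^{n+1}$ with its Riemannian volume $\mathrm{vol}$ and geodesic distance. A subset of $\mathbb{S}^n$ is called convex if it is contained in a hemisphere and the cone over it with vertex at the origin is convex in $\mathbb{R}^{n+1}$. A probability measure $\mu$ on $\mathbb{S}^n$ is called convexely derived if it is the vague limit of a sequence of probability measures $\mathrm{vol}|_{S_i}/\mathrm{vol}(S_i)$, where the $S_i\subset\mathbb{S}^n$ are non-empty, open and convex. Let $\mu$ be a convexely derived probability measure on $\mathbb{S}^n$ whose support $S$ has dimension $k$, that is, the linear span of $S$ has dimension $k+1$. Then $\mu$ has a density on $S$ with respect to the $k$-dimensional Riemannian volume of the great $k$-sphere containing $S$, which is continuous on the relative interior of $S$ (its value at a relative boundary point of $S$ being the upper limit of its values at relative interior points), and this density achieves its maximum over $S$ at a unique point $M_0(\mu)\in S$. Moreover, for every $0<\varepsilon\le\pi/2$, the open geodesic ball $B(M_0(\mu),\varepsilon)$ satisfies $$\mu\bigl(B(M_0(\mu),\varepsilon)\bigr)\ \geq\ \frac{\int_{0}^{\varepsilon}\cos^{n-k}(t)\,\sin^{k-1}(t)\,dt}{\int_{0}^{\pi/2}\cos^{n-k}(t)\,\sin^{k-1}(t)\,dt}.$$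 -/

import Mathlib

open MeasureTheory Filter Topology
open scoped ENNReal

noncomputable section

/-- The ambient Euclidean space `ℝⁿ⁺¹`. -/
abbrev AmbientSpace (n : ℕ) : Type := EuclideanSpace ℝ (Fin (n + 1))

/-- The unit sphere `𝕊ⁿ ⊆ ℝⁿ⁺¹`. -/
abbrev UnitSphere (n : ℕ) : Type := Metric.sphere (0 : AmbientSpace n) 1

/-- The Riemannian volume of `𝕊ⁿ`: up to a constant factor, the volume of `H ⊆ 𝕊ⁿ` is the Lebesgue
measure of the truncated cone over `H`. -/
def sphereVolume (n : ℕ) : Measure (UnitSphere n) :=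
  (volume : Measure (AmbientSpace n)).toSphere

/-- The cone over `S ⊆ 𝕊ⁿ` with vertex at the origin. -/
def coneOver {n : ℕ} (S : Set (UnitSphere n)) : Set (AmbientSpace n) :=
  {y | ∃ t : ℝ, 0 ≤ t ∧ ∃ x ∈ S, y = t • (x : AmbientSpace n)}

/-- `S ⊆ 𝕊ⁿ` is convex if it is contained in a hemisphere and the cone over it is convex. -/
def IsSphericallyConvex {n : ℕ} (S : Set (UnitSphere n)) : Prop :=
  (∃ v : AmbientSpace n, v ≠ 0 ∧ ∀ x ∈ S, 0 ≤ inner ℝ v (x : AmbientSpace n)) ∧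
    Convex ℝ (coneOver S)

/-- A convexely derived measure: a weak (vague, as `𝕊ⁿ` is compact) limit of a sequence of
probability measures `vol|S_i / vol(S_i)` with `S_i` open and convex. -/
def IsConvexelyDerived {n : ℕ} (μ : ProbabilityMeasure (UnitSphere n)) : Prop :=
  ∃ (S : ℕ → Set (UnitSphere n)) (ν : ℕ → ProbabilityMeasure (UnitSphere n)),
    (∀ i, IsOpen (S i) ∧ (S i).Nonempty ∧ IsSphericallyConvex (S i) ∧
      (ν i : Measure (UnitSphere n)) = ProbabilityTheory.cond (sphereVolume n) (S i)) ∧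
    Tendsto ν atTop (𝓝 μ)

/-- The linear span of `S ⊆ 𝕊ⁿ`; its unit sphere is the smallest great subsphere containing `S`. -/
def sphereSpan {n : ℕ} (S : Set (UnitSphere n)) : Submodule ℝ (AmbientSpace n) :=
  Submodule.span ℝ ((fun x : UnitSphere n => (x : AmbientSpace n)) '' S)

/-- `S` has dimension `k` as a subset of the sphere: it spans a linear subspace of dimension `k + 1`,
that is, the smallest great subsphere containing it is a `k`-sphere. -/
def HasSphericalDim {n : ℕ} (S : Set (UnitSphere n)) (k : ℕ) : Prop :=
  Module.finrank ℝ (sphereSpan S) = k + 1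

/-- The inclusion into `𝕊ⁿ` of the great subsphere cut out by a linear subspace. -/
def subsphereIncl {n : ℕ} (V : Submodule ℝ (AmbientSpace n)) (x : Metric.sphere (0 : V) 1) :
    UnitSphere n :=
  ⟨((x : V) : AmbientSpace n), by
    have h : ‖(x : V)‖ = 1 := by simp
    rw [mem_sphere_zero_iff_norm]
    exact h⟩

/-- The Riemannian volume of the great subsphere cut out by `V`, as a measure on `𝕊ⁿ`. The measure
`(stdOrthonormalBasis ℝ V).toBasis.addHaar` is the Lebesgue measure of the Euclidean space `V`. -/
def subsphereVolume {n : ℕ} (V : Submodule ℝ (AmbientSpace n)) : Measure (UnitSphere n) :=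
  ((stdOrthonormalBasis ℝ V).toBasis.addHaar.toSphere).map (subsphereIncl V)

/-- The relative interior of a convex `S ⊆ 𝕊ⁿ` (within the smallest great subsphere that
contains `S`). -/
def relInterior {n : ℕ} (S : Set (UnitSphere n)) : Set (UnitSphere n) :=
  {x | (x : AmbientSpace n) ∈ intrinsicInterior ℝ (coneOver S)}

/-- `f` is the density of `μ` with respect to the Riemannian volume of the great subsphere spanned by
the support `S` of `μ`. It is normalized pointwise: it is continuous on the relative interior of
`S`, and at a boundary point its value is the upper limit of its values at interior points. These
conditions determine `f` on `S`; they hold for a density that is continuous on all of `S`. -/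
structure IsSphericalDensity {n : ℕ} (μ : ProbabilityMeasure (UnitSphere n))
    (f : UnitSphere n → ℝ≥0∞) : Prop where
  eq_withDensity : (μ : Measure (UnitSphere n)) =
    ((subsphereVolume (sphereSpan (μ : Measure (UnitSphere n)).support)).restrict
      (μ : Measure (UnitSphere n)).support).withDensity f
  continuousOn : ContinuousOn f (relInterior (μ : Measure (UnitSphere n)).support)
  eq_limsup : ∀ x ∈ (μ : Measure (UnitSphere n)).support,
    f x = limsup f (𝓝[relInterior (μ : Measure (UnitSphere n)).support] x)

/-- `p` is a point of the support of `μ` at which the density of `μ` achieves its maximum. -/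
def IsDensityMaxPoint {n : ℕ} (μ : ProbabilityMeasure (UnitSphere n)) (p : UnitSphere n) : Prop :=
  ∃ f : UnitSphere n → ℝ≥0∞, IsSphericalDensity μ f ∧
    p ∈ (μ : Measure (UnitSphere n)).support ∧
    ∀ x ∈ (μ : Measure (UnitSphere n)).support, f x ≤ f p

/-- The open ball of centre `p` and radius `ε` for the geodesic distance of `𝕊ⁿ`. -/
def geodesicBall {n : ℕ} (p : UnitSphere n) (ε : ℝ) : Set (UnitSphere n) :=
  {x | InnerProductGeometry.angle (p : AmbientSpace n) (x : AmbientSpace n) < ε}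

end

/-! Let Λ be the measure on ℝⁿ⁺¹ with polar decomposition μ ⊗ rⁿ dr. For the normalised volume of an
open convex set, Λ is a multiple of Lebesgue measure on a convex cone, so it satisfies the
Brunn-Minkowski inequality of degree n + 1. Tested on balls, this inequality survives weak limits
(`IsConvexelyDerived.mul_add_pow_le_coneMeasure`). Hence the cone K over the support of μ is closed
and convex, and Λ lives on its span V, of dimension k + 1.

On V, Brunn-Minkowski implies that translating a ball by an element of K does not decrease its mass.
Averaging over translations bounds Λ locally by Lebesgue measure, so Λ has a density, homogeneous of
degree m = n - k. Brunn-Minkowski for balls whose radii are proportional to the m-th roots of the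
density shows that the density is gᵐ, with g concave and positively homogeneous of degree one on the
interior of K (`IsBrunnMinkowskiCone.exists_isConcaveGauge`).

Let M be the supremum of g over the unit vectors of the interior of K; by compactness it is
approached near some unit vector p. Two such vectors p, q would give 2M ≤ M‖p + q‖, hence p = q.
Expanding M + s g(x) ≤ M‖p + s x‖ to first order gives g(x) ≤ M⟨p, x⟩, and concavity between p and x
then shows that g / cos t decreases with the angle t along each quarter of a great circle issuing
from p (`IsConcaveGauge.indicator_mul_cos_le`). So gᵐ decreases relative to cosᵐ t, and on each such
arc the angles below ε carry at least the share of the mass that they carry in the model. The weight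
sin^(k-1) t comes from polar coordinates around p; integrating over all directions gives the bound.

Since boundary values of the normalised density are upper limits, its maximum points are exactly the
peaks p (`IsDensityGauge.isDensityMaxPoint_iff`). -/

open scoped Pointwise

/-! ### The Prékopa-Leindler and Brunn-Minkowski inequalities -/

/-- The one-dimensional Brunn-Minkowski inequality. -/
theorem Real.volume_add_volume_le_of_add_mem {A B D : Set ℝ} (hA : MeasurableSet A)
    (hB : MeasurableSet B) (hAne : A.Nonempty) (hBne : B.Nonempty)
    (hD : ∀ x ∈ A, ∀ y ∈ B, x + y ∈ D) : volume A + volume B ≤ volume D := by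
  have hleft : volume A ≤ volume D := by
    obtain ⟨y, hy⟩ := hBne
    rw [← measure_preimage_add_right volume (-y) A]
    refine measure_mono fun z hz => ?_
    simpa using hD _ hz y hy
  have hright : volume B ≤ volume D := by
    obtain ⟨x, hx⟩ := hAne
    rw [← measure_preimage_add volume (-x) B]
    refine measure_mono fun z hz => ?_
    simpa using hD x hx _ hz
  rcases eq_or_ne (volume A) 0 with h0 | hA0
  · simpa [h0] using hright
  rcases eq_or_ne (volume B) 0 with h0 | hB0
  · simpa [h0] using hleft
  have key : ∀ r < volume A, ∀ s < volume B, r + s ≤ volume D := by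
    intro r hr s hs
    obtain ⟨K, hKA, hK, hrK⟩ := hA.exists_lt_isCompact hr
    obtain ⟨L, hLB, hL, hsL⟩ := hB.exists_lt_isCompact hs
    have hKne : K.Nonempty := by
      by_contra h
      simp [Set.not_nonempty_iff_eq_empty.1 h] at hrK
    have hLne : L.Nonempty := by
      by_contra h
      simp [Set.not_nonempty_iff_eq_empty.1 h] at hsL
    have hM := hK.sSup_mem hKne
    have hm := hL.sInf_mem hLne
    set M := sSup K
    set m := sInf L
    -- The translates K + min L and max K + L both lie in D and meet at most in the point max K +
    -- min L.
    have hsub : ((· + (-m)) ⁻¹' K) ∪ ((-M + ·) ⁻¹' L) ⊆ D := by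
      rintro z (hz | hz)
      · simpa using hD _ (hKA hz) _ (hLB hm)
      · simpa using hD _ (hKA hM) _ (hLB hz)
    have hdisj : AEDisjoint volume ((· + (-m)) ⁻¹' K) ((-M + ·) ⁻¹' L) := by
      refine measure_mono_null (t := {M + m}) ?_ (by simp)
      rintro z ⟨hz1, hz2⟩
      have h1 : z + -m ≤ M := le_csSup hK.bddAbove hz1
      have h2 : m ≤ -M + z := csInf_le hL.bddBelow hz2
      simp only [Set.mem_singleton_iff]
      linarith
    calc r + s ≤ volume K + volume L := add_le_add hrK.le hsL.le
      _ = volume (((· + (-m)) ⁻¹' K) ∪ ((-M + ·) ⁻¹' L)) := by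
          rw [measure_union₀ _ hdisj, measure_preimage_add_right, measure_preimage_add]
          exact (hL.measurableSet.preimage (measurable_const_add _)).nullMeasurableSet
      _ ≤ volume D := measure_mono hsub
  -- The suprema over s and then over r are taken separately, each time subtracting a finite
  -- quantity.
  have step : ∀ r < volume A, r + volume B ≤ volume D := by
    intro r hr
    refine le_of_forall_lt fun c hc => ?_
    by_contra hcon
    push Not at hcon
    have hr' : r ≠ ∞ := (hr.trans_le le_top).ne
    have : volume B ≤ c - r := by
      refine le_of_forall_lt fun s hs => ?_
      obtain ⟨s', hs', hs''⟩ := exists_between hs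
      have := (key r hr s' hs'').trans hcon
      exact hs'.trans_le (ENNReal.le_sub_of_add_le_left hr' this)
    have h2 : r + volume B ≤ r + (c - r) := by gcongr
    have h3 : r ≤ c := (le_self_add.trans (key r hr 0 (pos_iff_ne_zero.2 hB0))).trans hcon
    rw [add_tsub_cancel_of_le h3] at h2
    exact absurd hc (not_lt.2 h2)
  refine le_of_forall_lt fun c hc => ?_
  by_contra hcon
  push Not at hcon
  have hBtop : volume B ≠ ∞ := by
    intro h
    have := step 0 (pos_iff_ne_zero.2 hA0)
    rw [h, add_top] at this
    exact absurd (hc.trans_le le_top) (not_lt.2 (this.trans hcon))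
  have : volume A ≤ c - volume B := by
    refine le_of_forall_lt fun s hs => ?_
    obtain ⟨s', hs', hs''⟩ := exists_between hs
    exact hs'.trans_le (ENNReal.le_sub_of_add_le_right hBtop ((step s' hs'').trans hcon))
  have h2 : volume A + volume B ≤ (c - volume B) + volume B := by gcongr
  rw [tsub_add_cancel_of_le (hright.trans hcon)] at h2
  exact absurd hc (not_lt.2 h2)

/-- The weighted inequality between the geometric and the arithmetic mean. -/
theorem ENNReal.rpow_mul_rpow_le_weighted_add {a b : ℝ} (ha : 0 < a) (hb : 0 < b) (hab : a + b = 1)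
    (X Y : ℝ≥0∞) : X ^ a * Y ^ b ≤ ENNReal.ofReal a * X + ENNReal.ofReal b * Y := by
  have hpq : (a⁻¹).HolderConjugate b⁻¹ := by
    rw [Real.holderConjugate_iff]
    refine ⟨(one_lt_inv₀ ha).2 (by linarith), by simpa using hab⟩
  have := ENNReal.young_inequality (X ^ a) (Y ^ b) hpq
  rw [← ENNReal.rpow_mul, ← ENNReal.rpow_mul, mul_inv_cancel₀ ha.ne', mul_inv_cancel₀ hb.ne',
    ENNReal.rpow_one, ENNReal.rpow_one, ENNReal.ofReal_inv_of_pos ha, ENNReal.ofReal_inv_of_pos hb,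
    div_eq_mul_inv, div_eq_mul_inv, inv_inv, inv_inv] at this
  rwa [mul_comm _ X, mul_comm _ Y]

/-- A measure on a real vector space for which the Prékopa-Leindler inequality holds. -/
def PrekopaLeindler {E : Type*} [AddCommGroup E] [Module ℝ E] [MeasurableSpace E]
    (μ : Measure E) : Prop :=
  ∀ (a b : ℝ), 0 < a → 0 < b → a + b = 1 → ∀ f g h : E → ℝ≥0∞, Measurable f → Measurable g →
    Measurable h → (∀ x y, f x ^ a * g y ^ b ≤ h (a • x + b • y)) →
      (∫⁻ x, f x ∂μ) ^ a * (∫⁻ x, g x ∂μ) ^ b ≤ ∫⁻ x, h x ∂μ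

theorem lintegral_eq_lintegral_measure_lt_toReal {f : ℝ → ℝ≥0∞} (hf : Measurable f)
    (hf1 : ∀ x, f x ≤ 1) :
    ∫⁻ x, f x = ∫⁻ t in Set.Ioi (0 : ℝ), volume {x | t < (f x).toReal} := by
  rw [← lintegral_eq_lintegral_meas_lt volume (Eventually.of_forall fun x => ENNReal.toReal_nonneg)
    hf.ennreal_toReal.aemeasurable]
  refine lintegral_congr fun x => ?_
  rw [ENNReal.ofReal_toReal ((hf1 x).trans_lt ENNReal.one_lt_top).ne]

/-- The sets a{f > t} + b{g > t} lie in {h > t}, so the layer-cake formula reduces the claim to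
dimension one. Brunn-Minkowski needs non-empty sets: with both suprema equal to 1, the level sets of
f and g are non-empty for t < 1 and both empty for t ≥ 1. -/
theorem lintegral_weighted_add_le_of_iSup_eq_one {a b : ℝ} (ha : 0 < a) (hb : 0 < b)
    (hab : a + b = 1) {f g h : ℝ → ℝ≥0∞} (hf : Measurable f) (hg : Measurable g)
    (hh : Measurable h) (hfgh : ∀ x y, f x ^ a * g y ^ b ≤ h (a • x + b • y))
    (hf1 : ⨆ x, f x = 1) (hg1 : ⨆ x, g x = 1) :
    ENNReal.ofReal a * (∫⁻ x, f x) + ENNReal.ofReal b * (∫⁻ x, g x) ≤ ∫⁻ x, h x := by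
  have hfle : ∀ x, f x ≤ 1 := fun x => hf1 ▸ le_iSup f x
  have hgle : ∀ x, g x ≤ 1 := fun x => hg1 ▸ le_iSup g x
  have hhle : ∀ x, min (h x) 1 ≤ 1 := fun x => min_le_right _ _
  refine le_trans ?_ (lintegral_mono fun x => min_le_left (h x) 1)
  rw [lintegral_eq_lintegral_measure_lt_toReal hf hfle,
    lintegral_eq_lintegral_measure_lt_toReal hg hgle,
    lintegral_eq_lintegral_measure_lt_toReal (hh.min measurable_const) hhle]
  have hanti : ∀ u : ℝ → ℝ≥0∞, Measurable fun t : ℝ => volume {x | t < (u x).toReal} := fun u =>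
    (Antitone.measurable fun s t hst => measure_mono fun x hx => lt_of_le_of_lt hst hx)
  rw [← lintegral_const_mul _ (hanti f), ← lintegral_const_mul _ (hanti g),
    ← lintegral_add_left ((hanti f).const_mul _)]
  refine setLIntegral_mono' measurableSet_Ioi fun t ht => ?_
  have ht0 : (0 : ℝ) < t := ht
  rcases le_or_gt 1 t with h1t | ht1
  · have hempty : ∀ u : ℝ → ℝ≥0∞, (∀ x, u x ≤ 1) → {x | t < (u x).toReal} = ∅ := by
      intro u hu
      ext x
      simp only [Set.mem_ofPred_eq, Set.mem_empty_iff_false, iff_false, not_lt]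
      refine le_trans ?_ h1t
      simpa using ENNReal.toReal_mono ENNReal.one_ne_top (hu x)
    simp [hempty f hfle, hempty g hgle]
  have hlevel : ∀ u : ℝ → ℝ≥0∞, (∀ x, u x ≤ 1) → ∀ x,
      (t < (u x).toReal ↔ ENNReal.ofReal t < u x) := fun u hu x =>
    (ENNReal.ofReal_lt_iff_lt_toReal ht0.le ((hu x).trans_lt ENNReal.one_lt_top).ne).symm
  have ht1' : ENNReal.ofReal t < 1 := by simpa using ht1
  have hne : ∀ u : ℝ → ℝ≥0∞, (∀ x, u x ≤ 1) → ⨆ x, u x = 1 → {x | t < (u x).toReal}.Nonempty := by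
    intro u hu hu1
    rw [← hu1] at ht1'
    obtain ⟨x, hx⟩ := lt_iSup_iff.1 ht1'
    exact ⟨x, (hlevel u hu x).2 hx⟩
  have hms : ∀ u : ℝ → ℝ≥0∞, Measurable u → MeasurableSet {x | t < (u x).toReal} := fun u hu =>
    measurableSet_lt measurable_const hu.ennreal_toReal
  have hscale : ∀ (c : ℝ), 0 < c → ∀ A : Set ℝ, ENNReal.ofReal c * volume A = volume (c • A) := by
    intro c hc A
    rw [Measure.addHaar_smul]
    simp [abs_of_pos hc]
  rw [hscale a ha, hscale b hb]
  refine Real.volume_add_volume_le_of_add_mem ((hms f hf).const_smul₀ a)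
    ((hms g hg).const_smul₀ b) ((hne f hfle hf1).smul_set) ((hne g hgle hg1).smul_set) ?_
  rintro _ ⟨x, hx, rfl⟩ _ ⟨y, hy, rfl⟩
  have hx' := (hlevel f hfle x).1 hx
  have hy' := (hlevel g hgle y).1 hy
  refine (hlevel (fun x => min (h x) 1) hhle _).2 (lt_min (lt_of_lt_of_le ?_ (hfgh x y)) ht1')
  have ht0' : ENNReal.ofReal t ≠ 0 := by simpa using ht0
  calc ENNReal.ofReal t = ENNReal.ofReal t ^ a * ENNReal.ofReal t ^ b := by
        rw [← ENNReal.rpow_add _ _ ht0' ENNReal.ofReal_ne_top, hab, ENNReal.rpow_one]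
    _ < f x ^ a * g y ^ b := ENNReal.mul_lt_mul (ENNReal.rpow_lt_rpow hx' ha)
        (ENNReal.rpow_lt_rpow hy' hb)

/-- Dividing f and g by their suprema reduces to the normalised case, where the weighted arithmetic
mean dominates the geometric one. -/
theorem lintegral_rpow_mul_le_of_bounded {a b : ℝ} (ha : 0 < a) (hb : 0 < b)
    (hab : a + b = 1) {f g h : ℝ → ℝ≥0∞} (hf : Measurable f) (hg : Measurable g)
    (hh : Measurable h) (hfgh : ∀ x y, f x ^ a * g y ^ b ≤ h (a • x + b • y))
    (hf1 : ⨆ x, f x ≠ ∞) (hg1 : ⨆ x, g x ≠ ∞) :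
    (∫⁻ x, f x) ^ a * (∫⁻ x, g x) ^ b ≤ ∫⁻ x, h x := by
  set s := ⨆ x, f x with hs
  set t := ⨆ x, g x with ht
  rcases eq_or_ne s 0 with hs0 | hs0
  · have : f = 0 := funext fun x => by simpa using (ENNReal.iSup_eq_zero.1 hs0) x
    simp [this, ha]
  rcases eq_or_ne t 0 with ht0 | ht0
  · have : g = 0 := funext fun x => by simpa using (ENNReal.iSup_eq_zero.1 ht0) x
    simp [this, hb]
  have hsa : s ^ a ≠ 0 := by simp [ENNReal.rpow_eq_zero_iff, hs0, hf1]
  have htb : t ^ b ≠ 0 := by simp [ENNReal.rpow_eq_zero_iff, ht0, hg1]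
  have hsa' : s ^ a ≠ ∞ := ENNReal.rpow_ne_top_of_nonneg ha.le hf1
  have htb' : t ^ b ≠ ∞ := ENNReal.rpow_ne_top_of_nonneg hb.le hg1
  have hc0 : s ^ a * t ^ b ≠ 0 := mul_ne_zero hsa htb
  have hc1 : s ^ a * t ^ b ≠ ∞ := ENNReal.mul_ne_top hsa' htb'
  have hinv : (s ^ a * t ^ b)⁻¹ = (s⁻¹) ^ a * (t⁻¹) ^ b := by
    rw [ENNReal.mul_inv (Or.inl hsa) (Or.inl hsa'), ENNReal.inv_rpow, ENNReal.inv_rpow]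
  have main := lintegral_weighted_add_le_of_iSup_eq_one ha hb hab
    (f := fun x => s⁻¹ * f x) (g := fun x => t⁻¹ * g x) (h := fun x => (s ^ a * t ^ b)⁻¹ * h x)
    (hf.const_mul _) (hg.const_mul _) (hh.const_mul _)
    (fun x y => by
      rw [ENNReal.mul_rpow_of_nonneg _ _ ha.le, ENNReal.mul_rpow_of_nonneg _ _ hb.le,
        mul_mul_mul_comm, ← hinv]
      gcongr
      exact hfgh x y)
    (by rw [← ENNReal.mul_iSup, ← hs, ENNReal.inv_mul_cancel hs0 hf1])
    (by rw [← ENNReal.mul_iSup, ← ht, ENNReal.inv_mul_cancel ht0 hg1])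
  have main' := (ENNReal.rpow_mul_rpow_le_weighted_add ha hb hab _ _).trans main
  rw [lintegral_const_mul _ hf, lintegral_const_mul _ hg, lintegral_const_mul _ hh,
    ENNReal.mul_rpow_of_nonneg _ _ ha.le, ENNReal.mul_rpow_of_nonneg _ _ hb.le,
    mul_mul_mul_comm, ← hinv] at main'
  exact (ENNReal.mul_le_mul_iff_right (ENNReal.inv_ne_zero.2 hc1) (ENNReal.inv_ne_top.2 hc0)).1 main'

theorem prekopaLeindler_real : PrekopaLeindler (volume : Measure ℝ) := by
  intro a b ha hb hab f g h hf hg hh hfgh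
  rcases eq_or_ne (∫⁻ x, f x) 0 with hf0 | hf0
  · simp [hf0, ha]
  rcases eq_or_ne (∫⁻ x, g x) 0 with hg0 | hg0
  · simp [hg0, hb]
  -- Unbounded functions are truncated at n and recovered by monotone convergence. Both integrals
  -- are non-zero here, so the limit of the products never meets 0 · ∞.
  have hlim : ∀ u : ℝ → ℝ≥0∞, Measurable u →
      Tendsto (fun n : ℕ => ∫⁻ x, min (u x) n) atTop (𝓝 (∫⁻ x, u x)) := by
    intro u hu
    refine lintegral_tendsto_of_tendsto_of_monotone
      (fun n => (hu.min measurable_const).aemeasurable)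
      (Eventually.of_forall fun x m n hmn => min_le_min le_rfl (by exact_mod_cast hmn))
      (Eventually.of_forall fun x => ?_)
    have : Tendsto (fun n : ℕ => min (u x) (n : ℝ≥0∞)) atTop (𝓝 (min (u x) ∞)) :=
      tendsto_const_nhds.min ENNReal.tendsto_nat_nhds_top
    simpa using this
  have hsup : ∀ (u : ℝ → ℝ≥0∞) (n : ℕ), ⨆ x, min (u x) n ≠ ∞ := fun u n =>
    ((iSup_le fun x => min_le_right _ _).trans_lt (ENNReal.natCast_lt_top n)).ne
  refine le_of_tendsto (ENNReal.Tendsto.mul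
    ((ENNReal.continuous_rpow_const.tendsto _).comp (hlim f hf))
    (Or.inl (by simp [ENNReal.rpow_eq_zero_iff, hf0, ha.not_gt]))
    ((ENNReal.continuous_rpow_const.tendsto _).comp (hlim g hg))
    (Or.inl (by simp [ENNReal.rpow_eq_zero_iff, hg0, hb.not_gt]))) (Eventually.of_forall fun n => ?_)
  refine lintegral_rpow_mul_le_of_bounded ha hb hab (hf.min measurable_const)
    (hg.min measurable_const) hh (fun x y => le_trans ?_ (hfgh x y)) (hsup f n) (hsup g n)
  gcongr <;> exact min_le_left _ _

/-- The inequality on the fibres is precisely the hypothesis of the inequality for the fibre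
integrals, so Tonelli gives the product. This is the induction on the dimension. -/
theorem PrekopaLeindler.prod {E F : Type*} [AddCommGroup E] [Module ℝ E] [MeasurableSpace E]
    [AddCommGroup F] [Module ℝ F] [MeasurableSpace F] {μ : Measure E} {ν : Measure F} [SFinite ν]
    (hμ : PrekopaLeindler μ) (hν : PrekopaLeindler ν) : PrekopaLeindler (μ.prod ν) := by
  intro a b ha hb hab f g h hf hg hh hfgh
  rw [lintegral_prod _ hf.aemeasurable, lintegral_prod _ hg.aemeasurable,
    lintegral_prod _ hh.aemeasurable]
  refine hμ a b ha hb hab _ _ _ hf.lintegral_prod_right' hg.lintegral_prod_right'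
    hh.lintegral_prod_right' fun x y => ?_
  exact hν a b ha hb hab _ _ _ (hf.comp measurable_prodMk_left) (hg.comp measurable_prodMk_left)
    (hh.comp measurable_prodMk_left) fun x' y' => hfgh (x, x') (y, y')

theorem PrekopaLeindler.of_measurePreserving {E F : Type*} [AddCommGroup E] [Module ℝ E]
    [MeasurableSpace E] [AddCommGroup F] [Module ℝ F] [MeasurableSpace F] {μ : Measure E}
    {ν : Measure F} (hμ : PrekopaLeindler μ) (e : E ≃ᵐ F) (he : MeasurePreserving e μ ν)
    (hlin : ∀ (a b : ℝ) (x y : E), e (a • x + b • y) = a • e x + b • e y) :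
    PrekopaLeindler ν := by
  intro a b ha hb hab f g h hf hg hh hfgh
  rw [← he.lintegral_comp hf, ← he.lintegral_comp hg, ← he.lintegral_comp hh]
  refine hμ a b ha hb hab _ _ _ (hf.comp e.measurable) (hg.comp e.measurable)
    (hh.comp e.measurable) fun x y => ?_
  simpa only [Function.comp_apply, hlin] using hfgh (e x) (e y)

theorem prekopaLeindler_pi : ∀ n : ℕ, PrekopaLeindler (volume : Measure (Fin n → ℝ))
  | 0 => by
    intro a b ha hb hab f g h hf hg hh hfgh
    rw [volume_pi, Measure.pi_of_empty, lintegral_dirac, lintegral_dirac, lintegral_dirac]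
    convert hfgh _ _
  | n + 1 => by
    refine (prekopaLeindler_real.prod (prekopaLeindler_pi n)).of_measurePreserving
      (MeasurableEquiv.piFinSuccAbove (fun _ => ℝ) 0).symm
      ((volume_preserving_piFinSuccAbove (fun _ => ℝ) 0).symm _) fun a b x y => ?_
    ext i
    refine Fin.cases ?_ (fun j => ?_) i <;> simp [MeasurableEquiv.piFinSuccAbove]

theorem prekopaLeindler_euclideanSpace (n : ℕ) :
    PrekopaLeindler (volume : Measure (EuclideanSpace ℝ (Fin n))) :=
  (prekopaLeindler_pi n).of_measurePreserving (MeasurableEquiv.toLp 2 (Fin n → ℝ))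
    ((EuclideanSpace.volume_preserving_symm_measurableEquiv_toLp (Fin n)).symm _)
    fun _ _ _ _ => rfl

/-- The Brunn-Minkowski inequality, in a form without roots. -/
theorem PrekopaLeindler.mul_add_pow_le {E : Type*} [NormedAddCommGroup E] [NormedSpace ℝ E]
    [FiniteDimensional ℝ E] [MeasurableSpace E] [BorelSpace E] {μ : Measure E}
    [μ.IsAddHaarMeasure] (hμ : PrekopaLeindler μ) {A B D : Set E} (hA : MeasurableSet A)
    (hB : MeasurableSet B) (hD : MeasurableSet D) (hABD : ∀ x ∈ A, ∀ y ∈ B, x + y ∈ D)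
    {c : ℝ≥0∞} {α β : ℝ} (hα : 0 < α) (hβ : 0 < β)
    (hcA : c * ENNReal.ofReal α ^ Module.finrank ℝ E ≤ μ A)
    (hcB : c * ENNReal.ofReal β ^ Module.finrank ℝ E ≤ μ B) :
    c * ENNReal.ofReal (α + β) ^ Module.finrank ℝ E ≤ μ D := by
  have hαβ : 0 < α + β := add_pos hα hβ
  have hscale : ∀ (r : ℝ), 0 < r → ∀ S : Set E,
      μ (r⁻¹ • S) * ENNReal.ofReal r ^ Module.finrank ℝ E = μ S := by
    intro r hr S
    rw [Measure.addHaar_smul, abs_of_pos (by positivity), ENNReal.ofReal_pow (by positivity),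
      mul_right_comm, ← mul_pow, ← ENNReal.ofReal_mul (by positivity), inv_mul_cancel₀ hr.ne']
    simp
  have hcancel : ∀ (r : ℝ), 0 < r → ∀ x y : ℝ≥0∞,
      (x * ENNReal.ofReal r ^ Module.finrank ℝ E ≤ y * ENNReal.ofReal r ^ Module.finrank ℝ E
        ↔ x ≤ y) := fun r hr x y =>
    ENNReal.mul_le_mul_iff_left (by simpa using fun h => absurd hr (not_lt.2 h)) (by simp)
  -- By homogeneity A/α and B/β both have measure at least c, and the goal is the same bound for
  -- D/(α + β), which contains their convex combination with weights α/(α + β) and β/(α + β).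
  rw [← hscale α hα, hcancel α hα] at hcA
  rw [← hscale β hβ, hcancel β hβ] at hcB
  rw [← hscale _ hαβ, hcancel _ hαβ]
  have hind : ∀ S : Set E, MeasurableSet S → ∫⁻ x, S.indicator 1 x ∂μ = μ S := fun S hS =>
    lintegral_indicator_one hS
  have hsum : α / (α + β) + β / (α + β) = 1 := by field_simp
  have hAm := hA.const_smul₀ α⁻¹
  have hBm := hB.const_smul₀ β⁻¹
  have hDm := hD.const_smul₀ (α + β)⁻¹
  have main := hμ (α / (α + β)) (β / (α + β)) (by positivity) (by positivity) hsum
    ((α⁻¹ • A).indicator 1) ((β⁻¹ • B).indicator 1) (((α + β)⁻¹ • D).indicator 1)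
    (measurable_one.indicator hAm) (measurable_one.indicator hBm)
    (measurable_one.indicator hDm) (fun x y => by
      by_cases hx : x ∈ α⁻¹ • A
      · by_cases hy : y ∈ β⁻¹ • B
        · have : (α / (α + β)) • x + (β / (α + β)) • y ∈ (α + β)⁻¹ • D := by
            rw [Set.mem_inv_smul_set_iff₀ hαβ.ne', smul_add, smul_smul, smul_smul,
              mul_div_cancel₀ _ hαβ.ne', mul_div_cancel₀ _ hαβ.ne']
            exact hABD _ ((Set.mem_inv_smul_set_iff₀ hα.ne' _ _).1 hx) _
              ((Set.mem_inv_smul_set_iff₀ hβ.ne' _ _).1 hy)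
          simp [Set.indicator_of_mem hx, Set.indicator_of_mem hy, Set.indicator_of_mem this]
        · simp [Set.indicator_of_notMem hy, ENNReal.zero_rpow_of_pos (div_pos hβ hαβ)]
      · simp [Set.indicator_of_notMem hx, ENNReal.zero_rpow_of_pos (div_pos hα hαβ)])
  rw [hind _ hAm, hind _ hBm, hind _ hDm] at main
  refine le_trans ?_ main
  rcases eq_or_ne c 0 with rfl | hc0
  · simp
  rcases eq_or_ne c ∞ with rfl | hc1
  · rw [top_le_iff.1 hcA, top_le_iff.1 hcB, ENNReal.top_rpow_of_pos (by positivity),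
      ENNReal.top_rpow_of_pos (by positivity)]
    simp
  calc c = c ^ (α / (α + β)) * c ^ (β / (α + β)) := by
        rw [← ENNReal.rpow_add _ _ hc0 hc1, hsum, ENNReal.rpow_one]
    _ ≤ _ := by gcongr

/-! ### The cone measure of a measure on the sphere -/

noncomputable section

/-- The measure on `ℝⁿ⁺¹` whose polar decomposition is `ν ⊗ rⁿ dr`. -/
def coneMeasure {n : ℕ} (ν : Measure (UnitSphere n)) : Measure (AmbientSpace n) :=
  (ν.prod (Measure.volumeIoiPow n)).map fun p => (p.2 : ℝ) • (p.1 : AmbientSpace n)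

section coneMeasure
variable {n : ℕ}

theorem measurable_smul_sphere :
    Measurable fun p : UnitSphere n × Set.Ioi (0 : ℝ) => (p.2 : ℝ) • (p.1 : AmbientSpace n) := by
  fun_prop

theorem coneMeasure_apply (ν : Measure (UnitSphere n)) [SFinite ν] {A : Set (AmbientSpace n)}
    (hA : MeasurableSet A) :
    coneMeasure ν A = ∫⁻ r : Set.Ioi (0 : ℝ), ν {x | (r : ℝ) • (x : AmbientSpace n) ∈ A}
      ∂(Measure.volumeIoiPow n) := by
  rw [coneMeasure, Measure.map_apply measurable_smul_sphere hA,
    Measure.prod_apply_symm (measurable_smul_sphere hA)]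
  rfl

theorem measurable_measure_smul_mem (ν : Measure (UnitSphere n)) [SFinite ν]
    {A : Set (AmbientSpace n)} (hA : MeasurableSet A) :
    Measurable fun r : Set.Ioi (0 : ℝ) => ν {x | (r : ℝ) • (x : AmbientSpace n) ∈ A} :=
  measurable_measure_prodMk_right (measurable_smul_sphere hA)

theorem norm_unitSphere (x : UnitSphere n) : ‖(x : AmbientSpace n)‖ = 1 := by simp

theorem smul_mem_coneOver_iff {S : Set (UnitSphere n)} {x : UnitSphere n} {r : ℝ} (hr : 0 < r) :
    r • (x : AmbientSpace n) ∈ coneOver S ↔ x ∈ S := by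
  refine ⟨?_, fun h => ⟨r, hr.le, x, h, rfl⟩⟩
  rintro ⟨t, ht, y, hy, h⟩
  have := congrArg norm h
  rw [norm_smul, norm_smul, norm_unitSphere, norm_unitSphere, Real.norm_of_nonneg hr.le,
    Real.norm_of_nonneg ht, mul_one, mul_one] at this
  subst this
  have hxy : x = y := Subtype.ext (smul_right_injective _ hr.ne' h)
  exact hxy ▸ hy

theorem zero_mem_coneOver {S : Set (UnitSphere n)} (hS : S.Nonempty) :
    (0 : AmbientSpace n) ∈ coneOver S := by
  obtain ⟨x, hx⟩ := hS
  exact ⟨0, le_rfl, x, hx, by simp⟩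

theorem smul_mem_coneOver {S : Set (UnitSphere n)} {y : AmbientSpace n} (hy : y ∈ coneOver S)
    {t : ℝ} (ht : 0 ≤ t) : t • y ∈ coneOver S := by
  obtain ⟨s, hs, x, hx, rfl⟩ := hy
  exact ⟨t * s, mul_nonneg ht hs, x, hx, by rw [smul_smul]⟩

theorem add_mem_coneOver {S : Set (UnitSphere n)} (hS : Convex ℝ (coneOver S))
    {y z : AmbientSpace n} (hy : y ∈ coneOver S) (hz : z ∈ coneOver S) : y + z ∈ coneOver S := by
  have := smul_mem_coneOver (hS hy hz (a := 1 / 2) (b := 1 / 2) (by norm_num) (by norm_num)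
    (by norm_num)) (t := 2) (by norm_num)
  simpa [smul_add, smul_smul] using this

/-- Away from the origin the cone is the preimage of S under y ↦ y/‖y‖. -/
theorem measurableSet_coneOver {S : Set (UnitSphere n)} (hS : MeasurableSet S) :
    MeasurableSet (coneOver S) := by
  rcases S.eq_empty_or_nonempty with rfl | hne
  · have : coneOver (∅ : Set (UnitSphere n)) = ∅ := by ext y; simp [coneOver]
    simp [this]
  have : coneOver S = insert 0 (Subtype.val ''
      ((fun y => (homeomorphUnitSphereProd (AmbientSpace n) y).1) ⁻¹' S)) := by
    ext y
    rcases eq_or_ne y 0 with rfl | hy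
    · simp [zero_mem_coneOver hne]
    have hy' : 0 < ‖y‖ := norm_pos_iff.2 hy
    have hmem : ‖y‖ • ((homeomorphUnitSphereProd (AmbientSpace n) ⟨y, hy⟩).1 : AmbientSpace n)
        = y := by
      simp [smul_smul, hy'.ne']
    rw [← hmem, smul_mem_coneOver_iff hy', hmem]
    simp only [Set.mem_insert_iff, hy, false_or]
    constructor
    · intro h
      exact ⟨⟨y, hy⟩, h, rfl⟩
    · rintro ⟨⟨z, hz⟩, h, rfl⟩
      exact h
  rw [this]
  exact ((MeasurableEmbedding.subtype_coe (measurableSet_singleton _).compl).measurableSet_image.2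
    (((measurable_fst.comp (Homeomorph.measurable _))) hS)).insert 0

/-- This is the polar decomposition of Lebesgue measure; the origin, which polar coordinates omit,
is a null set. -/
theorem coneMeasure_sphereVolume : coneMeasure (sphereVolume n) = volume := by
  have hmp := (volume : Measure (AmbientSpace n)).measurePreserving_homeomorphUnitSphereProd
  rw [finrank_euclideanSpace_fin, Nat.add_sub_cancel] at hmp
  rw [coneMeasure, sphereVolume, ← hmp.map_eq,
    Measure.map_map measurable_smul_sphere hmp.measurable]
  have : ((fun p : UnitSphere n × Set.Ioi (0 : ℝ) => (p.2 : ℝ) • (p.1 : AmbientSpace n)) ∘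
      homeomorphUnitSphereProd (AmbientSpace n)) = Subtype.val := by
    ext1 y
    have : ‖(y : AmbientSpace n)‖ ≠ 0 := norm_ne_zero_iff.2 y.2
    simp [smul_smul, this]
  rw [this, map_comap_subtype_coe (measurableSet_singleton _).compl, restrict_compl_singleton]

theorem coneMeasure_restrict_apply (ν : Measure (UnitSphere n)) [SFinite ν]
    {S : Set (UnitSphere n)} (hS : MeasurableSet S) {A : Set (AmbientSpace n)}
    (hA : MeasurableSet A) :
    coneMeasure (ν.restrict S) A = coneMeasure ν (A ∩ coneOver S) := by
  rw [coneMeasure_apply _ hA, coneMeasure_apply _ (hA.inter (measurableSet_coneOver hS))]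
  refine lintegral_congr fun r => ?_
  rw [Measure.restrict_apply (by exact measurable_prodMk_right (measurable_smul_sphere hA))]
  congr 1
  ext x
  simp [smul_mem_coneOver_iff (S := S) r.2]

theorem coneMeasure_smul (ν : Measure (UnitSphere n)) [SFinite ν] (c : ℝ≥0∞) :
    coneMeasure (c • ν) = c • coneMeasure ν := by
  rw [coneMeasure, Measure.prod_smul_left, Measure.map_smul, coneMeasure]

theorem coneMeasure_cond_apply {S : Set (UnitSphere n)} (hS : MeasurableSet S)
    {A : Set (AmbientSpace n)} (hA : MeasurableSet A) :
    coneMeasure (ProbabilityTheory.cond (sphereVolume n) S) A =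
      (sphereVolume n S)⁻¹ * volume (A ∩ coneOver S) := by
  have : IsFiniteMeasure (sphereVolume n) := by unfold sphereVolume; infer_instance
  rw [ProbabilityTheory.cond, coneMeasure_smul, Measure.smul_apply, smul_eq_mul,
    coneMeasure_restrict_apply _ hS hA, coneMeasure_sphereVolume]

/-- A convex cone is stable under addition, so the Brunn-Minkowski inequality applies to the traces
of A, B, D on the cone. The normalising factor is absorbed into c. -/
theorem coneMeasure_cond_mul_add_pow_le {S : Set (UnitSphere n)} (hS : MeasurableSet S)
    (hconv : Convex ℝ (coneOver S)) {A B D : Set (AmbientSpace n)} (hA : MeasurableSet A)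
    (hB : MeasurableSet B) (hD : MeasurableSet D) (hABD : ∀ x ∈ A, ∀ y ∈ B, x + y ∈ D)
    {c : ℝ≥0∞} {α β : ℝ} (hα : 0 < α) (hβ : 0 < β)
    (hcA : c * ENNReal.ofReal α ^ (n + 1) ≤
      coneMeasure (ProbabilityTheory.cond (sphereVolume n) S) A)
    (hcB : c * ENNReal.ofReal β ^ (n + 1) ≤
      coneMeasure (ProbabilityTheory.cond (sphereVolume n) S) B) :
    c * ENNReal.ofReal (α + β) ^ (n + 1) ≤
      coneMeasure (ProbabilityTheory.cond (sphereVolume n) S) D := by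
  have : IsFiniteMeasure (sphereVolume n) := by unfold sphereVolume; infer_instance
  have hC := measurableSet_coneOver hS
  rw [coneMeasure_cond_apply hS hA] at hcA
  rw [coneMeasure_cond_apply hS hB] at hcB
  rw [coneMeasure_cond_apply hS hD]
  -- If S is null, the conditional measure vanishes and the hypothesis on A forces c = 0.
  rcases eq_or_ne (sphereVolume n S) 0 with h0 | h0
  · have hzero : ∀ T : Set (AmbientSpace n), volume (T ∩ coneOver S) = 0 := by
      intro T
      refine measure_mono_null Set.inter_subset_right ?_
      rw [← coneMeasure_sphereVolume, ← Set.univ_inter (coneOver S),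
        ← coneMeasure_restrict_apply _ hS MeasurableSet.univ, Measure.restrict_eq_zero.2 h0]
      simp [coneMeasure]
    rw [hzero] at hcA
    have : c = 0 := by simpa [hα.not_ge] using hcA
    simp [this]
  have htop : sphereVolume n S ≠ ∞ := measure_ne_top _ _
  have hmove : ∀ x y : ℝ≥0∞, (x ≤ (sphereVolume n S)⁻¹ * y ↔ sphereVolume n S * x ≤ y) := by
    intro x y
    rw [← ENNReal.mul_le_mul_iff_right h0 htop, ← mul_assoc, ENNReal.mul_inv_cancel h0 htop,
      one_mul]
  rw [hmove, ← mul_assoc] at hcA hcB ⊢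
  have := (prekopaLeindler_euclideanSpace (n + 1)).mul_add_pow_le (A := A ∩ coneOver S)
    (B := B ∩ coneOver S) (D := D ∩ coneOver S) (hA.inter hC) (hB.inter hC) (hD.inter hC)
    (fun x hx y hy => ⟨hABD x hx.1 y hy.1, add_mem_coneOver hconv hx.2 hy.2⟩) hα hβ
    (c := sphereVolume n S * c)
  rw [finrank_euclideanSpace_fin] at this
  exact this hcA hcB

theorem continuous_smul_sphere (r : ℝ) :
    Continuous fun x : UnitSphere n => r • (x : AmbientSpace n) := by fun_prop

/-- On each sphere of radius r this is the portmanteau theorem for open sets; Fatou's lemma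
integrates it over r. -/
theorem coneMeasure_le_liminf {ν : ℕ → ProbabilityMeasure (UnitSphere n)}
    {μ : ProbabilityMeasure (UnitSphere n)} (h : Tendsto ν atTop (𝓝 μ)) {G : Set (AmbientSpace n)}
    (hG : IsOpen G) :
    coneMeasure (μ : Measure (UnitSphere n)) G ≤
      liminf (fun i => coneMeasure (ν i : Measure (UnitSphere n)) G) atTop := by
  simp_rw [coneMeasure_apply _ hG.measurableSet]
  refine le_trans (lintegral_mono fun r => ?_)
    (lintegral_liminf_le fun i => measurable_measure_smul_mem _ hG.measurableSet)
  exact ProbabilityMeasure.le_liminf_measure_open_of_tendsto h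
    (hG.preimage (continuous_smul_sphere (r : ℝ)))

theorem setOf_smul_mem_eq_empty {A : Set (AmbientSpace n)} {R : ℝ}
    (hA : A ⊆ Metric.ball 0 R) {r : ℝ} (hr : 0 < r) (hRr : R ≤ r) :
    {x : UnitSphere n | r • (x : AmbientSpace n) ∈ A} = ∅ := by
  ext x
  simp only [Set.mem_ofPred_eq, Set.mem_empty_iff_false, iff_false]
  intro hx
  have := hA hx
  rw [mem_ball_zero_iff, norm_smul, norm_unitSphere, Real.norm_of_nonneg hr.le] at this
  linarith

/-- The portmanteau theorem for closed sets, integrated by the reverse Fatou lemma. The latter needs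
a dominating function, which is why F is bounded: only radii below R contribute. -/
theorem limsup_coneMeasure_le {ν : ℕ → ProbabilityMeasure (UnitSphere n)}
    {μ : ProbabilityMeasure (UnitSphere n)} (h : Tendsto ν atTop (𝓝 μ)) {F : Set (AmbientSpace n)}
    (hF : IsClosed F) {R : ℝ} (hR : 0 < R) (hFR : F ⊆ Metric.ball 0 R) :
    limsup (fun i => coneMeasure (ν i : Measure (UnitSphere n)) F) atTop ≤
      coneMeasure (μ : Measure (UnitSphere n)) F := by
  simp_rw [coneMeasure_apply _ hF.measurableSet]
  refine le_trans (limsup_lintegral_le ((Set.Iio (⟨R, hR⟩ : Set.Ioi (0 : ℝ))).indicator 1)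
    (fun i => measurable_measure_smul_mem _ hF.measurableSet) (fun i => Eventually.of_forall
      fun r => ?_) ?_) (lintegral_mono fun r => ?_)
  · by_cases hr : r ∈ Set.Iio (⟨R, hR⟩ : Set.Ioi (0 : ℝ))
    · rw [Set.indicator_of_mem hr]
      exact prob_le_one
    · dsimp only
      rw [setOf_smul_mem_eq_empty hFR r.2 (not_lt.1 hr)]
      simp
  · rw [lintegral_indicator_one measurableSet_Iio, Measure.volumeIoiPow_apply_Iio]
    exact ENNReal.ofReal_ne_top
  · exact ProbabilityMeasure.limsup_measure_closed_le_of_tendsto h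
      (hF.preimage (continuous_smul_sphere (r : ℝ)))

theorem coneMeasure_ball_zero (μ : Measure (UnitSphere n)) [IsProbabilityMeasure μ] {R : ℝ}
    (hR : 0 < R) :
    coneMeasure μ (Metric.ball 0 R) = ENNReal.ofReal (R ^ (n + 1) / (n + 1)) := by
  rw [coneMeasure_apply _ Metric.isOpen_ball.measurableSet,
    ← Measure.volumeIoiPow_apply_Iio n ⟨R, hR⟩, ← lintegral_indicator_one measurableSet_Iio]
  refine lintegral_congr fun r => ?_
  by_cases hr : r ∈ Set.Iio (⟨R, hR⟩ : Set.Ioi (0 : ℝ))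
  · have hr0 : (0 : ℝ) < r := r.2
    have hrR : (r : ℝ) < R := hr
    have : {x : UnitSphere n | (r : ℝ) • (x : AmbientSpace n) ∈ Metric.ball 0 R} = Set.univ := by
      ext x
      simp [norm_smul, abs_of_pos hr0, hrR]
    rw [this, Set.indicator_of_mem hr]
    simp
  · rw [setOf_smul_mem_eq_empty le_rfl r.2 (not_lt.1 hr), Set.indicator_of_notMem hr]
    simp

instance (μ : Measure (UnitSphere n)) [IsProbabilityMeasure μ] :
    IsLocallyFiniteMeasure (coneMeasure μ) := by
  refine ⟨fun x => ⟨Metric.ball 0 (‖x‖ + 1), Metric.isOpen_ball.mem_nhds (by simp), ?_⟩⟩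
  rw [coneMeasure_ball_zero _ (by positivity)]
  exact ENNReal.ofReal_lt_top

/-- The Brunn-Minkowski inequality for the cone measure of a convexely derived measure. -/
theorem IsConvexelyDerived.mul_add_pow_le_coneMeasure {μ : ProbabilityMeasure (UnitSphere n)}
    (hμ : IsConvexelyDerived μ) {x y : AmbientSpace n} {r s : ℝ} {c : ℝ≥0∞} {α β : ℝ}
    (hα : 0 < α) (hβ : 0 < β)
    (hx : c * ENNReal.ofReal α ^ (n + 1) < coneMeasure (μ : Measure (UnitSphere n))
      (Metric.ball x r))
    (hy : c * ENNReal.ofReal β ^ (n + 1) < coneMeasure (μ : Measure (UnitSphere n))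
      (Metric.ball y s)) :
    c * ENNReal.ofReal (α + β) ^ (n + 1) ≤ coneMeasure (μ : Measure (UnitSphere n))
      (Metric.closedBall (x + y) (r + s)) := by
  obtain ⟨S, ν, hS, hν⟩ := hμ
  -- The strict bounds on open balls pass from the limit to all late ν i; the resulting bound on the
  -- closed ball passes back to the limit.
  have h1 := eventually_lt_of_lt_liminf
    (hx.trans_le (coneMeasure_le_liminf hν Metric.isOpen_ball))
  have h2 := eventually_lt_of_lt_liminf
    (hy.trans_le (coneMeasure_le_liminf hν Metric.isOpen_ball))
  refine le_trans ?_ (limsup_coneMeasure_le hν Metric.isClosed_closedBall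
    (R := |r + s| + ‖x + y‖ + 1) (by positivity) fun z hz => ?_)
  · refine le_limsup_of_frequently_le (Eventually.frequently ?_)
    filter_upwards [h1, h2] with i h1 h2
    obtain ⟨hopen, -, hconv, hi⟩ := hS i
    rw [hi] at h1 h2 ⊢
    refine coneMeasure_cond_mul_add_pow_le hopen.measurableSet hconv.2
      Metric.isOpen_ball.measurableSet Metric.isOpen_ball.measurableSet
      Metric.isClosed_closedBall.measurableSet (fun a ha b hb => ?_) hα hβ h1.le h2.le
    rw [mem_closedBall_iff_norm, add_sub_add_comm]
    rw [mem_ball_iff_norm] at ha hb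
    exact (norm_add_le _ _).trans (add_le_add ha.le hb.le)
  · rw [mem_closedBall_iff_norm] at hz
    rw [mem_ball_zero_iff]
    calc ‖z‖ = ‖(z - (x + y)) + (x + y)‖ := by simp
      _ ≤ ‖z - (x + y)‖ + ‖x + y‖ := norm_add_le _ _
      _ < _ := by linarith [le_abs_self (r + s)]

/-- Substituting ρ ↦ tρ in the radial integral of ρⁿ dρ produces the factor t^(n+1). -/
theorem coneMeasure_closedBall_smul (μ : Measure (UnitSphere n)) [SFinite μ] (x : AmbientSpace n)
    (r : ℝ) {t : ℝ} (ht : 0 < t) :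
    coneMeasure μ (Metric.closedBall (t • x) (t * r)) =
      ENNReal.ofReal t ^ (n + 1) * coneMeasure μ (Metric.closedBall x r) := by
  have hball : ∀ ρ : ℝ, {z : UnitSphere n | (t * ρ) • (z : AmbientSpace n) ∈
      Metric.closedBall (t • x) (t * r)} =
      {z : UnitSphere n | ρ • (z : AmbientSpace n) ∈ Metric.closedBall x r} := by
    intro ρ
    ext z
    simp only [Set.mem_ofPred_eq, mem_closedBall_iff_norm]
    rw [mul_smul, ← smul_sub, norm_smul, Real.norm_of_nonneg ht.le, mul_le_mul_iff_right₀ ht]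
  have hint : ∀ A : Set (AmbientSpace n), MeasurableSet A → coneMeasure μ A =
      ∫⁻ ρ in Set.Ioi (0 : ℝ), ENNReal.ofReal (ρ ^ n) *
        μ {z : UnitSphere n | ρ • (z : AmbientSpace n) ∈ A} := by
    intro A hA
    rw [coneMeasure_apply _ hA, Measure.volumeIoiPow, lintegral_withDensity_eq_lintegral_mul _
      (by fun_prop) (measurable_measure_smul_mem μ hA)]
    exact lintegral_subtype_comap measurableSet_Ioi
      (fun ρ : ℝ => ENNReal.ofReal (ρ ^ n) * μ {z : UnitSphere n | ρ • (z : AmbientSpace n) ∈ A})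
  rw [hint _ Metric.isClosed_closedBall.measurableSet,
    hint _ Metric.isClosed_closedBall.measurableSet]
  have himg : (fun ρ : ℝ => t * ρ) '' Set.Ioi 0 = Set.Ioi 0 := by
    rw [Set.image_mul_left_Ioi ht, mul_zero]
  conv_lhs => rw [← himg]
  rw [lintegral_image_eq_lintegral_abs_deriv_mul measurableSet_Ioi
    (f' := fun _ => t) (fun ρ _ => by simpa using ((hasDerivAt_id ρ).const_mul t).hasDerivWithinAt)
    (fun a _ b _ hab => mul_left_cancel₀ ht.ne' hab),
    ← lintegral_const_mul' _ _ (by simp)]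
  refine setLIntegral_congr_fun measurableSet_Ioi fun ρ hρ => ?_
  rw [hball, abs_of_pos ht, mul_pow, ENNReal.ofReal_mul (by positivity),
    ENNReal.ofReal_pow ht.le]
  ring

theorem coneMeasure_compl_coneOver_support (μ : Measure (UnitSphere n)) [SFinite μ] :
    coneMeasure μ (coneOver μ.support)ᶜ = 0 := by
  rw [coneMeasure_apply _ (measurableSet_coneOver Measure.isClosed_support.measurableSet).compl]
  refine (lintegral_congr fun r => ?_).trans lintegral_zero
  have : {x : UnitSphere n | (r : ℝ) • (x : AmbientSpace n) ∈ (coneOver μ.support)ᶜ} =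
      μ.supportᶜ := by
    ext x
    simp [smul_mem_coneOver_iff (S := μ.support) r.2]
  rw [this, Measure.measure_compl_support]

theorem volumeIoiPow_Ioo_pos {a b : Set.Ioi (0 : ℝ)} (hab : a < b) :
    0 < Measure.volumeIoiPow n (Set.Ioo a b) := by
  -- An intermediate c gives Iio b ⊆ Iio c ∪ Ioo a b without treating the endpoint a, and the masses
  -- of Iio c and Iio b are explicit.
  obtain ⟨c, hac, hcb⟩ := exists_between hab
  have hlt : Measure.volumeIoiPow n (Set.Iio c) < Measure.volumeIoiPow n (Set.Iio b) := by
    rw [Measure.volumeIoiPow_apply_Iio, Measure.volumeIoiPow_apply_Iio]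
    have hc : (0 : ℝ) < c := c.2
    have hcb' : (c : ℝ) < b := hcb
    have hb : (0 : ℝ) < b := b.2
    exact (ENNReal.ofReal_lt_ofReal_iff (by positivity)).2 (by gcongr)
  refine pos_iff_ne_zero.2 fun h0 => absurd hlt (not_lt.2 ?_)
  calc Measure.volumeIoiPow n (Set.Iio b)
      ≤ Measure.volumeIoiPow n (Set.Iio c ∪ Set.Ioo a b) := measure_mono fun x hx => by
        rcases lt_or_ge x c with h | h
        · exact Or.inl h
        · exact Or.inr ⟨hac.trans_le h, hx⟩
    _ ≤ _ := (measure_union_le _ _).trans (by simp [h0])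

theorem coneMeasure_pos_of_isOpen (μ : Measure (UnitSphere n)) [SFinite μ] {x : UnitSphere n}
    (hx : x ∈ μ.support) {t : ℝ} (ht : 0 < t) {G : Set (AmbientSpace n)} (hG : IsOpen G)
    (hxG : t • (x : AmbientSpace n) ∈ G) : 0 < coneMeasure μ G := by
  rw [coneMeasure_apply _ hG.measurableSet,
    lintegral_pos_iff_support (measurable_measure_smul_mem μ hG.measurableSet)]
  have hcont : Continuous fun r : ℝ => r • (x : AmbientSpace n) := by fun_prop
  obtain ⟨η, hη, hball⟩ := Metric.isOpen_iff.1 (hG.preimage hcont) t hxG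
  refine (volumeIoiPow_Ioo_pos (n := n) (a := ⟨t, ht⟩)
    (b := ⟨t + η, add_pos ht hη⟩) (Subtype.mk_lt_mk.2 (by linarith))).trans_le
    (measure_mono fun r hr => ?_)
  have h1 : t < r := hr.1
  have h2 : (r : ℝ) < t + η := hr.2
  have hmem : (r : ℝ) • (x : AmbientSpace n) ∈ G := hball (by
    rw [Metric.mem_ball, Real.dist_eq, abs_lt]
    constructor <;> linarith)
  exact ((Measure.mem_support_iff_forall x).1 hx _
    ((hG.preimage (continuous_smul_sphere (r : ℝ))).mem_nhds hmem)).ne'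

theorem coneMeasure_ball_pos (μ : Measure (UnitSphere n)) [SFinite μ] {y : AmbientSpace n}
    (hy : y ∈ coneOver μ.support) {ρ : ℝ} (hρ : 0 < ρ) : 0 < coneMeasure μ (Metric.ball y ρ) := by
  obtain ⟨t, ht, x, hx, rfl⟩ := hy
  -- The radius t may be zero; t + ρ/2 is positive and still gives a point of the ball.
  refine coneMeasure_pos_of_isOpen μ hx (t := t + ρ / 2) (by positivity) Metric.isOpen_ball ?_
  rw [mem_ball_iff_norm, ← sub_smul, norm_smul, norm_unitSphere, mul_one, Real.norm_eq_abs,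
    abs_of_nonneg (by linarith)]
  linarith

theorem isClosed_coneOver {S : Set (UnitSphere n)} (hS : IsClosed S) : IsClosed (coneOver S) := by
  rcases S.eq_empty_or_nonempty with rfl | hne
  · have : coneOver (∅ : Set (UnitSphere n)) = ∅ := by ext y; simp [coneOver]
    simp [this]
  refine IsSeqClosed.isClosed fun u y hu huy => ?_
  choose t ht x hx hux using hu
  have hnorm : ∀ i, t i = ‖u i‖ := fun i => by
    rw [hux i, norm_smul, norm_unitSphere, mul_one, Real.norm_of_nonneg (ht i)]
  have htlim : Tendsto t atTop (𝓝 ‖y‖) := by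
    simp_rw [funext hnorm]
    exact huy.norm
  obtain ⟨z, hz, φ, hφ, hlim⟩ := hS.isCompact.tendsto_subseq hx
  refine ⟨‖y‖, norm_nonneg _, z, hz, ?_⟩
  refine tendsto_nhds_unique (huy.comp hφ.tendsto_atTop) ?_
  have := (htlim.comp hφ.tendsto_atTop).smul ((continuous_subtype_val.tendsto z).comp hlim)
  refine this.congr fun i => ?_
  simp [hux]

/-- If x + y were outside the closed cone, a small ball around it would have mass zero, whereas
Brunn-Minkowski with α = β = 1 bounds that mass below by c · 2^(n+1), with c > 0 smaller than the
masses of balls around x and y. -/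
theorem IsConvexelyDerived.add_mem_coneOver_support {μ : ProbabilityMeasure (UnitSphere n)}
    (hμ : IsConvexelyDerived μ) {x y : AmbientSpace n}
    (hx : x ∈ coneOver (μ : Measure (UnitSphere n)).support)
    (hy : y ∈ coneOver (μ : Measure (UnitSphere n)).support) :
    x + y ∈ coneOver (μ : Measure (UnitSphere n)).support := by
  by_contra hxy
  obtain ⟨ρ, hρ, hball⟩ := Metric.isOpen_iff.1
    (isClosed_coneOver (Measure.isClosed_support (μ := (μ : Measure (UnitSphere n))))).isOpen_compl
    _ hxy
  have hx' := coneMeasure_ball_pos (μ : Measure (UnitSphere n)) hx (ρ := ρ / 4) (by positivity)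
  have hy' := coneMeasure_ball_pos (μ : Measure (UnitSphere n)) hy (ρ := ρ / 4) (by positivity)
  obtain ⟨c, hc0, hc⟩ := exists_between (lt_min hx' hy')
  have h := hμ.mul_add_pow_le_coneMeasure (x := x) (y := y) (r := ρ / 4) (s := ρ / 4) (c := c)
    one_pos one_pos (by simpa using (lt_min_iff.1 hc).1) (by simpa using (lt_min_iff.1 hc).2)
  have h0 : coneMeasure (μ : Measure (UnitSphere n))
      (Metric.closedBall (x + y) (ρ / 4 + ρ / 4)) = 0 :=
    measure_mono_null ((Metric.closedBall_subset_ball (by linarith)).trans hball)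
      (coneMeasure_compl_coneOver_support _)
  rw [h0, nonpos_iff_eq_zero, mul_eq_zero] at h
  rcases h with h | h
  · exact hc0.ne' h
  · simp at h
    linarith

theorem convex_coneOver_of_add_mem {S : Set (UnitSphere n)}
    (h : ∀ x ∈ coneOver S, ∀ y ∈ coneOver S, x + y ∈ coneOver S) : Convex ℝ (coneOver S) :=
  fun _ hx _ hy _ _ ha hb _ => h _ (smul_mem_coneOver hx ha) _ (smul_mem_coneOver hy hb)

end coneMeasure

/-! ### Brunn-Minkowski cone measures and their densities -/

/-- A homogeneous measure of degree `N` whose support is a solid closed convex cone `K` and which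
satisfies the Brunn-Minkowski inequality on balls. -/
structure IsBrunnMinkowskiCone {V : Type*} [NormedAddCommGroup V] [NormedSpace ℝ V]
    [MeasurableSpace V] (Λ : Measure V) (N : ℕ) (K : Set V) : Prop where
  isLocallyFinite : IsLocallyFiniteMeasure Λ
  isClosed : IsClosed K
  add_mem : ∀ x ∈ K, ∀ y ∈ K, x + y ∈ K
  smul_mem : ∀ x ∈ K, ∀ t : ℝ, 0 ≤ t → t • x ∈ K
  interior_nonempty : (interior K).Nonempty
  measure_compl : Λ Kᶜ = 0
  measure_ball_pos : ∀ x ∈ K, ∀ r : ℝ, 0 < r → 0 < Λ (Metric.ball x r)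
  closedBall_smul : ∀ (x : V) (r t : ℝ), 0 < t →
    Λ (Metric.closedBall (t • x) (t * r)) = ENNReal.ofReal t ^ N * Λ (Metric.closedBall x r)
  mul_add_pow_le : ∀ (x y : V) (r s : ℝ) (c : ℝ≥0∞) (α β : ℝ), 0 < α → 0 < β →
    c * ENNReal.ofReal α ^ N < Λ (Metric.ball x r) →
    c * ENNReal.ofReal β ^ N < Λ (Metric.ball y s) →
    c * ENNReal.ofReal (α + β) ^ N ≤ Λ (Metric.closedBall (x + y) (r + s))

/-- The lower density of `Λ` with respect to `ω`. -/
def lowerDensity {V : Type*} [PseudoMetricSpace V] [MeasurableSpace V] (Λ ω : Measure V) (x : V) :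
    ℝ≥0∞ :=
  liminf (fun r => Λ (Metric.closedBall x r) / ω (Metric.closedBall x r)) (𝓝[>] 0)

section lowerDensity

variable {V : Type*} [NormedAddCommGroup V] [NormedSpace ℝ V] [FiniteDimensional ℝ V]
  [MeasurableSpace V] [BorelSpace V]

theorem eventually_lt_of_lt_lowerDensity {Λ ω : Measure V} [ω.IsAddHaarMeasure] {x : V} {c : ℝ≥0∞}
    (hc : c < lowerDensity Λ ω x) :
    ∀ᶠ r in 𝓝[>] (0 : ℝ), c * (ENNReal.ofReal r ^ Module.finrank ℝ V * ω (Metric.ball 0 1)) <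
      Λ (Metric.closedBall x r) := by
  filter_upwards [eventually_lt_of_lt_liminf hc, self_mem_nhdsWithin] with r hr hr0
  have hr0' : (0 : ℝ) < r := hr0
  rw [← ENNReal.ofReal_pow hr0'.le, ← Measure.addHaar_closedBall ω x hr0'.le]
  rwa [ENNReal.lt_div_iff_mul_lt (Or.inl (Metric.measure_closedBall_pos ω x hr0').ne')
    (Or.inl measure_closedBall_lt_top.ne)] at hr

theorem le_lowerDensity {Λ ω : Measure V} [ω.IsAddHaarMeasure] {x : V} {c : ℝ≥0∞}
    (hc : ∀ᶠ r in 𝓝[>] (0 : ℝ),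
      c * (ENNReal.ofReal r ^ Module.finrank ℝ V * ω (Metric.ball 0 1)) ≤
        Λ (Metric.closedBall x r)) :
    c ≤ lowerDensity Λ ω x := by
  refine le_liminf_of_le (by isBoundedDefault) ?_
  filter_upwards [hc, self_mem_nhdsWithin] with r hr hr0
  have hr0' : (0 : ℝ) < r := hr0
  rw [← ENNReal.ofReal_pow hr0'.le, ← Measure.addHaar_closedBall ω x hr0'.le] at hr
  rwa [ENNReal.le_div_iff_mul_le (Or.inl (Metric.measure_closedBall_pos ω x hr0').ne')
    (Or.inl measure_closedBall_lt_top.ne)]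

/-- By Besicovitch differentiation the ratios on balls converge almost everywhere to the
Radon-Nikodym derivative. The lower limit is a representative defined everywhere, so inequalities
between balls become pointwise inequalities. -/
theorem withDensity_lowerDensity {Λ ω : Measure V} [IsLocallyFiniteMeasure Λ]
    [ω.IsAddHaarMeasure] (h : Λ ≪ ω) : ω.withDensity (lowerDensity Λ ω) = Λ := by
  rw [← Measure.withDensity_rnDeriv_eq Λ ω h]
  refine withDensity_congr_ae ?_
  filter_upwards [Besicovitch.ae_tendsto_rnDeriv Λ ω] with x hx
  rw [Measure.withDensity_rnDeriv_eq Λ ω h]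
  exact hx.liminf_eq

theorem tendsto_const_mul_nhdsGT_zero {t : ℝ} (ht : 0 < t) :
    Tendsto (fun r => t * r) (𝓝[>] (0 : ℝ)) (𝓝[>] 0) := by
  refine tendsto_nhdsWithin_iff.2 ⟨?_, ?_⟩
  · have : Tendsto (fun r : ℝ => t * r) (𝓝 0) (𝓝 (t * 0)) := tendsto_id.const_mul t
    rw [mul_zero] at this
    exact this.mono_left nhdsWithin_le_nhds
  · filter_upwards [self_mem_nhdsWithin] with r hr
    exact mul_pos ht hr

end lowerDensity

namespace IsBrunnMinkowskiCone

theorem convex {V : Type*} [NormedAddCommGroup V] [NormedSpace ℝ V] [MeasurableSpace V]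
    {Λ : Measure V} {N : ℕ} {K : Set V} (h : IsBrunnMinkowskiCone Λ N K) : Convex ℝ K :=
  fun x hx y hy a b ha hb _ => h.add_mem _ (h.smul_mem x hx a ha) _ (h.smul_mem y hy b hb)

variable {V : Type*} [NormedAddCommGroup V] [NormedSpace ℝ V] [FiniteDimensional ℝ V]
  [MeasurableSpace V] [BorelSpace V] {Λ : Measure V} {N m : ℕ} {K : Set V}

/-- Brunn-Minkowski with α = 1 and a tiny β: balls around w ∈ K have positive mass, so c β^N is
below the mass of a ball of radius s - r around w once β is small. This gives c ≤ c(1 + β)^N ≤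
Λ(closedBall (x + w) s), and then s decreases to r. -/
theorem ball_le_closedBall_add (h : IsBrunnMinkowskiCone Λ N K) {w : V} (hw : w ∈ K) (x : V)
    (r : ℝ) (hN : N ≠ 0) : Λ (Metric.ball x r) ≤ Λ (Metric.closedBall (x + w) r) := by
  have := h.isLocallyFinite
  have hstep : ∀ s : ℝ, r < s → Λ (Metric.ball x r) ≤ Λ (Metric.closedBall (x + w) s) := by
    intro s hs
    refine le_of_forall_lt_imp_le_of_dense fun c hc => ?_
    have hpos := h.measure_ball_pos w hw (s - r) (by linarith)
    have hlim : Tendsto (fun β : ℝ => c * ENNReal.ofReal β ^ N) (𝓝[>] 0) (𝓝 0) := by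
      have h1 : Tendsto (fun β : ℝ => c * ENNReal.ofReal β ^ N) (𝓝 0)
          (𝓝 (c * ENNReal.ofReal 0 ^ N)) := by
        refine ENNReal.Tendsto.const_mul ?_ (Or.inr (hc.trans_le le_top).ne)
        exact ENNReal.Tendsto.pow (ENNReal.tendsto_ofReal tendsto_id)
      simp only [ENNReal.ofReal_zero, zero_pow hN, mul_zero] at h1
      exact h1.mono_left nhdsWithin_le_nhds
    obtain ⟨β, hβ, hβ0⟩ := ((hlim.eventually_lt_const hpos).and self_mem_nhdsWithin).exists
    have hβ0' : (0 : ℝ) < β := hβ0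
    have key := h.mul_add_pow_le x w r (s - r) c 1 β one_pos hβ0' (by simpa using hc) hβ
    rw [add_sub_cancel] at key
    refine le_trans ?_ key
    refine le_mul_of_one_le_right' ?_
    exact one_le_pow₀ (by simpa using hβ0'.le)
  have hlim : Tendsto (fun s => Λ (Metric.closedBall (x + w) s)) (𝓝[>] r)
      (𝓝 (Λ (⋂ s > r, Metric.closedBall (x + w) s))) :=
    tendsto_measure_biInter_gt
      (fun s _ => Metric.isClosed_closedBall.measurableSet.nullMeasurableSet)
      (fun _ _ _ hij => Metric.closedBall_subset_closedBall hij)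
      ⟨r + 1, by simp, measure_closedBall_lt_top.ne⟩
  have hinter : ⋂ s > r, Metric.closedBall (x + w) s = Metric.closedBall (x + w) r := by
    ext z
    simp only [Set.mem_iInter, Metric.mem_closedBall]
    exact ⟨fun hz => le_of_forall_gt_imp_ge_of_dense hz, fun hz s hs => hz.trans hs.le⟩
  rw [hinter] at hlim
  refine ge_of_tendsto hlim ?_
  filter_upwards [self_mem_nhdsWithin] with s hs using hstep s hs

/-- The translation inequality is averaged over w in a ball B ⊆ K. By Tonelli, each point z lies in
the ball around x + w only for w in a ball of radius r, so Λ(ball x r) ω(B) ≤ Λ(T) ω(closedBall 0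
r). -/
theorem exists_closedBall_le (h : IsBrunnMinkowskiCone Λ N K) (hN : N ≠ 0) (ω : Measure V)
    [ω.IsAddHaarMeasure] (R : ℝ) :
    ∃ C : NNReal, ∀ x : V, ‖x‖ ≤ R → ∀ r : ℝ, 0 < r → r ≤ 1 →
      Λ (Metric.closedBall x r) ≤ C * ω (Metric.closedBall x r) := by
  have := h.isLocallyFinite
  obtain ⟨x₀, hx₀⟩ := h.interior_nonempty
  obtain ⟨δ, hδ, hball⟩ := Metric.isOpen_iff.1 isOpen_interior x₀ hx₀
  have hballK : Metric.ball x₀ δ ⊆ K := hball.trans interior_subset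
  set B := Metric.ball x₀ δ
  -- T contains every closed ball of radius at most 2 around x + w with ‖x‖ ≤ R and w ∈ B. Radii up
  -- to 2 occur because a closed ball of radius r is enclosed in an open one of radius 2r.
  set T := Metric.closedBall (0 : V) (R + (‖x₀‖ + δ) + 2)
  have hT : Λ T ≠ ∞ := measure_closedBall_lt_top.ne
  have hB0 : ω B ≠ 0 := (Metric.measure_ball_pos ω x₀ hδ).ne'
  have hB1 : ω B ≠ ∞ := measure_ball_lt_top.ne
  have key : ∀ x : V, ‖x‖ ≤ R → ∀ r : ℝ, 0 < r → r ≤ 2 →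
      Λ (Metric.ball x r) * ω B ≤ Λ T * ω (Metric.closedBall 0 r) := by
    intro x hx r hr hr1
    set P : Set (V × V) := {p | dist p.2 (x + p.1) ≤ r} with hP
    have hPm : MeasurableSet P :=
      (isClosed_le (by fun_prop) continuous_const).measurableSet
    calc Λ (Metric.ball x r) * ω B
        = ∫⁻ w in B, Λ (Metric.ball x r) ∂ω := by rw [setLIntegral_const]
      _ ≤ ∫⁻ w in B, (Λ.restrict T) (Prod.mk w ⁻¹' P) ∂ω := by
          refine setLIntegral_mono' Metric.isOpen_ball.measurableSet fun w hw => ?_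
          refine (h.ball_le_closedBall_add (hballK hw) x r hN).trans ?_
          rw [Measure.restrict_apply (measurable_prodMk_left hPm)]
          refine measure_mono fun z hz => ⟨hz, ?_⟩
          rw [mem_closedBall_zero_iff]
          rw [mem_closedBall_iff_norm] at hz
          have hw' : ‖w‖ < ‖x₀‖ + δ := by
            rw [mem_ball_iff_norm] at hw
            calc ‖w‖ = ‖x₀ + (w - x₀)‖ := by simp
              _ ≤ ‖x₀‖ + ‖w - x₀‖ := norm_add_le _ _
              _ < _ := by linarith
          calc ‖z‖ = ‖(z - (x + w)) + (x + w)‖ := by simp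
            _ ≤ ‖z - (x + w)‖ + (‖x‖ + ‖w‖) := (norm_add_le _ _).trans (by gcongr; exact norm_add_le _ _)
            _ ≤ _ := by linarith
      _ = ∫⁻ z in T, (ω.restrict B) ((fun w => (w, z)) ⁻¹' P) ∂Λ := by
          rw [← Measure.prod_apply hPm, ← Measure.prod_apply_symm hPm]
      _ ≤ ∫⁻ z in T, ω (Metric.closedBall 0 r) ∂Λ := by
          refine lintegral_mono fun z => (Measure.restrict_apply_le _ _).trans ?_
          rw [Measure.addHaar_closedBall ω 0 hr.le, ← Measure.addHaar_closedBall ω (z - x) hr.le]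
          refine measure_mono fun w hw => ?_
          have hw' : dist z (x + w) ≤ r := hw
          rw [mem_closedBall_iff_norm]
          rw [dist_comm, dist_eq_norm] at hw'
          convert hw' using 2
          abel
      _ = _ := by rw [setLIntegral_const, mul_comm]
  have hC : Λ T * (ω B)⁻¹ * ENNReal.ofReal (2 ^ Module.finrank ℝ V) ≠ ∞ :=
    ENNReal.mul_ne_top (ENNReal.mul_ne_top hT (ENNReal.inv_ne_top.2 hB0)) ENNReal.ofReal_ne_top
  refine ⟨(Λ T * (ω B)⁻¹ * ENNReal.ofReal (2 ^ Module.finrank ℝ V)).toNNReal,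
    fun x hx r hr hr1 => ?_⟩
  rw [ENNReal.coe_toNNReal hC]
  have h2 := key x hx (2 * r) (by positivity) (by linarith)
  calc Λ (Metric.closedBall x r) ≤ Λ (Metric.ball x (2 * r)) :=
        measure_mono (Metric.closedBall_subset_ball (by linarith))
    _ = Λ (Metric.ball x (2 * r)) * ω B * (ω B)⁻¹ := by
        rw [mul_assoc, ENNReal.mul_inv_cancel hB0 hB1, mul_one]
    _ ≤ Λ T * ω (Metric.closedBall 0 (2 * r)) * (ω B)⁻¹ := by gcongr
    _ = _ := by
        rw [Measure.addHaar_closedBall ω 0 (by positivity), Measure.addHaar_closedBall ω x hr.le,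
          mul_pow, ENNReal.ofReal_mul (by positivity)]
        ring

/-- The ratio bound on small balls is uniform on bounded sets, so the Besicovitch covering theorem
turns it into Λ ≤ C ω on bounded pieces. -/
theorem absolutelyContinuous (h : IsBrunnMinkowskiCone Λ N K) (hN : N ≠ 0) (ω : Measure V)
    [ω.IsAddHaarMeasure] : Λ ≪ ω := by
  have := h.isLocallyFinite
  refine Measure.AbsolutelyContinuous.mk fun s _ hs => ?_
  have hcover : s = ⋃ n : ℕ, s ∩ Metric.closedBall 0 n := by
    rw [← Set.inter_iUnion, Metric.iUnion_closedBall_nat, Set.inter_univ]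
  rw [hcover]
  refine measure_iUnion_null fun n => ?_
  obtain ⟨C, hC⟩ := h.exists_closedBall_le hN ω n
  have hle := (Besicovitch.vitaliFamily Λ).measure_le_of_frequently_le (C • ω)
    Measure.AbsolutelyContinuous.rfl (s ∩ Metric.closedBall 0 n) (fun x hx => by
      refine (Besicovitch.tendsto_filterAt Λ x).frequently (Eventually.frequently ?_)
      filter_upwards [Ioc_mem_nhdsGT (zero_lt_one' ℝ)] with r hr
      simpa using hC x (by simpa using hx.2) r hr.1 hr.2)
  refine le_antisymm (hle.trans ?_) bot_le
  rw [Measure.smul_apply, measure_mono_null Set.inter_subset_left hs, smul_zero]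

/-- Spheres are null by absolute continuity. This reconciles Brunn-Minkowski, whose hypotheses
concern open balls, with the lower density, defined by closed ones. -/
theorem closedBall_eq_ball (h : IsBrunnMinkowskiCone Λ N K) (hN : N ≠ 0) (x : V) {r : ℝ}
    (hr : r ≠ 0) : Λ (Metric.closedBall x r) = Λ (Metric.ball x r) := by
  have hsph : Λ (Metric.sphere x r) = 0 :=
    h.absolutelyContinuous hN Measure.addHaar (Measure.addHaar_sphere_of_ne_zero _ x hr)
  refine le_antisymm ?_ (measure_mono Metric.ball_subset_closedBall)
  rw [← Metric.ball_union_sphere]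
  exact (measure_union_le _ _).trans (by simp [hsph])

variable (ω : Measure V) [ω.IsAddHaarMeasure]

theorem exists_lowerDensity_le (h : IsBrunnMinkowskiCone Λ N K) (hN : N ≠ 0) (R : ℝ) :
    ∃ C : NNReal, ∀ x : V, ‖x‖ ≤ R → lowerDensity Λ ω x ≤ C := by
  obtain ⟨C, hC⟩ := h.exists_closedBall_le hN ω R
  refine ⟨C, fun x hx => ?_⟩
  refine liminf_le_of_frequently_le' (Eventually.frequently ?_)
  filter_upwards [Ioc_mem_nhdsGT (zero_lt_one' ℝ)] with r hr
  exact ENNReal.div_le_of_le_mul (hC x hx r hr.1 hr.2)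

theorem lowerDensity_ne_top (h : IsBrunnMinkowskiCone Λ N K) (hN : N ≠ 0) (x : V) :
    lowerDensity Λ ω x ≠ ∞ := by
  obtain ⟨C, hC⟩ := h.exists_lowerDensity_le ω hN ‖x‖
  exact ((hC x le_rfl).trans_lt ENNReal.coe_lt_top).ne

theorem lowerDensity_le_add (h : IsBrunnMinkowskiCone Λ N K) (hN : N ≠ 0) (x : V) {w : V}
    (hw : w ∈ K) : lowerDensity Λ ω x ≤ lowerDensity Λ ω (x + w) := by
  refine le_of_forall_lt_imp_le_of_dense fun c hc => le_lowerDensity ?_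
  filter_upwards [eventually_lt_of_lt_lowerDensity hc, self_mem_nhdsWithin] with r hr hr0
  have hr0' : (0 : ℝ) < r := hr0
  rw [h.closedBall_eq_ball hN x hr0'.ne'] at hr
  exact hr.le.trans (h.ball_le_closedBall_add hw x r hN)

/-- The mass of a ball scales with degree N and its volume with the dimension, which leaves degree
m. The reverse inequality is this one applied to t • x and t⁻¹. -/
theorem mul_lowerDensity_le (h : IsBrunnMinkowskiCone Λ N K) (hNm : N = Module.finrank ℝ V + m)
    (x : V) {t : ℝ} (ht : 0 < t) :
    ENNReal.ofReal t ^ m * lowerDensity Λ ω x ≤ lowerDensity Λ ω (t • x) := by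
  have ht0 : ENNReal.ofReal t ≠ 0 := by simpa using ht
  have ht1 : ENNReal.ofReal t ≠ ∞ := ENNReal.ofReal_ne_top
  rw [mul_comm, ← ENNReal.le_div_iff_mul_le (Or.inl (pow_ne_zero _ ht0))
    (Or.inl (ENNReal.pow_ne_top ht1))]
  refine le_of_forall_lt_imp_le_of_dense fun c hc => ?_
  rw [ENNReal.le_div_iff_mul_le (Or.inl (pow_ne_zero _ ht0)) (Or.inl (ENNReal.pow_ne_top ht1))]
  refine le_lowerDensity ?_
  filter_upwards [(tendsto_const_mul_nhdsGT_zero (inv_pos.2 ht)).eventually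
    (eventually_lt_of_lt_lowerDensity hc), self_mem_nhdsWithin] with r hr hr0
  have hr0' : (0 : ℝ) < r := hr0
  have hball := h.closedBall_smul x (t⁻¹ * r) t ht
  rw [mul_inv_cancel_left₀ ht.ne'] at hball
  have hmul : ENNReal.ofReal t * ENNReal.ofReal (t⁻¹ * r) = ENNReal.ofReal r := by
    rw [← ENNReal.ofReal_mul ht.le, mul_inv_cancel_left₀ ht.ne']
  rw [hball, hNm, ← hmul]
  calc _ = ENNReal.ofReal t ^ (Module.finrank ℝ V + m) *
        (c * (ENNReal.ofReal (t⁻¹ * r) ^ Module.finrank ℝ V * ω (Metric.ball 0 1))) := by ring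
    _ ≤ _ := by gcongr

theorem lowerDensity_smul (h : IsBrunnMinkowskiCone Λ N K) (hNm : N = Module.finrank ℝ V + m)
    (x : V) {t : ℝ} (ht : 0 < t) :
    lowerDensity Λ ω (t • x) = ENNReal.ofReal t ^ m * lowerDensity Λ ω x := by
  refine le_antisymm ?_ (h.mul_lowerDensity_le ω hNm x ht)
  have := h.mul_lowerDensity_le ω hNm (t • x) (inv_pos.2 ht)
  rw [smul_smul, inv_mul_cancel₀ ht.ne', one_smul] at this
  calc lowerDensity Λ ω (t • x)
      = ENNReal.ofReal t ^ m * (ENNReal.ofReal t⁻¹ ^ m * lowerDensity Λ ω (t • x)) := by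
        rw [← mul_assoc, ← mul_pow, ← ENNReal.ofReal_mul ht.le, mul_inv_cancel₀ ht.ne']
        simp
    _ ≤ _ := by gcongr

/-- Balls of radii ar/(a + b) and br/(a + b) around x and y have masses close to c a^N and c b^N
with the same c, because the densities aᵐ and bᵐ supply the missing powers. Brunn-Minkowski with α =
a and β = b is then sharp. The factor q < 1 provides the strict inequalities and tends to 1 at the
end. -/
theorem ofReal_add_pow_le_lowerDensity (h : IsBrunnMinkowskiCone Λ N K)
    (hNm : N = Module.finrank ℝ V + m) (hm : m ≠ 0) {x y : V} {a b : ℝ} (ha : 0 < a) (hb : 0 < b)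
    (hx : lowerDensity Λ ω x = ENNReal.ofReal a ^ m)
    (hy : lowerDensity Λ ω y = ENNReal.ofReal b ^ m) :
    ENNReal.ofReal (a + b) ^ m ≤ lowerDensity Λ ω (x + y) := by
  have hab : 0 < a + b := add_pos ha hb
  have hN : N ≠ 0 := by omega
  have main : ∀ q : ℝ, 0 < q → q < 1 →
      ENNReal.ofReal q ^ m * ENNReal.ofReal (a + b) ^ m ≤ lowerDensity Λ ω (x + y) := by
    intro q hq0 hq1
    have hlt : ∀ u : ℝ, 0 < u → ENNReal.ofReal q ^ m * ENNReal.ofReal u ^ m <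
        ENNReal.ofReal u ^ m := by
      intro u hu
      rw [← mul_pow, ← ENNReal.ofReal_mul hq0.le]
      have hqu : ENNReal.ofReal (q * u) < ENNReal.ofReal u :=
        (ENNReal.ofReal_lt_ofReal_iff hu).2 (by nlinarith)
      exact ENNReal.pow_lt_pow_left hm hqu
    refine le_lowerDensity ?_
    have hsc : ∀ u : ℝ, 0 < u → Tendsto (fun r => u / (a + b) * r) (𝓝[>] (0 : ℝ)) (𝓝[>] 0) :=
      fun u hu => tendsto_const_mul_nhdsGT_zero (by positivity)
    filter_upwards [(hsc a ha).eventually (eventually_lt_of_lt_lowerDensity ((hlt a ha).trans_eq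
      hx.symm)), (hsc b hb).eventually (eventually_lt_of_lt_lowerDensity ((hlt b hb).trans_eq
      hy.symm)), self_mem_nhdsWithin] with r hra hrb hr0
    have hr0' : (0 : ℝ) < r := hr0
    set c := ENNReal.ofReal q ^ m *
      (ENNReal.ofReal (r / (a + b)) ^ Module.finrank ℝ V * ω (Metric.ball 0 1)) with hc
    have hform : ∀ u : ℝ, 0 < u → c * ENNReal.ofReal u ^ N =
        ENNReal.ofReal q ^ m * ENNReal.ofReal u ^ m *
          (ENNReal.ofReal (u / (a + b) * r) ^ Module.finrank ℝ V * ω (Metric.ball 0 1)) := by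
      intro u hu
      have : u / (a + b) * r = u * (r / (a + b)) := by ring
      rw [this, ENNReal.ofReal_mul hu.le, hc, hNm]
      ring
    rw [h.closedBall_eq_ball hN _ (by positivity), ← hform a ha] at hra
    rw [h.closedBall_eq_ball hN _ (by positivity), ← hform b hb] at hrb
    have := h.mul_add_pow_le _ _ _ _ _ _ _ ha hb hra hrb
    rw [hform _ hab, ← add_mul, ← add_div, div_self hab.ne', one_mul] at this
    exact this
  have hlim : Tendsto (fun q : ℝ => ENNReal.ofReal q ^ m * ENNReal.ofReal (a + b) ^ m) (𝓝[<] 1)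
      (𝓝 (ENNReal.ofReal 1 ^ m * ENNReal.ofReal (a + b) ^ m)) := by
    refine Tendsto.mono_left ?_ nhdsWithin_le_nhds
    refine ENNReal.Tendsto.mul_const ?_ (Or.inr (ENNReal.pow_ne_top ENNReal.ofReal_ne_top))
    exact ENNReal.Tendsto.pow (ENNReal.tendsto_ofReal tendsto_id)
  simp only [ENNReal.ofReal_one, one_pow, one_mul] at hlim
  refine le_of_tendsto hlim ?_
  filter_upwards [Ioo_mem_nhdsLT (zero_lt_one' ℝ)] with q hq using main q hq.1 hq.2

/-- As Λ ≠ 0, the density is positive at some y, not necessarily in K. For small t > 0 the vector x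
- t • y is still in K, so the density at x is at least that at t • y. -/
theorem lowerDensity_pos (h : IsBrunnMinkowskiCone Λ N K) (hNm : N = Module.finrank ℝ V + m)
    (hN : N ≠ 0) {x : V} (hx : x ∈ interior K) : 0 < lowerDensity Λ ω x := by
  have := h.isLocallyFinite
  obtain ⟨y, hy⟩ : ∃ y, 0 < lowerDensity Λ ω y := by
    by_contra hcon
    push Not at hcon
    have hΛ : Λ = 0 := by
      rw [← withDensity_lowerDensity (h.absolutelyContinuous hN ω),
        show lowerDensity Λ ω = 0 from funext fun y => le_antisymm (hcon y) bot_le,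
        withDensity_zero]
    simpa [hΛ] using h.measure_ball_pos x (interior_subset hx) 1 one_pos
  have hlim : Tendsto (fun t : ℝ => x - t • y) (𝓝[>] 0) (𝓝 x) := by
    have : Tendsto (fun t : ℝ => x - t • y) (𝓝 0) (𝓝 (x - (0 : ℝ) • y)) :=
      (continuous_const.sub (continuous_id.smul continuous_const)).tendsto 0
    rw [zero_smul, sub_zero] at this
    exact this.mono_left nhdsWithin_le_nhds
  obtain ⟨t, htK, ht⟩ := ((hlim.eventually (isOpen_interior.mem_nhds hx)).and
    self_mem_nhdsWithin).exists
  have ht' : (0 : ℝ) < t := ht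
  calc 0 < ENNReal.ofReal t ^ m * lowerDensity Λ ω y :=
        ENNReal.mul_pos (pow_ne_zero _ (by simpa using ht')) hy.ne'
    _ = lowerDensity Λ ω (t • y) := (h.lowerDensity_smul ω hNm y ht').symm
    _ ≤ lowerDensity Λ ω (t • y + (x - t • y)) :=
        h.lowerDensity_le_add ω hN _ (interior_subset htK)
    _ = _ := by rw [add_sub_cancel]

end IsBrunnMinkowskiCone

/-- A positively homogeneous concave function on a solid closed convex cone, bounded on the unit
sphere. -/
structure IsConcaveGauge {V : Type*} [NormedAddCommGroup V] [NormedSpace ℝ V] (g : V → ℝ)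
    (K : Set V) : Prop where
  isClosed : IsClosed K
  add_mem : ∀ x ∈ K, ∀ y ∈ K, x + y ∈ K
  smul_mem : ∀ x ∈ K, ∀ t : ℝ, 0 ≤ t → t • x ∈ K
  interior_nonempty : (interior K).Nonempty
  nonneg : ∀ x, 0 ≤ g x
  map_smul : ∀ (x : V) (t : ℝ), 0 < t → g (t • x) = t * g x
  pos : ∀ x ∈ interior K, 0 < g x
  add_le : ∀ x ∈ interior K, ∀ y ∈ interior K, g x + g y ≤ g (x + y)
  continuousOn : ContinuousOn g (interior K)
  bounded : ∃ C : ℝ, ∀ x, ‖x‖ = 1 → g x ≤ C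

/-- The density of a Brunn-Minkowski cone measure is a power of a concave function. -/
theorem IsBrunnMinkowskiCone.exists_isConcaveGauge {V : Type*} [NormedAddCommGroup V]
    [NormedSpace ℝ V] [FiniteDimensional ℝ V] [MeasurableSpace V] [BorelSpace V] {Λ : Measure V}
    {N m : ℕ} {K : Set V} (h : IsBrunnMinkowskiCone Λ N K) (ω : Measure V) [ω.IsAddHaarMeasure]
    (hNm : N = Module.finrank ℝ V + m) (hm : m ≠ 0) :
    ∃ g : V → ℝ, IsConcaveGauge g K ∧ Λ = ω.withDensity fun x => ENNReal.ofReal (g x ^ m) := by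
  have := h.isLocallyFinite
  have hN : N ≠ 0 := by omega
  have hm' : (m : ℝ) ≠ 0 := by exact_mod_cast hm
  set D := lowerDensity Λ ω with hD
  set g : V → ℝ := fun x => (D x).toReal ^ (m : ℝ)⁻¹ with hg
  have hg0 : ∀ x, 0 ≤ g x := fun x => Real.rpow_nonneg ENNReal.toReal_nonneg _
  have hgpow : ∀ x, g x ^ m = (D x).toReal := fun x => Real.rpow_inv_natCast_pow
    ENNReal.toReal_nonneg hm
  have hgD : ∀ x, ENNReal.ofReal (g x ^ m) = D x := fun x => by
    rw [hgpow, ENNReal.ofReal_toReal (h.lowerDensity_ne_top ω hN x)]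
  have hgD' : ∀ x, D x = ENNReal.ofReal (g x) ^ m := fun x => by
    rw [← hgD, ENNReal.ofReal_pow (hg0 x)]
  have hpos : ∀ x ∈ interior K, 0 < g x := fun x hx =>
    Real.rpow_pos_of_pos (ENNReal.toReal_pos (h.lowerDensity_pos ω hNm hN hx).ne'
      (h.lowerDensity_ne_top ω hN x)) _
  have hle : ∀ {u : ℝ} {x : V}, 0 ≤ u → ENNReal.ofReal u ^ m ≤ D x → u ≤ g x := by
    intro u x hu hux
    rw [← ENNReal.ofReal_pow hu, ← hgD, ENNReal.ofReal_le_ofReal_iff (pow_nonneg (hg0 x) m)] at hux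
    exact le_of_pow_le_pow_left₀ hm (hg0 x) hux
  have hadd : ∀ x ∈ interior K, ∀ y ∈ interior K, g x + g y ≤ g (x + y) := fun x hx y hy =>
    hle (add_nonneg (hg0 x) (hg0 y)) (h.ofReal_add_pow_le_lowerDensity ω hNm hm (hpos x hx)
      (hpos y hy) (hgD' x) (hgD' y))
  have hsmul : ∀ (x : V) (t : ℝ), 0 < t → g (t • x) = t * g x := by
    intro x t ht
    have h1 : g (t • x) ^ m = (t * g x) ^ m := by
      rw [hgpow, hD, h.lowerDensity_smul ω hNm x ht, ENNReal.toReal_mul, ENNReal.toReal_pow,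
        ENNReal.toReal_ofReal ht.le, mul_pow, hgpow]
    exact (pow_left_inj₀ (hg0 _) (mul_nonneg ht.le (hg0 x)) hm).1 h1
  have hsmulK : ∀ x ∈ interior K, ∀ t : ℝ, 0 < t → t • x ∈ interior K := by
    intro x hx t ht
    have : t • interior K ⊆ interior K := by
      refine interior_maximal ?_ (isOpen_interior.smul₀ ht.ne')
      rintro _ ⟨z, hz, rfl⟩
      exact h.smul_mem z (interior_subset hz) t ht.le
    exact this (Set.smul_mem_smul_set hx)
  -- Homogeneity turns superadditivity into concavity, and a concave function on an open convex set
  -- in finite dimension is continuous.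
  have hconc : ConcaveOn ℝ (interior K) g := by
    refine ⟨h.convex.interior, fun x hx y hy a b ha hb hab => ?_⟩
    rcases ha.eq_or_lt with rfl | ha
    · have hb1 : b = 1 := by linarith
      simp [hb1]
    rcases hb.eq_or_lt with rfl | hb
    · have ha1 : a = 1 := by linarith
      simp [ha1]
    have := hadd _ (hsmulK x hx a ha) _ (hsmulK y hy b hb)
    rw [hsmul x a ha, hsmul y b hb] at this
    simpa using this
  refine ⟨g, ⟨h.isClosed, h.add_mem, h.smul_mem, h.interior_nonempty, hg0, hsmul, hpos, hadd,
    hconc.continuousOn isOpen_interior, ?_⟩, ?_⟩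
  · obtain ⟨C, hC⟩ := h.exists_lowerDensity_le ω hN 1
    refine ⟨(C : ℝ) ^ (m : ℝ)⁻¹, fun x hx => ?_⟩
    refine Real.rpow_le_rpow ENNReal.toReal_nonneg ?_ (by positivity)
    exact ENNReal.toReal_le_coe_of_le_coe (hC x hx.le)
  · rw [← withDensity_lowerDensity (h.absolutelyContinuous hN ω)]
    congr 1
    exact (funext hgD).symm

/-! ### Concave gauges and their peak -/

/-- The supremum of `g` over the unit vectors in the interior of `K`. -/
def peakValue {V : Type*} [NormedAddCommGroup V] (g : V → ℝ) (K : Set V) : ℝ :=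
  sSup (g '' (interior K ∩ Metric.sphere 0 1))

/-- `p` is a unit vector at which the upper limit of `g` along the unit vectors in the interior of
`K` is the supremum of `g` over these vectors. -/
def IsPeak {V : Type*} [NormedAddCommGroup V] (g : V → ℝ) (K : Set V) (p : V) : Prop :=
  ‖p‖ = 1 ∧ ∀ a < peakValue g K, ∃ᶠ x in 𝓝[interior K ∩ Metric.sphere 0 1] p, a < g x

/-- The density of the cone measure attached to the gauge `g`. -/
def gaugeDensity {V : Type*} [TopologicalSpace V] (g : V → ℝ) (K : Set V) (m : ℕ) : V → ℝ≥0∞ :=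
  (interior K).indicator fun x => ENNReal.ofReal (g x ^ m)

namespace IsConcaveGauge

section NormedSpace
variable {V : Type*} [NormedAddCommGroup V] [NormedSpace ℝ V] {g : V → ℝ} {K : Set V}

theorem map_zero (h : IsConcaveGauge g K) : g 0 = 0 := by
  have := h.map_smul 0 2 two_pos
  rw [smul_zero] at this
  linarith

theorem ne_zero (h : IsConcaveGauge g K) {x : V} (hx : x ∈ interior K) : x ≠ 0 := by
  rintro rfl
  exact (h.pos 0 hx).ne' h.map_zero

theorem smul_mem_interior (h : IsConcaveGauge g K) {x : V} (hx : x ∈ interior K) {t : ℝ}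
    (ht : 0 < t) : t • x ∈ interior K := by
  have : t • interior K ⊆ interior K := by
    refine interior_maximal ?_ (isOpen_interior.smul₀ ht.ne')
    rintro _ ⟨z, hz, rfl⟩
    exact h.smul_mem z (interior_subset hz) t ht.le
  exact this (Set.smul_mem_smul_set hx)

theorem add_mem_interior (h : IsConcaveGauge g K) {w x : V} (hw : w ∈ K) (hx : x ∈ interior K) :
    w + x ∈ interior K := by
  have : w +ᵥ interior K ⊆ interior K := by
    refine interior_maximal ?_ (isOpen_interior.vadd w)
    rintro _ ⟨z, hz, rfl⟩
    exact h.add_mem w hw z (interior_subset hz)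
  exact this ⟨x, hx, rfl⟩

theorem normalize_mem (h : IsConcaveGauge g K) {x : V} (hx : x ∈ interior K) :
    ‖x‖⁻¹ • x ∈ interior K ∩ Metric.sphere 0 1 := by
  have h0 : ‖x‖ ≠ 0 := norm_ne_zero_iff.2 (h.ne_zero hx)
  refine ⟨h.smul_mem_interior hx (inv_pos.2 (norm_pos_iff.2 (h.ne_zero hx))), ?_⟩
  rw [mem_sphere_zero_iff_norm, norm_smul, norm_inv, norm_norm, inv_mul_cancel₀ h0]

theorem bddAbove_image (h : IsConcaveGauge g K) :
    BddAbove (g '' (interior K ∩ Metric.sphere 0 1)) := by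
  obtain ⟨C, hC⟩ := h.bounded
  refine ⟨C, ?_⟩
  rintro _ ⟨x, hx, rfl⟩
  exact hC x (mem_sphere_zero_iff_norm.1 hx.2)

theorem nonempty_image (h : IsConcaveGauge g K) :
    (g '' (interior K ∩ Metric.sphere 0 1)).Nonempty := by
  obtain ⟨x, hx⟩ := h.interior_nonempty
  exact ⟨_, _, h.normalize_mem hx, rfl⟩

theorem le_peakValue (h : IsConcaveGauge g K) {x : V}
    (hx : x ∈ interior K ∩ Metric.sphere 0 1) : g x ≤ peakValue g K :=
  le_csSup h.bddAbove_image ⟨x, hx, rfl⟩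

theorem peakValue_pos (h : IsConcaveGauge g K) : 0 < peakValue g K := by
  obtain ⟨x, hx⟩ := h.interior_nonempty
  exact (h.pos _ (h.normalize_mem hx).1).trans_le (h.le_peakValue (h.normalize_mem hx))

theorem le_peakValue_mul_norm (h : IsConcaveGauge g K) {x : V} (hx : x ∈ interior K) :
    g x ≤ peakValue g K * ‖x‖ := by
  have h0 : 0 < ‖x‖ := norm_pos_iff.2 (h.ne_zero hx)
  have := h.le_peakValue (h.normalize_mem hx)
  rw [h.map_smul _ _ (inv_pos.2 h0), inv_mul_le_iff₀ h0] at this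
  linarith

/-- A maximising sequence of unit vectors has a limit point by compactness. It may lie on the
boundary of K, where g is not controlled; hence the formulation with upper limits. -/
theorem exists_isPeak [FiniteDimensional ℝ V] (h : IsConcaveGauge g K) : ∃ p, IsPeak g K p := by
  obtain ⟨u, -, hu, hmem⟩ := exists_seq_tendsto_sSup h.nonempty_image h.bddAbove_image
  choose x hx hxu using hmem
  obtain ⟨p, hp, φ, hφ, hlim⟩ := (isCompact_sphere (0 : V) 1).tendsto_subseq fun i => (hx i).2
  refine ⟨p, mem_sphere_zero_iff_norm.1 hp, fun a ha => ?_⟩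
  have hlim' : Tendsto (x ∘ φ) atTop (𝓝[interior K ∩ Metric.sphere 0 1] p) :=
    tendsto_nhdsWithin_iff.2 ⟨hlim, Eventually.of_forall fun i => hx _⟩
  refine hlim'.frequently (Eventually.frequently ?_)
  filter_upwards [(hu.comp hφ.tendsto_atTop).eventually_const_lt ha] with i hi
  simpa [hxu] using hi

theorem exists_seq_tendsto_peak (h : IsConcaveGauge g K) {p : V} (hp : IsPeak g K p) :
    ∃ u : ℕ → V, (∀ i, u i ∈ interior K ∩ Metric.sphere 0 1) ∧ Tendsto u atTop (𝓝 p) ∧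
      Tendsto (fun i => g (u i)) atTop (𝓝 (peakValue g K)) := by
  have hex : ∀ i : ℕ, ∃ x, x ∈ interior K ∩ Metric.sphere 0 1 ∧ dist x p < 1 / ((i : ℝ) + 1) ∧
      peakValue g K - 1 / ((i : ℝ) + 1) < g x := by
    intro i
    have hi : (0 : ℝ) < 1 / ((i : ℝ) + 1) := by positivity
    have hev : ∀ᶠ x in 𝓝[interior K ∩ Metric.sphere 0 1] p, dist x p < 1 / ((i : ℝ) + 1) :=
      mem_nhdsWithin_of_mem_nhds (Metric.ball_mem_nhds p hi)
    have := (hp.2 (peakValue g K - 1 / ((i : ℝ) + 1)) (by linarith)).and_eventually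
      (hev.and self_mem_nhdsWithin)
    obtain ⟨x, h1, h2, h3⟩ := this.exists
    exact ⟨x, h3, h2, h1⟩
  choose u hu hdist hval using hex
  refine ⟨u, hu, ?_, ?_⟩
  · rw [tendsto_iff_dist_tendsto_zero]
    exact squeeze_zero (fun _ => dist_nonneg) (fun i => (hdist i).le)
      tendsto_one_div_add_atTop_nhds_zero_nat
  · refine tendsto_of_tendsto_of_tendsto_of_le_of_le ?_ tendsto_const_nhds
      (fun i => (hval i).le) (fun i => h.le_peakValue (hu i))
    simpa using tendsto_const_nhds.sub (tendsto_one_div_add_atTop_nhds_zero_nat (𝕜 := ℝ))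

theorem isPeak_mem (h : IsConcaveGauge g K) {p : V} (hp : IsPeak g K p) : p ∈ K := by
  obtain ⟨u, hu, hlim, -⟩ := h.exists_seq_tendsto_peak hp
  exact h.isClosed.mem_of_tendsto hlim (Eventually.of_forall fun i => interior_subset (hu i).1)

/-- Superadditivity is applied along a sequence tending to p, and g is continuous at the interior
point a • p + y. At a boundary peak, `peakValue g K` thus plays the part of g p. -/
theorem mul_peakValue_add_le (h : IsConcaveGauge g K) {p y : V} (hp : IsPeak g K p)
    (hy : y ∈ interior K) {a : ℝ} (ha : 0 ≤ a) : a * peakValue g K + g y ≤ g (a • p + y) := by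
  rcases ha.eq_or_lt with rfl | ha
  · simp
  obtain ⟨u, hu, hlim, hval⟩ := h.exists_seq_tendsto_peak hp
  have hmem : a • p + y ∈ interior K :=
    h.add_mem_interior (h.smul_mem p (h.isPeak_mem hp) a ha.le) hy
  have hcont : Tendsto (fun i => g (a • u i + y)) atTop (𝓝 (g (a • p + y))) :=
    ((h.continuousOn.continuousAt (isOpen_interior.mem_nhds hmem)).tendsto).comp
      ((hlim.const_smul a).add_const y)
  refine le_of_tendsto_of_tendsto ((hval.const_mul a).add_const (g y)) hcont
    (Eventually.of_forall fun i => ?_)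
  have := h.add_le _ (h.smul_mem_interior (hu i).1 ha) y hy
  rwa [h.map_smul _ _ ha] at this

end NormedSpace

section InnerProductSpace
variable {V : Type*} [NormedAddCommGroup V] [InnerProductSpace ℝ V] {g : V → ℝ} {K : Set V}

/-- Superadditivity gives 2M ≤ M‖p + q‖, so ‖p + q‖ ≥ 2, and the parallelogram law forces p = q. -/
theorem isPeak_unique (h : IsConcaveGauge g K) {p q : V} (hp : IsPeak g K p) (hq : IsPeak g K q) :
    p = q := by
  obtain ⟨u, hu, hulim, huval⟩ := h.exists_seq_tendsto_peak hp
  obtain ⟨v, hv, hvlim, hvval⟩ := h.exists_seq_tendsto_peak hq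
  have hle : peakValue g K + peakValue g K ≤ peakValue g K * ‖p + q‖ := by
    refine le_of_tendsto_of_tendsto (huval.add hvval)
      (((hulim.add hvlim).norm).const_mul _) (Eventually.of_forall fun i => ?_)
    exact (h.add_le _ (hu i).1 _ (hv i).1).trans (h.le_peakValue_mul_norm
      (h.add_mem_interior (interior_subset (hu i).1) (hv i).1))
  have h2 : 2 ≤ ‖p + q‖ := by
    by_contra hcon
    push Not at hcon
    nlinarith [h.peakValue_pos]
  have hpar := parallelogram_law_with_norm ℝ p q
  rw [hp.1, hq.1] at hpar
  have : ‖p - q‖ * ‖p - q‖ ≤ 0 := by nlinarith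
  have h0 : ‖p - q‖ = 0 := by nlinarith [norm_nonneg (p - q)]
  exact sub_eq_zero.1 (norm_eq_zero.1 h0)

/-- The first-order condition at the maximum: M + s g(x) ≤ M‖p + s x‖ ≤ M(1 + s⟨p, x⟩ + s²‖x‖²/2);
divide by s and let s → 0. -/
theorem le_peakValue_mul_inner (h : IsConcaveGauge g K) {p x : V} (hp : IsPeak g K p)
    (hx : x ∈ interior K) : g x ≤ peakValue g K * inner ℝ p x := by
  have hM := h.peakValue_pos
  have key : ∀ s : ℝ, 0 < s → g x ≤ peakValue g K * (inner ℝ p x + s * ‖x‖ ^ 2 / 2) := by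
    intro s hs
    have hsx := h.smul_mem_interior hx hs
    have h1 := h.mul_peakValue_add_le hp hsx zero_le_one
    rw [h.map_smul _ _ hs, one_mul, one_smul] at h1
    have h2 := h.le_peakValue_mul_norm (h.add_mem_interior (h.isPeak_mem hp) hsx)
    -- This is 2‖v‖ ≤ 1 + ‖v‖² for v = p + s • x.
    have h3 : ‖p + s • x‖ ≤ 1 + s * inner ℝ p x + s ^ 2 * ‖x‖ ^ 2 / 2 := by
      have hsq : ‖p + s • x‖ ^ 2 = 1 + 2 * (s * inner ℝ p x) + s ^ 2 * ‖x‖ ^ 2 := by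
        rw [norm_add_sq_real, hp.1, inner_smul_right, norm_smul, mul_pow, Real.norm_eq_abs, sq_abs]
        ring
      nlinarith [sq_nonneg (‖p + s • x‖ - 1)]
    have h4 : peakValue g K + s * g x ≤
        peakValue g K * (1 + s * inner ℝ p x + s ^ 2 * ‖x‖ ^ 2 / 2) :=
      (h1.trans h2).trans (mul_le_mul_of_nonneg_left h3 hM.le)
    have h5 : s * g x ≤ s * (peakValue g K * (inner ℝ p x + s * ‖x‖ ^ 2 / 2)) := by linarith
    exact le_of_mul_le_mul_left h5 hs
  have hlim : Tendsto (fun s : ℝ => peakValue g K * (inner ℝ p x + s * ‖x‖ ^ 2 / 2)) (𝓝[>] 0)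
      (𝓝 (peakValue g K * (inner ℝ p x + 0 * ‖x‖ ^ 2 / 2))) :=
    Tendsto.mono_left (Continuous.tendsto (by fun_prop) 0) nhdsWithin_le_nhds
  rw [zero_mul, zero_div, add_zero] at hlim
  refine ge_of_tendsto hlim ?_
  filter_upwards [self_mem_nhdsWithin] with s hs using key s hs

theorem inner_peak_pos (h : IsConcaveGauge g K) {p x : V} (hp : IsPeak g K p)
    (hx : x ∈ interior K) : 0 < inner ℝ p x := by
  have h1 := h.le_peakValue_mul_inner hp hx
  have h2 := h.pos x hx
  have h3 := h.peakValue_pos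
  by_contra hcon
  push Not at hcon
  nlinarith

/-- The point at angle s is a positive combination of p and the point x at angle t. Concavity bounds
g there from below by values at p and x, M is at least g(x)/cos t, and sin(t - s) + sin s cos t =
sin t cos s. -/
theorem indicator_mul_cos_le (h : IsConcaveGauge g K) {p θ : V} (hp : IsPeak g K p)
    (hpθ : inner ℝ p θ = 0) {s t : ℝ} (hs : 0 < s) (hst : s ≤ t)
    (ht : t < Real.pi / 2) :
    (interior K).indicator g (Real.cos t • p + Real.sin t • θ) * Real.cos s ≤
      (interior K).indicator g (Real.cos s • p + Real.sin s • θ) * Real.cos t := by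
  have hpi := Real.pi_pos
  have hcs : 0 < Real.cos s := Real.cos_pos_of_mem_Ioo ⟨by linarith, by linarith⟩
  have hct : 0 < Real.cos t := Real.cos_pos_of_mem_Ioo ⟨by linarith, by linarith⟩
  have hsins : 0 < Real.sin s := Real.sin_pos_of_pos_of_lt_pi hs (by linarith)
  have hsint : 0 < Real.sin t := Real.sin_pos_of_pos_of_lt_pi (by linarith) (by linarith)
  have hsub : 0 ≤ Real.sin (t - s) :=
    Real.sin_nonneg_of_nonneg_of_le_pi (by linarith) (by linarith)
  set x := Real.cos t • p + Real.sin t • θ with hx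
  by_cases hxK : x ∈ interior K
  · have hcomb : Real.cos s • p + Real.sin s • θ =
        (Real.sin (t - s) / Real.sin t) • p + (Real.sin s / Real.sin t) • x := by
      rw [hx, smul_add, smul_smul, smul_smul, ← add_assoc, ← add_smul, Real.sin_sub]
      congr 2 <;> field_simp
      ring
    have hsx := h.smul_mem_interior hxK (div_pos hsins hsint)
    have ha : 0 ≤ Real.sin (t - s) / Real.sin t := div_nonneg hsub hsint.le
    have hmem : Real.cos s • p + Real.sin s • θ ∈ interior K := by
      rw [hcomb]
      exact h.add_mem_interior (h.smul_mem p (h.isPeak_mem hp) _ ha) hsx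
    rw [Set.indicator_of_mem hxK, Set.indicator_of_mem hmem, hcomb]
    have h1 := h.mul_peakValue_add_le hp hsx ha
    rw [h.map_smul _ _ (div_pos hsins hsint)] at h1
    have h2 := h.le_peakValue_mul_inner hp hxK
    have h3 : inner ℝ p x = Real.cos t := by
      rw [hx, inner_add_right, inner_smul_right, inner_smul_right, hpθ,
        real_inner_self_eq_norm_sq, hp.1]
      simp
    rw [h3] at h2
    calc g x * Real.cos s
        = Real.sin (t - s) / Real.sin t * g x + Real.sin s / Real.sin t * g x * Real.cos t := by
          rw [Real.sin_sub]
          field_simp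
          ring
      _ ≤ Real.sin (t - s) / Real.sin t * (peakValue g K * Real.cos t) +
          Real.sin s / Real.sin t * g x * Real.cos t := by gcongr
      _ = (Real.sin (t - s) / Real.sin t * peakValue g K + Real.sin s / Real.sin t * g x) *
          Real.cos t := by ring
      _ ≤ _ := by gcongr
  · rw [Set.indicator_of_notMem hxK, zero_mul]
    exact mul_nonneg (Set.indicator_nonneg (fun _ _ => h.nonneg _) _) hct.le

end InnerProductSpace

section gaugeDensity
variable {V : Type*} [NormedAddCommGroup V] [NormedSpace ℝ V] {g : V → ℝ} {K : Set V}

/-- Continuity of g is known only on the interior of K; the cut-off in `gaugeDensity` makes this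
enough. -/
theorem measurable_gaugeDensity [MeasurableSpace V] [BorelSpace V] (h : IsConcaveGauge g K) (m : ℕ) :
    Measurable (gaugeDensity g K m) := by
  have hcont : ContinuousOn (fun x => ENNReal.ofReal (g x ^ m)) (interior K) :=
    ENNReal.continuous_ofReal.comp_continuousOn (h.continuousOn.pow m)
  refine measurable_of_restrict_of_restrict_compl
    (isOpen_interior (s := K)).measurableSet ?_ ?_
  · have : (interior K).domRestrict (gaugeDensity g K m) =
        (interior K).domRestrict fun x => ENNReal.ofReal (g x ^ m) := by
      ext x
      exact Set.indicator_of_mem x.2 fun x => ENNReal.ofReal (g x ^ m)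
    rw [this]
    exact (continuousOn_iff_continuous_domRestrict.1 hcont).measurable
  · have : (interior K)ᶜ.domRestrict (gaugeDensity g K m) = 0 := by
      ext x
      exact Set.indicator_of_notMem x.2 fun x => ENNReal.ofReal (g x ^ m)
    rw [this]
    exact measurable_zero

theorem gaugeDensity_smul (h : IsConcaveGauge g K) (m : ℕ) (x : V) {t : ℝ} (ht : 0 < t) :
    gaugeDensity g K m (t • x) = ENNReal.ofReal t ^ m * gaugeDensity g K m x := by
  by_cases hx : x ∈ interior K
  · rw [gaugeDensity, Set.indicator_of_mem hx, Set.indicator_of_mem (h.smul_mem_interior hx ht),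
      h.map_smul x t ht, mul_pow, ENNReal.ofReal_mul (by positivity), ENNReal.ofReal_pow ht.le]
  · have hx' : t • x ∉ interior K := fun hmem => hx (by
      simpa [smul_smul, inv_mul_cancel₀ ht.ne'] using h.smul_mem_interior hmem (inv_pos.2 ht))
    rw [gaugeDensity, Set.indicator_of_notMem hx, Set.indicator_of_notMem hx', mul_zero]

theorem gaugeDensity_eq (h : IsConcaveGauge g K) {m : ℕ} (hm : m ≠ 0) (x : V) :
    gaugeDensity g K m x = ENNReal.ofReal ((interior K).indicator g x) ^ m := by
  by_cases hx : x ∈ interior K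
  · rw [gaugeDensity, Set.indicator_of_mem hx, Set.indicator_of_mem hx, ENNReal.ofReal_pow (h.nonneg x)]
  · rw [gaugeDensity, Set.indicator_of_notMem hx, Set.indicator_of_notMem hx, ENNReal.ofReal_zero,
      zero_pow hm]

end gaugeDensity

end IsConcaveGauge

/-! ### Polar coordinates around the peak and comparison with the model -/

theorem lintegral_volumeIoiPow (n : ℕ) {f : ℝ → ℝ≥0∞} (hf : Measurable f) :
    ∫⁻ r : Set.Ioi (0 : ℝ), f r ∂(Measure.volumeIoiPow n) =
      ∫⁻ r in Set.Ioi (0 : ℝ), ENNReal.ofReal (r ^ n) * f r := by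
  rw [Measure.volumeIoiPow, lintegral_withDensity_eq_lintegral_mul _ (by fun_prop)
    (show Measurable fun r : Set.Ioi (0 : ℝ) => f r from hf.comp measurable_subtype_coe)]
  exact lintegral_subtype_comap measurableSet_Ioi fun r : ℝ => ENNReal.ofReal (r ^ n) * f r

/-- Integration in polar coordinates. -/
theorem lintegral_eq_lintegral_toSphere {E : Type*} [NormedAddCommGroup E] [NormedSpace ℝ E]
    [FiniteDimensional ℝ E] [MeasurableSpace E] [BorelSpace E] [Nontrivial E] (ω : Measure E)
    [ω.IsAddHaarMeasure] {F : E → ℝ≥0∞} (hF : Measurable F) :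
    ∫⁻ x, F x ∂ω = ∫⁻ θ : Metric.sphere (0 : E) 1, (∫⁻ r in Set.Ioi (0 : ℝ),
      ENNReal.ofReal (r ^ (Module.finrank ℝ E - 1)) * F (r • (θ : E))) ∂ω.toSphere := by
  have hmeas : Measurable fun q : Metric.sphere (0 : E) 1 × Set.Ioi (0 : ℝ) =>
      F ((q.2 : ℝ) • (q.1 : E)) := hF.comp (by fun_prop)
  calc ∫⁻ x, F x ∂ω = ∫⁻ x : ({0}ᶜ : Set E), F x ∂(ω.comap (↑)) := by
        rw [lintegral_subtype_comap (measurableSet_singleton _).compl, restrict_compl_singleton]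
    _ = ∫⁻ q, F ((q.2 : ℝ) • (q.1 : E))
          ∂(ω.toSphere.prod (Measure.volumeIoiPow (Module.finrank ℝ E - 1))) := by
        rw [← ω.measurePreserving_homeomorphUnitSphereProd.lintegral_comp hmeas]
        refine lintegral_congr fun x => ?_
        have : ‖(x : E)‖ ≠ 0 := norm_ne_zero_iff.2 x.2
        simp [smul_smul, this]
    _ = _ := by
        rw [lintegral_prod _ hmeas.aemeasurable]
        refine lintegral_congr fun θ => ?_
        exact lintegral_volumeIoiPow _ (f := fun r => F (r • (θ : E))) (hF.comp (by fun_prop))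

/-- A ratio of densities which decreases makes the ratio of the masses of initial segments
larger. -/
theorem setLIntegral_Ioo_mul_le {Φ c w : ℝ → ℝ≥0∞} (hΦ : Measurable Φ) (hc : Measurable c)
    (hw : Measurable w) {ε b : ℝ} (hε : ε ≤ b)
    (hmono : ∀ s t, 0 < s → s ≤ t → t < b → Φ t * c s ≤ Φ s * c t) :
    (∫⁻ t in Set.Ioo 0 b, Φ t * w t) * (∫⁻ t in Set.Ioo 0 ε, c t * w t) ≤
      (∫⁻ t in Set.Ioo 0 ε, Φ t * w t) * (∫⁻ t in Set.Ioo 0 b, c t * w t) := by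
  rcases le_or_gt ε 0 with hε0 | hε0
  · simp [Set.Ioo_eq_empty_of_le hε0]
  have hunion : Set.Ioo 0 b = Set.Ioo 0 ε ∪ Set.Ico ε b := by
    rw [Set.Ioo_union_Ico_eq_Ioo hε0 hε]
  have hdisj : Disjoint (Set.Ioo 0 ε) (Set.Ico ε b) := by
    rw [Set.disjoint_left]
    exact fun x h1 h2 => absurd h1.2 (not_lt.2 h2.1)
  rw [hunion, lintegral_union measurableSet_Ico hdisj, lintegral_union measurableSet_Ico hdisj,
    add_mul, mul_add]
  -- The product over (0, ε) × (0, ε) is common to both sides; the remaining products compare s < ε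
  -- ≤ t pointwise.
  refine add_le_add le_rfl ?_
  have hΦw : Measurable fun t => Φ t * w t := hΦ.mul hw
  have hcw : Measurable fun t => c t * w t := hc.mul hw
  rw [← lintegral_mul_const _ hΦw, ← lintegral_const_mul _ hcw]
  refine setLIntegral_mono' measurableSet_Ico fun t ht => ?_
  rw [← lintegral_const_mul _ hcw, ← lintegral_mul_const _ hΦw]
  refine setLIntegral_mono' measurableSet_Ioo fun s hs => ?_
  calc Φ t * w t * (c s * w s) = Φ t * c s * (w t * w s) := by ring
    _ ≤ Φ s * c t * (w t * w s) := by
        gcongr ?_ * _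
        exact hmono s t hs.1 (hs.2.le.trans ht.1) ht.2
    _ = _ := by ring

section orthogonal

variable {V : Type*} [NormedAddCommGroup V] [InnerProductSpace ℝ V]

/-- The decomposition `V = ℝ p ⊕ pᗮ` for a unit vector `p`. -/
def orthogonalSumEquiv (p : V) (hp : ‖p‖ = 1) : (ℝ × (ℝ ∙ p)ᗮ) ≃ₗ[ℝ] V where
  toFun q := q.1 • p + (q.2 : V)
  map_add' x y := by simp only [Prod.fst_add, Prod.snd_add, add_smul, Submodule.coe_add]; abel
  map_smul' t x := by simp [smul_smul]
  invFun x := (inner ℝ p x, ⟨x - inner ℝ p x • p, by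
    rw [Submodule.mem_orthogonal_singleton_iff_inner_right, inner_sub_right, inner_smul_right,
      real_inner_self_eq_norm_sq, hp]
    simp⟩)
  left_inv := by
    rintro ⟨h, z⟩
    have hz : inner ℝ p (z : V) = 0 := Submodule.mem_orthogonal_singleton_iff_inner_right.1 z.2
    have hin : inner ℝ p (h • p + (z : V)) = h := by
      rw [inner_add_right, inner_smul_right, real_inner_self_eq_norm_sq, hp, hz]
      simp
    refine Prod.ext hin (Subtype.ext ?_)
    simp [hin]
  right_inv x := by simp

theorem inner_smul_add_smul {p θ : V} (hp : ‖p‖ = 1) (hpθ : inner ℝ p θ = 0) (h r : ℝ) :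
    inner ℝ p (h • p + r • θ) = h := by
  rw [inner_add_right, inner_smul_right, inner_smul_right, real_inner_self_eq_norm_sq, hp, hpθ]
  simp

theorem norm_cos_smul_add_sin_smul {p θ : V} (hp : ‖p‖ = 1) (hθ : ‖θ‖ = 1)
    (hpθ : inner ℝ p θ = 0) (t : ℝ) : ‖Real.cos t • p + Real.sin t • θ‖ = 1 := by
  have : ‖Real.cos t • p + Real.sin t • θ‖ ^ 2 = 1 := by
    rw [norm_add_sq_real, inner_smul_left, inner_smul_right, hpθ, norm_smul, norm_smul, hp, hθ]
    simp
  exact (pow_eq_one_iff_of_nonneg (norm_nonneg _) two_ne_zero).1 this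

theorem angle_cos_smul_add_sin_smul {p θ : V} (hp : ‖p‖ = 1) (hθ : ‖θ‖ = 1)
    (hpθ : inner ℝ p θ = 0) {t : ℝ} (ht0 : 0 ≤ t) (ht : t ≤ Real.pi) :
    InnerProductGeometry.angle p (Real.cos t • p + Real.sin t • θ) = t := by
  rw [InnerProductGeometry.angle, inner_smul_add_smul hp hpθ, hp,
    norm_cos_smul_add_sin_smul hp hθ hpθ, mul_one, div_one, Real.arccos_cos ht0 ht]

variable [FiniteDimensional ℝ V] [MeasurableSpace V] [BorelSpace V]

/-- The integral over the planar half-disc of a function which is homogeneous on it. -/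
theorem lintegral_homogeneous_plane {H : V → ℝ≥0∞} (hH : Measurable H) {m j : ℕ}
    (hsmul : ∀ (x : V) (t : ℝ), 0 < t → H (t • x) = ENNReal.ofReal t ^ m * H x) {p θ : V}
    (hpos : ∀ x, H x ≠ 0 → 0 < inner ℝ p x) (hp : ‖p‖ = 1) (hθ : ‖θ‖ = 1)
    (hpθ : inner ℝ p θ = 0) :
    ∫⁻ h : ℝ, ∫⁻ r in Set.Ioi (0 : ℝ), ENNReal.ofReal (r ^ j) *
        (Metric.ball (0 : V) 1).indicator H (h • p + r • θ) =
      (∫⁻ ρ in Set.Ioo (0 : ℝ) 1, ENNReal.ofReal (ρ ^ (m + j + 1))) *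
        ∫⁻ t in Set.Ioo 0 (Real.pi / 2), H (Real.cos t • p + Real.sin t • θ) *
          ENNReal.ofReal (Real.sin t ^ j) := by
  have hind : Measurable ((Metric.ball (0 : V) 1).indicator H) :=
    hH.indicator Metric.isOpen_ball.measurableSet
  set f : ℝ × ℝ → ℝ≥0∞ := fun q => if 0 < q.2 then ENNReal.ofReal (q.2 ^ j) *
    (Metric.ball (0 : V) 1).indicator H (q.1 • p + q.2 • θ) else 0 with hf
  have hfm : Measurable f := by
    refine Measurable.ite (measurableSet_lt measurable_const measurable_snd) ?_ measurable_const
    exact Measurable.mul (by fun_prop) (hind.comp (by fun_prop))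
  -- In planar polar coordinates the integrand factors: the Jacobian ρ, the weight and the
  -- homogeneity give ρ^(m+j+1). The angle is confined to (0, π/2), since r > 0 forces sin t > 0 and
  -- the support of H forces cos t > 0.
  have hpt : ∀ ρ t : ℝ, 0 < ρ → t ∈ Set.Ioo (-Real.pi) Real.pi →
      ENNReal.ofReal ρ • f (ρ * Real.cos t, ρ * Real.sin t) =
        (Set.Ioo (0 : ℝ) 1).indicator (fun ρ => ENNReal.ofReal (ρ ^ (m + j + 1))) ρ *
        (Set.Ioo (0 : ℝ) (Real.pi / 2)).indicator (fun t => H (Real.cos t • p + Real.sin t • θ) *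
          ENNReal.ofReal (Real.sin t ^ j)) t := by
    intro ρ t hρ ht
    have hvec : (ρ * Real.cos t) • p + (ρ * Real.sin t) • θ =
        ρ • (Real.cos t • p + Real.sin t • θ) := by
      rw [smul_add, smul_smul, smul_smul]
    simp only [hf]
    rw [hvec]
    by_cases htI : t ∈ Set.Ioo (0 : ℝ) (Real.pi / 2)
    · have hsin : 0 < Real.sin t :=
        Real.sin_pos_of_pos_of_lt_pi htI.1 (by linarith [htI.2, Real.pi_pos])
      rw [if_pos (mul_pos hρ hsin), Set.indicator_of_mem htI]
      have hnorm : ‖ρ • (Real.cos t • p + Real.sin t • θ)‖ = ρ := by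
        rw [norm_smul, norm_cos_smul_add_sin_smul hp hθ hpθ, mul_one, Real.norm_of_nonneg hρ.le]
      by_cases hρ1 : ρ < 1
      · rw [Set.indicator_of_mem (by rw [mem_ball_zero_iff, hnorm]; exact hρ1),
          Set.indicator_of_mem (show ρ ∈ Set.Ioo (0 : ℝ) 1 from ⟨hρ, hρ1⟩), hsmul _ _ hρ, smul_eq_mul,
          mul_pow, ENNReal.ofReal_mul (by positivity), ENNReal.ofReal_pow hρ.le,
          ENNReal.ofReal_pow hρ.le]
        ring
      · rw [Set.indicator_of_notMem (by rw [mem_ball_zero_iff, hnorm]; exact hρ1),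
          Set.indicator_of_notMem (fun h => hρ1 h.2)]
        simp
    · rw [Set.indicator_of_notMem htI, mul_zero, smul_eq_mul]
      by_cases hsin : 0 < ρ * Real.sin t
      · rw [if_pos hsin]
        have hzero : H (ρ • (Real.cos t • p + Real.sin t • θ)) = 0 := by
          by_contra hne
          have h1 := hpos _ hne
          rw [inner_smul_right, inner_smul_add_smul hp hpθ] at h1
          have hcos : 0 < Real.cos t := pos_of_mul_pos_right h1 hρ.le
          have hsin' : 0 < Real.sin t := pos_of_mul_pos_right hsin hρ.le
          refine htI ⟨?_, ?_⟩
          · by_contra hcon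
            exact absurd hsin' (not_lt.2 (Real.sin_nonpos_of_nonpos_of_neg_pi_le
              (not_lt.1 hcon) ht.1.le))
          · by_contra hcon
            exact absurd hcos (not_lt.2 (Real.cos_nonpos_of_pi_div_two_le_of_le
              (not_lt.1 hcon) (by linarith [ht.2, Real.pi_pos])))
        have hzero' : (Metric.ball (0 : V) 1).indicator H
            (ρ • (Real.cos t • p + Real.sin t • θ)) = 0 :=
          Set.indicator_apply_eq_zero.2 fun _ => hzero
        rw [hzero', mul_zero, mul_zero]
      · rw [if_neg hsin, mul_zero]
  calc _ = ∫⁻ h : ℝ, ∫⁻ r : ℝ, f (h, r) := by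
        refine lintegral_congr fun h => ?_
        rw [← lintegral_indicator measurableSet_Ioi]
        refine lintegral_congr fun r => ?_
        by_cases hr : 0 < r
        · rw [Set.indicator_of_mem (show r ∈ Set.Ioi (0 : ℝ) from hr)]
          simp only [hf, if_pos hr]
        · rw [Set.indicator_of_notMem (show r ∉ Set.Ioi (0 : ℝ) from hr)]
          simp only [hf, if_neg hr]
    _ = ∫⁻ q, f q := by
        rw [Measure.volume_eq_prod, lintegral_prod _ hfm.aemeasurable]
    _ = ∫⁻ q in polarCoord.target, ENNReal.ofReal q.1 • f (polarCoord.symm q) :=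
        (lintegral_comp_polarCoord_symm f).symm
    _ = ∫⁻ q in Set.Ioi (0 : ℝ) ×ˢ Set.Ioo (-Real.pi) Real.pi,
          (Set.Ioo (0 : ℝ) 1).indicator (fun ρ => ENNReal.ofReal (ρ ^ (m + j + 1))) q.1 *
          (Set.Ioo (0 : ℝ) (Real.pi / 2)).indicator (fun t =>
            H (Real.cos t • p + Real.sin t • θ) * ENNReal.ofReal (Real.sin t ^ j)) q.2 := by
        rw [polarCoord_target]
        refine setLIntegral_congr_fun (measurableSet_Ioi.prod measurableSet_Ioo) fun q hq => ?_
        rw [polarCoord_symm_apply]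
        exact hpt q.1 q.2 hq.1 hq.2
    _ = _ := by
        rw [Measure.volume_eq_prod, ← Measure.prod_restrict, lintegral_prod_mul]
        · congr 1
          · rw [lintegral_indicator measurableSet_Ioo, Measure.restrict_restrict measurableSet_Ioo,
              Set.inter_eq_left.2 Set.Ioo_subset_Ioi_self]
          · rw [lintegral_indicator measurableSet_Ioo, Measure.restrict_restrict measurableSet_Ioo,
              Set.inter_eq_left.2 (Set.Ioo_subset_Ioo (by linarith [Real.pi_pos])
                (by linarith [Real.pi_pos]))]
        · exact (Measurable.indicator (by fun_prop) measurableSet_Ioo).aemeasurable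
        · exact (Measurable.indicator (Measurable.mul (hH.comp (by fun_prop)) (by fun_prop))
            measurableSet_Ioo).aemeasurable

/-- The integral over the unit ball of a homogeneous function supported in the open half space
around `p`, in polar coordinates around `p`. -/
theorem exists_lintegral_homogeneous_eq (ω : Measure V) [ω.IsAddHaarMeasure] {p : V}
    (hp : ‖p‖ = 1) (hdim : 2 ≤ Module.finrank ℝ V) (m : ℕ) :
    ∃ C : ℝ≥0∞, ∀ H : V → ℝ≥0∞, Measurable H →
      (∀ (x : V) (t : ℝ), 0 < t → H (t • x) = ENNReal.ofReal t ^ m * H x) →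
      (∀ x, H x ≠ 0 → 0 < inner ℝ p x) →
      ∫⁻ x in Metric.ball 0 1, H x ∂ω = C * ∫⁻ θ : Metric.sphere (0 : (ℝ ∙ p)ᗮ) 1,
        (∫⁻ t in Set.Ioo 0 (Real.pi / 2), H (Real.cos t • p + Real.sin t • ((θ : (ℝ ∙ p)ᗮ) : V)) *
          ENNReal.ofReal (Real.sin t ^ (Module.finrank ℝ V - 2)))
            ∂(Measure.addHaar : Measure (ℝ ∙ p)ᗮ).toSphere := by
  have hp0 : p ≠ 0 := norm_ne_zero_iff.1 (by rw [hp]; exact one_ne_zero)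
  have hrank : Module.finrank ℝ (ℝ ∙ p)ᗮ + 1 = Module.finrank ℝ V := by
    have := Submodule.finrank_add_finrank_orthogonal (ℝ ∙ p)
    rw [finrank_span_singleton hp0] at this
    omega
  have hrank' : Module.finrank ℝ (ℝ ∙ p)ᗮ - 1 = Module.finrank ℝ V - 2 := by omega
  have : Nontrivial (ℝ ∙ p)ᗮ := Module.nontrivial_of_finrank_pos (R := ℝ) (by omega)
  set ωW : Measure (ℝ ∙ p)ᗮ := Measure.addHaar
  set e : (ℝ × (ℝ ∙ p)ᗮ) ≃L[ℝ] V := (orthogonalSumEquiv p hp).toContinuousLinearEquiv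
  have he : ∀ q, e q = q.1 • p + (q.2 : V) := fun _ => rfl
  have : ((volume : Measure ℝ).prod ωW).IsAddHaarMeasure := inferInstance
  have : (((volume : Measure ℝ).prod ωW).map e).IsAddHaarMeasure :=
    e.isAddHaarMeasure_map _
  -- Uniqueness of Haar measure compares ω with the product measure on ℝ × pᗮ. Neither c nor the
  -- radial integral depends on H, so the same constant serves for the whole space and for a ball.
  obtain ⟨c, hc⟩ : ∃ c : ℝ≥0∞, ω = c • ((volume : Measure ℝ).prod ωW).map e :=
    ⟨_, Measure.isAddLeftInvariant_eq_smul ω (((volume : Measure ℝ).prod ωW).map e)⟩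
  refine ⟨c * ∫⁻ ρ in Set.Ioo (0 : ℝ) 1, ENNReal.ofReal (ρ ^ (m + (Module.finrank ℝ V - 2) + 1)),
    fun H hH hsmul hpos => ?_⟩
  have hind : Measurable ((Metric.ball (0 : V) 1).indicator H) :=
    hH.indicator Metric.isOpen_ball.measurableSet
  set F := (Metric.ball (0 : V) 1).indicator H
  have hFm : Measurable fun q : (ℝ × Metric.sphere (0 : (ℝ ∙ p)ᗮ) 1) × ℝ =>
      ENNReal.ofReal (q.2 ^ (Module.finrank ℝ V - 2)) *
        F (q.1.1 • p + q.2 • ((q.1.2 : (ℝ ∙ p)ᗮ) : V)) :=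
    Measurable.mul (by fun_prop) (hind.comp (by fun_prop))
  calc ∫⁻ x in Metric.ball 0 1, H x ∂ω = ∫⁻ x, F x ∂ω := by
        rw [← lintegral_indicator Metric.isOpen_ball.measurableSet]
    _ = c * ∫⁻ q, F (q.1 • p + (q.2 : V)) ∂((volume : Measure ℝ).prod ωW) := by
        rw [hc, lintegral_smul_measure, lintegral_map hind e.continuous.measurable, smul_eq_mul]
        rfl
    _ = c * ∫⁻ h : ℝ, ∫⁻ z, F (h • p + (z : V)) ∂ωW := by
        have hm : Measurable fun q : ℝ × (ℝ ∙ p)ᗮ => F (q.1 • p + (q.2 : V)) :=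
          hind.comp (by fun_prop)
        rw [lintegral_prod _ hm.aemeasurable]
    _ = c * ∫⁻ h : ℝ, ∫⁻ θ : Metric.sphere (0 : (ℝ ∙ p)ᗮ) 1, (∫⁻ r in Set.Ioi (0 : ℝ),
          ENNReal.ofReal (r ^ (Module.finrank ℝ V - 2)) *
            F (h • p + r • ((θ : (ℝ ∙ p)ᗮ) : V))) ∂ωW.toSphere := by
        congr 1
        refine lintegral_congr fun h => ?_
        rw [lintegral_eq_lintegral_toSphere ωW (F := fun z => F (h • p + (z : V)))
          (hind.comp (by fun_prop)), hrank']
        rfl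
    _ = c * ∫⁻ θ : Metric.sphere (0 : (ℝ ∙ p)ᗮ) 1, (∫⁻ h : ℝ, ∫⁻ r in Set.Ioi (0 : ℝ),
          ENNReal.ofReal (r ^ (Module.finrank ℝ V - 2)) *
            F (h • p + r • ((θ : (ℝ ∙ p)ᗮ) : V))) ∂ωW.toSphere := by
        rw [lintegral_lintegral_swap (hFm.lintegral_prod_right').aemeasurable]
    _ = _ := by
        rw [mul_assoc, ← lintegral_const_mul' (∫⁻ ρ in Set.Ioo (0 : ℝ) 1,
          ENNReal.ofReal (ρ ^ (m + (Module.finrank ℝ V - 2) + 1))) _ ?_]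
        · congr 1
          refine lintegral_congr fun θ => ?_
          have hθ : ‖((θ : (ℝ ∙ p)ᗮ) : V)‖ = 1 := mem_sphere_zero_iff_norm.1 θ.2
          exact lintegral_homogeneous_plane hH hsmul hpos hp hθ
            (Submodule.mem_orthogonal_singleton_iff_inner_right.1 (θ : (ℝ ∙ p)ᗮ).2)
        · refine ((setLIntegral_mono' measurableSet_Ioo fun ρ hρ => ?_).trans_lt
            (b := ∫⁻ ρ in Set.Ioo (0 : ℝ) 1, 1) (by simp)).ne
          rw [ENNReal.ofReal_le_one]
          exact pow_le_one₀ hρ.1.le hρ.2.le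

/-- Comparison of the mass of balls around the peak with the model densities. -/
theorem IsConcaveGauge.lintegral_ball_mul_le {g : V → ℝ} {K : Set V} (h : IsConcaveGauge g K)
    (ω : Measure V) [ω.IsAddHaarMeasure] (hdim : 2 ≤ Module.finrank ℝ V) {m : ℕ} (hm : m ≠ 0)
    {p : V} (hp : IsPeak g K p) {ε : ℝ} (hε : ε ≤ Real.pi / 2) :
    (∫⁻ x in Metric.ball 0 1, gaugeDensity g K m x ∂ω) *
        (∫⁻ t in Set.Ioo 0 ε, ENNReal.ofReal (Real.cos t) ^ m *
          ENNReal.ofReal (Real.sin t ^ (Module.finrank ℝ V - 2))) ≤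
      (∫⁻ x in Metric.ball 0 1,
          {x | InnerProductGeometry.angle p x < ε}.indicator (gaugeDensity g K m) x ∂ω) *
        (∫⁻ t in Set.Ioo 0 (Real.pi / 2), ENNReal.ofReal (Real.cos t) ^ m *
          ENNReal.ofReal (Real.sin t ^ (Module.finrank ℝ V - 2))) := by
  obtain ⟨C, hC⟩ := exists_lintegral_homogeneous_eq ω hp.1 hdim m
  have hAm : MeasurableSet {x : V | InnerProductGeometry.angle p x < ε} := by
    refine measurableSet_lt ?_ measurable_const
    unfold InnerProductGeometry.angle
    exact Real.continuous_arccos.measurable.comp (by fun_prop)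
  have hHm := h.measurable_gaugeDensity (m := m)
  have hpos : ∀ x, gaugeDensity g K m x ≠ 0 → 0 < inner ℝ p x := fun x hx =>
    h.inner_peak_pos hp (Set.mem_of_indicator_ne_zero hx)
  -- The formula is used for the density and for its restriction to {angle < ε}, which stays
  -- homogeneous because angles are invariant under positive dilations.
  rw [hC _ hHm (fun x t ht => h.gaugeDensity_smul m x ht) hpos,
    hC _ (hHm.indicator hAm) (fun x t ht => ?_)
      (fun x hx => hpos x fun h0 => hx (by simp [Set.indicator, h0]))]
  · have hf1 : Measurable fun t : ℝ => ENNReal.ofReal (Real.cos t) ^ m *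
        ENNReal.ofReal (Real.sin t ^ (Module.finrank ℝ V - 2)) := by fun_prop
    have hinner : ∀ G : V → ℝ≥0∞, Measurable G → Measurable fun θ :
        Metric.sphere (0 : (ℝ ∙ p)ᗮ) 1 => ∫⁻ t in Set.Ioo 0 (Real.pi / 2),
          G (Real.cos t • p + Real.sin t • ((θ : (ℝ ∙ p)ᗮ) : V)) *
          ENNReal.ofReal (Real.sin t ^ (Module.finrank ℝ V - 2)) := by
      intro G hG
      refine Measurable.lintegral_prod_right' (f := fun q : Metric.sphere (0 : (ℝ ∙ p)ᗮ) 1 × ℝ =>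
        G (Real.cos q.2 • p + Real.sin q.2 • ((q.1 : (ℝ ∙ p)ᗮ) : V)) *
          ENNReal.ofReal (Real.sin q.2 ^ (Module.finrank ℝ V - 2))) ?_
      exact Measurable.mul (hG.comp (by fun_prop)) (by fun_prop)
    rw [mul_assoc, mul_assoc, ← lintegral_mul_const _ (hinner _ hHm),
      ← lintegral_mul_const _ (hinner _ (hHm.indicator hAm))]
    gcongr C * ?_
    refine lintegral_mono fun θ => ?_
    have hθ : ‖((θ : (ℝ ∙ p)ᗮ) : V)‖ = 1 := mem_sphere_zero_iff_norm.1 θ.2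
    have hpθ : inner ℝ p ((θ : (ℝ ∙ p)ᗮ) : V) = 0 :=
      Submodule.mem_orthogonal_singleton_iff_inner_right.1 (θ : (ℝ ∙ p)ᗮ).2
    refine (setLIntegral_Ioo_mul_le (Φ := fun t => gaugeDensity g K m
      (Real.cos t • p + Real.sin t • ((θ : (ℝ ∙ p)ᗮ) : V)))
      (hHm.comp (by fun_prop)) (c := fun t => ENNReal.ofReal (Real.cos t) ^ m) (by fun_prop)
      (w := fun t => ENNReal.ofReal (Real.sin t ^ (Module.finrank ℝ V - 2))) (by fun_prop) hε ?_).trans ?_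
    · intro s t hs hst ht
      have hcs : 0 ≤ Real.cos s := Real.cos_nonneg_of_mem_Icc ⟨by linarith, by linarith⟩
      have hct : 0 ≤ Real.cos t := Real.cos_nonneg_of_mem_Icc ⟨by linarith, by linarith⟩
      rw [h.gaugeDensity_eq hm, h.gaugeDensity_eq hm, ← mul_pow, ← mul_pow,
        ← ENNReal.ofReal_mul' hcs, ← ENNReal.ofReal_mul' hct]
      exact pow_le_pow_left' (ENNReal.ofReal_le_ofReal (h.indicator_mul_cos_le hp hpθ hs hst ht)) m
    · gcongr ?_ * _
      -- On the arc in direction θ the angle with p equals t, so the cut-off is inactive for t < ε.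
      refine le_trans ?_ (lintegral_mono_set (Set.Ioo_subset_Ioo_right hε))
      refine setLIntegral_mono' measurableSet_Ioo fun t ht => ?_
      rw [Set.indicator_of_mem]
      change InnerProductGeometry.angle _ _ < ε
      rw [angle_cos_smul_add_sin_smul hp.1 hθ hpθ ht.1.le (by linarith [ht.2, Real.pi_pos])]
      exact ht.2
  · have hiff : (t • x ∈ {x : V | InnerProductGeometry.angle p x < ε}) ↔
        x ∈ {x : V | InnerProductGeometry.angle p x < ε} := by
      simp only [Set.mem_ofPred_eq, InnerProductGeometry.angle_smul_right_of_pos _ _ ht]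
    by_cases hx : x ∈ {x : V | InnerProductGeometry.angle p x < ε}
    · rw [Set.indicator_of_mem hx, Set.indicator_of_mem (hiff.2 hx), h.gaugeDensity_smul m x ht]
    · rw [Set.indicator_of_notMem hx, Set.indicator_of_notMem (fun hh => hx (hiff.1 hh)), mul_zero]

end orthogonal

theorem IsConcaveGauge.convex {V : Type*} [NormedAddCommGroup V] [NormedSpace ℝ V] {g : V → ℝ}
    {K : Set V} (h : IsConcaveGauge g K) : Convex ℝ K :=
  fun x hx y hy a b ha hb _ => h.add_mem _ (h.smul_mem x hx a ha) _ (h.smul_mem y hy b hb)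

/-- The boundary of a convex set is Lebesgue-null and Λ is carried by K, so cutting the density off
to the interior changes nothing. -/
theorem IsBrunnMinkowskiCone.exists_eq_withDensity_gaugeDensity {V : Type*} [NormedAddCommGroup V]
    [NormedSpace ℝ V] [FiniteDimensional ℝ V] [MeasurableSpace V] [BorelSpace V] {Λ : Measure V}
    {N m : ℕ} {K : Set V} (h : IsBrunnMinkowskiCone Λ N K) (ω : Measure V) [ω.IsAddHaarMeasure]
    (hNm : N = Module.finrank ℝ V + m) (hm : m ≠ 0) :
    ∃ g : V → ℝ, IsConcaveGauge g K ∧ Λ = ω.withDensity (gaugeDensity g K m) := by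
  obtain ⟨g, hg, hΛ⟩ := h.exists_isConcaveGauge ω hNm hm
  refine ⟨g, hg, ?_⟩
  have hfront : Λ (frontier K) = 0 :=
    h.absolutelyContinuous (by omega) ω (h.convex.addHaar_frontier ω)
  have hae : ∀ᵐ x ∂Λ, x ∈ interior K := by
    rw [ae_iff]
    refine measure_mono_null (t := Kᶜ ∪ frontier K) (fun x hx => ?_)
      (measure_union_null h.measure_compl hfront)
    by_cases hxK : x ∈ K
    · exact Or.inr ⟨subset_closure hxK, hx⟩
    · exact Or.inl hxK
  rw [gaugeDensity, withDensity_indicator isOpen_interior.measurableSet,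
    ← restrict_withDensity isOpen_interior.measurableSet, ← hΛ,
    Measure.restrict_eq_self_of_ae_mem hae]

/-! ### Transfer between the sphere and the linear span of the support -/

section subspaceCone

variable {n : ℕ}

/-- The cone over `S`, as a subset of the linear subspace `V`. -/
def subspaceCone (V : Submodule ℝ (AmbientSpace n)) (S : Set (UnitSphere n)) : Set V :=
  {x | (x : AmbientSpace n) ∈ coneOver S}

theorem coe_mem_coneOver_iff {S : Set (UnitSphere n)} {x : UnitSphere n} :
    (x : AmbientSpace n) ∈ coneOver S ↔ x ∈ S := by
  simpa using smul_mem_coneOver_iff (S := S) (x := x) one_pos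

theorem coe_mem_sphereSpan {S : Set (UnitSphere n)} {x : UnitSphere n} (hx : x ∈ S) :
    (x : AmbientSpace n) ∈ sphereSpan S :=
  Submodule.subset_span ⟨x, hx, rfl⟩

theorem coneOver_subset_sphereSpan (S : Set (UnitSphere n)) :
    coneOver S ⊆ (sphereSpan S : Set (AmbientSpace n)) := by
  rintro _ ⟨t, -, x, hx, rfl⟩
  exact Submodule.smul_mem _ _ (coe_mem_sphereSpan hx)

theorem image_subspaceCone_sphereSpan (S : Set (UnitSphere n)) :
    (Subtype.val : sphereSpan S → AmbientSpace n) '' subspaceCone (sphereSpan S) S =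
      coneOver S := by
  ext y
  constructor
  · rintro ⟨x, hx, rfl⟩
    exact hx
  · intro hy
    exact ⟨⟨y, coneOver_subset_sphereSpan S hy⟩, hy, rfl⟩

/-- The cone contains the origin, so its affine span is its linear span. For a convex cone this is
what yields a non-empty interior. -/
theorem affineSpan_subspaceCone {S : Set (UnitSphere n)} (hS : S.Nonempty) :
    affineSpan ℝ (subspaceCone (sphereSpan S) S) = ⊤ := by
  have h0 : (0 : sphereSpan S) ∈ subspaceCone (sphereSpan S) S := zero_mem_coneOver hS
  rw [AffineSubspace.affineSpan_eq_top_iff_vectorSpan_eq_top_of_nonempty ℝ _ _ ⟨0, h0⟩,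
    vectorSpan_eq_span_vsub_set_right ℝ h0]
  simp only [vsub_eq_sub, sub_zero, Set.image_id']
  apply Submodule.map_injective_of_injective (sphereSpan S).subtype_injective
  rw [Submodule.map_span, Submodule.map_subtype_top]
  refine le_antisymm ?_ ?_
  · rw [Submodule.span_le]
    rintro _ ⟨x, -, rfl⟩
    exact x.2
  · refine Submodule.span_mono ?_
    rintro _ ⟨x, hx, rfl⟩
    exact ⟨⟨x, coe_mem_sphereSpan hx⟩, coe_mem_coneOver_iff.2 hx, rfl⟩

theorem measurableEmbedding_subspace_val (V : Submodule ℝ (AmbientSpace n)) :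
    MeasurableEmbedding (Subtype.val : V → AmbientSpace n) :=
  MeasurableEmbedding.subtype_coe V.closed_of_finiteDimensional.measurableSet

theorem comap_coneMeasure_preimage (μ : Measure (UnitSphere n)) [SFinite μ]
    (A : Set (AmbientSpace n)) :
    (coneMeasure μ).comap (Subtype.val : sphereSpan μ.support → AmbientSpace n)
      (Subtype.val ⁻¹' A) = coneMeasure μ A := by
  rw [(measurableEmbedding_subspace_val _).comap_apply, Set.image_preimage_eq_inter_range,
    Subtype.range_coe]
  have hnull : coneMeasure μ ((sphereSpan μ.support : Set (AmbientSpace n)))ᶜ = 0 :=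
    measure_mono_null (Set.compl_subset_compl.2 (coneOver_subset_sphereSpan _))
      (coneMeasure_compl_coneOver_support μ)
  exact measure_inter_conull hnull

/-- Balls of the span are traces of ambient balls with the same centre, and the cone measure is
carried by the span, so restricting to it alters no mass. -/
theorem IsConvexelyDerived.isBrunnMinkowskiCone {μ : ProbabilityMeasure (UnitSphere n)}
    (hμ : IsConvexelyDerived μ) :
    IsBrunnMinkowskiCone ((coneMeasure (μ : Measure (UnitSphere n))).comap
      (Subtype.val : sphereSpan (μ : Measure (UnitSphere n)).support → AmbientSpace n)) (n + 1)
      (subspaceCone (sphereSpan (μ : Measure (UnitSphere n)).support)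
        (μ : Measure (UnitSphere n)).support) := by
  set ν : Measure (UnitSphere n) := (μ : Measure (UnitSphere n))
  have hne : ν.support.Nonempty := Measure.nonempty_support (IsProbabilityMeasure.ne_zero ν)
  have hball : ∀ (x : sphereSpan ν.support) (r : ℝ), Metric.ball x r =
      Subtype.val ⁻¹' Metric.ball (x : AmbientSpace n) r := fun _ _ => rfl
  have hclosed : ∀ (x : sphereSpan ν.support) (r : ℝ), Metric.closedBall x r =
      Subtype.val ⁻¹' Metric.closedBall (x : AmbientSpace n) r := fun _ _ => rfl
  have hconv : Convex ℝ (subspaceCone (sphereSpan ν.support) ν.support) :=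
    (convex_coneOver_of_add_mem fun x hx y hy => hμ.add_mem_coneOver_support hx hy).linear_preimage
      (sphereSpan ν.support).subtype
  constructor
  · refine ⟨fun x => ⟨Metric.ball x 1, Metric.ball_mem_nhds x one_pos, ?_⟩⟩
    rw [hball, comap_coneMeasure_preimage]
    exact measure_ball_lt_top
  · exact (isClosed_coneOver Measure.isClosed_support).preimage continuous_subtype_val
  · exact fun x hx y hy => hμ.add_mem_coneOver_support hx hy
  · exact fun x hx t ht => smul_mem_coneOver hx ht
  · rw [hconv.interior_nonempty_iff_affineSpan_eq_top]
    exact affineSpan_subspaceCone hne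
  · have : (subspaceCone (sphereSpan ν.support) ν.support)ᶜ =
        Subtype.val ⁻¹' (coneOver ν.support)ᶜ := rfl
    rw [this, comap_coneMeasure_preimage, coneMeasure_compl_coneOver_support]
  · intro x hx r hr
    rw [hball, comap_coneMeasure_preimage]
    exact coneMeasure_ball_pos ν hx hr
  · intro x r t ht
    rw [hclosed, hclosed, comap_coneMeasure_preimage, comap_coneMeasure_preimage]
    exact coneMeasure_closedBall_smul ν x r ht
  · intro x y r s c α β hα hβ hx hy
    rw [hball, comap_coneMeasure_preimage] at hx hy
    rw [hclosed, comap_coneMeasure_preimage]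
    exact hμ.mul_add_pow_le_coneMeasure hα hβ hx hy

/-- Every slice of radius r < 1 is a copy of A. The radial integral is the same for all A, hence
drops out of ratios. -/
theorem coneMeasure_coneOver_inter_ball (μ : Measure (UnitSphere n)) [SFinite μ]
    {A : Set (UnitSphere n)} (hA : MeasurableSet A) :
    coneMeasure μ (coneOver A ∩ Metric.ball 0 1) =
      μ A * ∫⁻ r in Set.Ioo (0 : ℝ) 1, ENNReal.ofReal (r ^ n) := by
  rw [coneMeasure_apply _ ((measurableSet_coneOver hA).inter Metric.isOpen_ball.measurableSet)]
  have hind : Measurable ((Set.Iio (1 : ℝ)).indicator fun _ => μ A) :=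
    measurable_const.indicator measurableSet_Iio
  calc _ = ∫⁻ r : Set.Ioi (0 : ℝ), (Set.Iio (1 : ℝ)).indicator (fun _ => μ A) r
        ∂(Measure.volumeIoiPow n) := by
        refine lintegral_congr fun r => ?_
        have hr0 : (0 : ℝ) < r := r.2
        by_cases hr : (r : ℝ) < 1
        · rw [Set.indicator_of_mem (show (r : ℝ) ∈ Set.Iio (1 : ℝ) from hr)]
          congr 1
          ext x
          simp [smul_mem_coneOver_iff (S := A) hr0, norm_smul, abs_of_pos hr0, hr]
        · rw [Set.indicator_of_notMem (show (r : ℝ) ∉ Set.Iio (1 : ℝ) from hr)]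
          convert measure_empty (μ := μ)
          ext x
          simp [norm_smul, abs_of_pos hr0, hr]
    _ = ∫⁻ r in Set.Ioi (0 : ℝ), (Set.Iio (1 : ℝ)).indicator
          (fun r => μ A * ENNReal.ofReal (r ^ n)) r := by
        rw [lintegral_volumeIoiPow n hind]
        refine lintegral_congr fun r => ?_
        by_cases hr : r ∈ Set.Iio (1 : ℝ)
        · rw [Set.indicator_of_mem hr, Set.indicator_of_mem hr, mul_comm]
        · rw [Set.indicator_of_notMem hr, Set.indicator_of_notMem hr, mul_zero]
    _ = _ := by
        rw [lintegral_indicator measurableSet_Iio, Measure.restrict_restrict measurableSet_Iio,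
          Set.inter_comm, Set.Ioi_inter_Iio, lintegral_const_mul _ (by fun_prop)]

theorem setLIntegral_Ioo_pow_ne_zero (n : ℕ) :
    ∫⁻ r in Set.Ioo (0 : ℝ) 1, ENNReal.ofReal (r ^ n) ≠ 0 := by
  refine (setLIntegral_pos_iff (by fun_prop) |>.2 ?_).ne'
  refine (show (0 : ℝ≥0∞) < volume (Set.Ioo (0 : ℝ) 1) by simp).trans_le
    (measure_mono fun r hr => ⟨?_, hr⟩)
  have : 0 < r := hr.1
  simpa using pow_pos this n

theorem setLIntegral_Ioo_pow_ne_top (n : ℕ) :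
    ∫⁻ r in Set.Ioo (0 : ℝ) 1, ENNReal.ofReal (r ^ n) ≠ ∞ := by
  refine ((setLIntegral_mono' measurableSet_Ioo fun r hr => ?_).trans_lt
    (show ∫⁻ r in Set.Ioo (0 : ℝ) 1, (1 : ℝ≥0∞) < ∞ by simp)).ne
  rw [ENNReal.ofReal_le_one]
  exact pow_le_one₀ hr.1.le hr.2.le

theorem isClosedEmbedding_subsphereIncl (V : Submodule ℝ (AmbientSpace n)) :
    IsClosedEmbedding (subsphereIncl V) := by
  refine Continuous.isClosedEmbedding ?_ fun x y hxy => ?_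
  · exact Continuous.subtype_mk (by fun_prop) _
  · have := congrArg (Subtype.val : UnitSphere n → AmbientSpace n) hxy
    exact Subtype.ext (Subtype.ext this)

/-- The mass of a set as an integral over the unit ball of the subspace. -/
theorem measure_mul_eq_setLIntegral {μ : Measure (UnitSphere n)} [SFinite μ]
    {ω : Measure (sphereSpan μ.support)} {D : sphereSpan μ.support → ℝ≥0∞}
    (hΛ : (coneMeasure μ).comap (Subtype.val : sphereSpan μ.support → AmbientSpace n) =
      ω.withDensity D) {A : Set (UnitSphere n)} (hA : MeasurableSet A) :
    μ A * ∫⁻ r in Set.Ioo (0 : ℝ) 1, ENNReal.ofReal (r ^ n) =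
      ∫⁻ x in Metric.ball 0 1, (subspaceCone (sphereSpan μ.support) A).indicator D x ∂ω := by
  have hm : MeasurableSet (subspaceCone (sphereSpan μ.support) A) :=
    measurable_subtype_coe (measurableSet_coneOver hA)
  rw [← coneMeasure_coneOver_inter_ball μ hA, ← comap_coneMeasure_preimage, hΛ]
  have : (Subtype.val ⁻¹' (coneOver A ∩ Metric.ball 0 1) : Set (sphereSpan μ.support)) =
      subspaceCone (sphereSpan μ.support) A ∩ Metric.ball 0 1 := by
    ext x
    simp [subspaceCone]
  rw [this, withDensity_apply _ (hm.inter Metric.isOpen_ball.measurableSet),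
    lintegral_indicator hm, Measure.restrict_restrict hm]

/-- The density of the measure on the great subsphere is the restriction of a homogeneous density
of the cone measure. -/
theorem measure_eq_setLIntegral_toSphere {μ : Measure (UnitSphere n)} [SFinite μ]
    {ω : Measure (sphereSpan μ.support)} [ω.IsAddHaarMeasure] {D : sphereSpan μ.support → ℝ≥0∞}
    (hΛ : (coneMeasure μ).comap (Subtype.val : sphereSpan μ.support → AmbientSpace n) =
      ω.withDensity D) (hD : Measurable D) {m : ℕ}
    (hDm : ∀ x (t : ℝ), 0 < t → D (t • x) = ENNReal.ofReal t ^ m * D x)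
    (hdim : 1 ≤ Module.finrank ℝ (sphereSpan μ.support))
    (hnm : n + 1 = Module.finrank ℝ (sphereSpan μ.support) + m)
    {A : Set (UnitSphere n)} (hA : MeasurableSet A) :
    μ A = ∫⁻ θ in subsphereIncl (sphereSpan μ.support) ⁻¹' A, D θ ∂ω.toSphere := by
  have : Nontrivial (sphereSpan μ.support) := Module.nontrivial_of_finrank_pos (R := ℝ) (by omega)
  have hm : MeasurableSet (subspaceCone (sphereSpan μ.support) A) :=
    measurable_subtype_coe (measurableSet_coneOver hA)
  have hA' : MeasurableSet (subsphereIncl (sphereSpan μ.support) ⁻¹' A) :=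
    (isClosedEmbedding_subsphereIncl (sphereSpan μ.support)).continuous.measurable hA
  have key := measure_mul_eq_setLIntegral hΛ hA
  have hF : Measurable ((Metric.ball (0 : (sphereSpan μ.support)) 1).indicator ((subspaceCone (sphereSpan μ.support) A).indicator D)) :=
    (hD.indicator hm).indicator Metric.isOpen_ball.measurableSet
  rw [← lintegral_indicator Metric.isOpen_ball.measurableSet,
    lintegral_eq_lintegral_toSphere ω hF] at key
  -- The radial exponents add up to (dim V - 1) + m = n, so each ray contributes the same factor
  -- that multiplies μ A, and this factor can be cancelled.
  have hinner : ∀ θ : Metric.sphere (0 : (sphereSpan μ.support)) 1, ∫⁻ r in Set.Ioi (0 : ℝ),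
      ENNReal.ofReal (r ^ (Module.finrank ℝ (sphereSpan μ.support) - 1)) *
        (Metric.ball (0 : (sphereSpan μ.support)) 1).indicator ((subspaceCone (sphereSpan μ.support) A).indicator D) (r • (θ : (sphereSpan μ.support))) =
      (subsphereIncl (sphereSpan μ.support) ⁻¹' A).indicator (fun θ => D θ) θ *
        ∫⁻ r in Set.Ioo (0 : ℝ) 1, ENNReal.ofReal (r ^ n) := by
    intro θ
    have hθ : ‖(θ : (sphereSpan μ.support))‖ = 1 := mem_sphere_zero_iff_norm.1 θ.2
    rw [← lintegral_const_mul _ (by fun_prop), ← Set.Ioi_inter_Iio, Set.inter_comm,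
      ← Measure.restrict_restrict measurableSet_Iio, ← lintegral_indicator measurableSet_Iio]
    refine setLIntegral_congr_fun measurableSet_Ioi fun r hr => ?_
    have hr0 : (0 : ℝ) < r := hr
    have hnorm : ‖r • (θ : (sphereSpan μ.support))‖ = r := by
      rw [norm_smul, hθ, mul_one, Real.norm_of_nonneg hr0.le]
    have hcone : r • (θ : (sphereSpan μ.support)) ∈ subspaceCone (sphereSpan μ.support) A ↔ θ ∈ subsphereIncl (sphereSpan μ.support) ⁻¹' A :=
      smul_mem_coneOver_iff (S := A) (x := subsphereIncl (sphereSpan μ.support) θ) hr0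
    by_cases hr1 : r < 1
    · rw [Set.indicator_of_mem (show r • (θ : (sphereSpan μ.support)) ∈ Metric.ball (0 : (sphereSpan μ.support)) 1 by
        rw [mem_ball_zero_iff, hnorm]; exact hr1),
        Set.indicator_of_mem (show r ∈ Set.Iio (1 : ℝ) from hr1)]
      by_cases hθA : θ ∈ subsphereIncl (sphereSpan μ.support) ⁻¹' A
      · rw [Set.indicator_of_mem hθA, Set.indicator_of_mem (hcone.2 hθA), hDm _ _ hr0,
          ← ENNReal.ofReal_pow hr0.le, ← mul_assoc, ← ENNReal.ofReal_mul (by positivity),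
          ← pow_add, mul_comm, show Module.finrank ℝ (sphereSpan μ.support) - 1 + m = n by omega]
      · rw [Set.indicator_of_notMem hθA, Set.indicator_of_notMem (fun h => hθA (hcone.1 h)),
          mul_zero, zero_mul]
    · rw [Set.indicator_of_notMem (show r • (θ : (sphereSpan μ.support)) ∉ Metric.ball (0 : (sphereSpan μ.support)) 1 by
        rw [mem_ball_zero_iff, hnorm]; exact hr1),
        Set.indicator_of_notMem (show r ∉ Set.Iio (1 : ℝ) from hr1), mul_zero]
  simp_rw [hinner] at key
  have hDA : Measurable ((subsphereIncl (sphereSpan μ.support) ⁻¹' A).indicator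
      fun θ : Metric.sphere (0 : sphereSpan μ.support) 1 => D θ) :=
    (hD.comp measurable_subtype_coe).indicator hA'
  rw [lintegral_mul_const _ hDA,
    lintegral_indicator hA'] at key
  exact (ENNReal.mul_left_inj (setLIntegral_Ioo_pow_ne_zero n) (setLIntegral_Ioo_pow_ne_top n)).1 key

end subspaceCone

/-! ### Upper limits of the density on the unit sphere -/

/-- The upper limit, along the unit vectors in the interior of `K`, of the density attached to the
gauge `g`. -/
def gaugeDensityLimsup {V : Type*} [NormedAddCommGroup V] (g : V → ℝ) (K : Set V) (m : ℕ)
    (θ : Metric.sphere (0 : V) 1) : ℝ≥0∞ :=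
  limsup (fun x : Metric.sphere (0 : V) 1 => gaugeDensity g K m x) (𝓝[Subtype.val ⁻¹' interior K] θ)

theorem nhdsWithin_inter_sphere {V : Type*} [NormedAddCommGroup V] (K : Set V)
    (θ : Metric.sphere (0 : V) 1) :
    𝓝[interior K ∩ Metric.sphere 0 1] (θ : V) =
      map Subtype.val (𝓝[Subtype.val ⁻¹' interior K] θ) := by
  rw [IsEmbedding.subtypeVal.map_nhdsWithin_eq, Subtype.image_preimage_coe, Set.inter_comm]

namespace IsConcaveGauge

variable {V : Type*} [NormedAddCommGroup V] [NormedSpace ℝ V] {g : V → ℝ} {K : Set V}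

theorem gaugeDensity_le (h : IsConcaveGauge g K) (m : ℕ) (θ : Metric.sphere (0 : V) 1) :
    gaugeDensity g K m θ ≤ ENNReal.ofReal (peakValue g K ^ m) := by
  by_cases hθ : (θ : V) ∈ interior K
  · rw [gaugeDensity, Set.indicator_of_mem hθ]
    exact ENNReal.ofReal_le_ofReal
      (pow_le_pow_left₀ (h.nonneg _) (h.le_peakValue ⟨hθ, θ.2⟩) m)
  · rw [gaugeDensity, Set.indicator_of_notMem hθ]
    exact zero_le

theorem gaugeDensityLimsup_le (h : IsConcaveGauge g K) (m : ℕ) (θ : Metric.sphere (0 : V) 1) :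
    gaugeDensityLimsup g K m θ ≤ ENNReal.ofReal (peakValue g K ^ m) :=
  limsup_le_of_le (h := Eventually.of_forall fun x => h.gaugeDensity_le m x)

/-- For m ≠ 0 the map a ↦ aᵐ is continuous and strictly increasing on a ≥ 0, so upper limits of g
and of gᵐ reach their bounds at the same points. -/
theorem isPeak_iff (h : IsConcaveGauge g K) {m : ℕ} (hm : m ≠ 0) (θ : Metric.sphere (0 : V) 1) :
    IsPeak g K θ ↔ ENNReal.ofReal (peakValue g K ^ m) ≤ gaugeDensityLimsup g K m θ := by
  have hM := h.peakValue_pos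
  constructor
  · intro hθ
    refine le_of_forall_lt fun c hc => ?_
    have hcont : ContinuousAt (fun a : ℝ => ENNReal.ofReal (a ^ m)) (peakValue g K) :=
      (ENNReal.continuous_ofReal.comp (continuous_pow m)).continuousAt
    have hev : ∀ᶠ a in 𝓝[<] peakValue g K, (c < ENNReal.ofReal (a ^ m) ∧ 0 < a) ∧
        a < peakValue g K :=
      (eventually_nhdsWithin_of_eventually_nhds
        ((hcont.eventually_const_lt hc).and (eventually_gt_nhds hM))).and self_mem_nhdsWithin
    obtain ⟨a, ⟨hca, ha0⟩, haM⟩ := hev.exists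
    have hfreq := hθ.2 a haM
    rw [nhdsWithin_inter_sphere, frequently_map] at hfreq
    refine hca.trans_le (le_limsup_of_frequently_le ?_)
    refine (hfreq.and_eventually self_mem_nhdsWithin).mono fun x hx => ?_
    rw [gaugeDensity, Set.indicator_of_mem hx.2]
    exact ENNReal.ofReal_le_ofReal (pow_le_pow_left₀ ha0.le hx.1.le m)
  · refine fun hθ => ⟨mem_sphere_zero_iff_norm.1 θ.2, fun a ha => ?_⟩
    rw [nhdsWithin_inter_sphere, frequently_map]
    -- The level a may be negative, where powers are not monotone.
    have hlt : ENNReal.ofReal (max a 0 ^ m) < gaugeDensityLimsup g K m θ := by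
      refine lt_of_lt_of_le ?_ hθ
      rw [ENNReal.ofReal_lt_ofReal_iff (pow_pos hM m)]
      exact pow_lt_pow_left₀ (max_lt ha hM) (le_max_right _ _) hm
    refine (frequently_lt_of_lt_limsup (h := hlt)).mono fun x hx => ?_
    have hxK : (x : V) ∈ interior K := by
      by_contra hxK
      rw [gaugeDensity, Set.indicator_of_notMem hxK] at hx
      exact not_lt_zero hx
    rw [gaugeDensity, Set.indicator_of_mem hxK,
      ENNReal.ofReal_lt_ofReal_iff (pow_pos (h.pos _ hxK) m)] at hx
    exact (le_max_left _ _).trans_lt (lt_of_pow_lt_pow_left₀ m (h.nonneg _) hx)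

theorem continuousOn_gaugeDensity (h : IsConcaveGauge g K) (m : ℕ) :
    ContinuousOn (fun θ : Metric.sphere (0 : V) 1 => gaugeDensity g K m θ)
      (Subtype.val ⁻¹' interior K) := by
  have hc : ContinuousOn (fun x => ENNReal.ofReal (g x ^ m)) (interior K) :=
    ENNReal.continuous_ofReal.comp_continuousOn (h.continuousOn.pow m)
  exact (hc.comp continuous_subtype_val.continuousOn fun θ hθ => hθ).congr fun θ hθ =>
    Set.indicator_of_mem (s := interior K) hθ _

theorem gaugeDensityLimsup_eq (h : IsConcaveGauge g K) (m : ℕ) {θ : Metric.sphere (0 : V) 1}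
    (hθ : (θ : V) ∈ interior K) : gaugeDensityLimsup g K m θ = gaugeDensity g K m θ := by
  have : (𝓝[(Subtype.val ⁻¹' interior K : Set (Metric.sphere (0 : V) 1))] θ).NeBot :=
    mem_closure_iff_nhdsWithin_neBot.1 (subset_closure hθ)
  exact (h.continuousOn_gaugeDensity m θ hθ).tendsto.limsup_eq

/-- The spherical measure of a set is a multiple of the measure of the truncated cone over it, and
that cone lies in the boundary of the convex set K. -/
theorem toSphere_sdiff_interior [FiniteDimensional ℝ V] [MeasurableSpace V] [BorelSpace V]
    (h : IsConcaveGauge g K) (ω : Measure V) [ω.IsAddHaarMeasure] :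
    ω.toSphere (Subtype.val ⁻¹' (K \ interior K)) = 0 := by
  have hm : MeasurableSet (K \ interior K) :=
    h.isClosed.measurableSet.diff isOpen_interior.measurableSet
  rw [Measure.toSphere_apply' _ (measurable_subtype_coe hm)]
  refine mul_eq_zero_of_right _ (measure_mono_null ?_ (h.convex.addHaar_frontier ω))
  rintro _ ⟨t, ht, _, ⟨θ, hθ, rfl⟩, rfl⟩
  have ht0 : (0 : ℝ) < t := ht.1
  rw [h.isClosed.frontier_eq]
  refine ⟨h.smul_mem _ hθ.1 _ ht0.le, fun hint => hθ.2 ?_⟩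
  have := h.smul_mem_interior hint (inv_pos.2 ht0)
  simpa [smul_smul, ht0.ne'] using this

end IsConcaveGauge

/-! ### The relative interior, seen in the span of the support -/

section relInterior

variable {n : ℕ}

/-- A linear isometry commutes with intrinsic interiors, and inside its span the cone has full
affine span, so its intrinsic interior is its interior. -/
theorem mem_relInterior_iff {S : Set (UnitSphere n)} (hS : S.Nonempty) {x : UnitSphere n} :
    x ∈ relInterior S ↔
      ∃ y ∈ interior (subspaceCone (sphereSpan S) S), (y : AmbientSpace n) = x := by
  have himg : (sphereSpan S).subtypeₗᵢ.toAffineIsometry '' subspaceCone (sphereSpan S) S =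
      coneOver S := image_subspaceCone_sphereSpan S
  have hint : intrinsicInterior ℝ (subspaceCone (sphereSpan S) S) =
      interior (subspaceCone (sphereSpan S) S) := by
    refine subset_antisymm ?_ interior_subset_intrinsicInterior
    have hopen : IsOpenMap (Subtype.val : affineSpan ℝ (subspaceCone (sphereSpan S) S) →
        sphereSpan S) := by
      refine IsOpen.isOpenMap_subtype_val (s := (affineSpan ℝ (subspaceCone (sphereSpan S) S) :
        Set (sphereSpan S))) ?_
      rw [affineSpan_subspaceCone hS]
      exact isOpen_univ
    refine interior_maximal intrinsicInterior_subset ?_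
    exact hopen _ isOpen_interior
  rw [relInterior, Set.mem_ofPred_eq, ← himg, AffineIsometry.intrinsicInterior_image, hint]
  rfl

theorem relInterior_eq_image {S : Set (UnitSphere n)} (hS : S.Nonempty) :
    relInterior S = subsphereIncl (sphereSpan S) ''
      (Subtype.val ⁻¹' interior (subspaceCone (sphereSpan S) S)) := by
  ext x
  rw [mem_relInterior_iff hS]
  constructor
  · rintro ⟨y, hy, hyx⟩
    have hy1 : y ∈ Metric.sphere (0 : sphereSpan S) 1 := by
      rw [mem_sphere_zero_iff_norm, ← Submodule.norm_coe, hyx, norm_unitSphere]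
    exact ⟨⟨y, hy1⟩, hy, Subtype.ext hyx⟩
  · rintro ⟨θ, hθ, rfl⟩
    exact ⟨θ, hθ, rfl⟩

theorem subsphereIncl_mem_iff {S : Set (UnitSphere n)} {V : Submodule ℝ (AmbientSpace n)}
    {θ : Metric.sphere (0 : V) 1} :
    subsphereIncl V θ ∈ S ↔ (θ : V) ∈ subspaceCone V S :=
  (coe_mem_coneOver_iff (S := S) (x := subsphereIncl V θ)).symm

theorem exists_subsphereIncl_eq {S : Set (UnitSphere n)} {x : UnitSphere n} (hx : x ∈ S) :
    ∃ θ, subsphereIncl (sphereSpan S) θ = x :=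
  ⟨⟨⟨x, coe_mem_sphereSpan hx⟩, by
    rw [mem_sphere_zero_iff_norm]
    exact norm_unitSphere x⟩, rfl⟩

theorem limsup_nhdsWithin_relInterior {S : Set (UnitSphere n)} (hS : S.Nonempty)
    (f : UnitSphere n → ℝ≥0∞) (θ : Metric.sphere (0 : sphereSpan S) 1) :
    limsup f (𝓝[relInterior S] (subsphereIncl (sphereSpan S) θ)) =
      limsup (f ∘ subsphereIncl (sphereSpan S))
        (𝓝[Subtype.val ⁻¹' interior (subspaceCone (sphereSpan S) S)] θ) := by
  rw [relInterior_eq_image hS,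
    ← (isClosedEmbedding_subsphereIncl (sphereSpan S)).isEmbedding.map_nhdsWithin_eq]
  rfl

theorem continuousOn_relInterior_iff {S : Set (UnitSphere n)} (hS : S.Nonempty)
    {f : UnitSphere n → ℝ≥0∞} :
    ContinuousOn f (relInterior S) ↔ ContinuousOn (f ∘ subsphereIncl (sphereSpan S))
      (Subtype.val ⁻¹' interior (subspaceCone (sphereSpan S) S)) := by
  rw [relInterior_eq_image hS]
  constructor
  · exact fun h => h.comp (isClosedEmbedding_subsphereIncl _).continuous.continuousOn
      (Set.mapsTo_image _ _)
  · rintro h _ ⟨θ, hθ, rfl⟩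
    rw [ContinuousWithinAt,
      ← (isClosedEmbedding_subsphereIncl (sphereSpan S)).isEmbedding.map_nhdsWithin_eq,
      tendsto_map'_iff]
    exact h θ hθ

end relInterior

theorem withDensity_restrict_subsphereVolume {n : ℕ} (V : Submodule ℝ (AmbientSpace n))
    (S : Set (UnitSphere n)) (f : UnitSphere n → ℝ≥0∞) :
    ((subsphereVolume V).restrict S).withDensity f =
      (((stdOrthonormalBasis ℝ V).toBasis.addHaar.toSphere.restrict
        (subsphereIncl V ⁻¹' S)).withDensity (f ∘ subsphereIncl V)).map (subsphereIncl V) := by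
  have hi := (isClosedEmbedding_subsphereIncl V).measurableEmbedding
  ext A hA
  rw [withDensity_apply _ hA, subsphereVolume, hi.restrict_map, hi.restrict_map, hi.lintegral_map,
    hi.map_apply, withDensity_apply _ (hi.measurable hA)]
  rfl

/-! ### The normalised density and its maximum points -/

section density

variable {n : ℕ} (μ : ProbabilityMeasure (UnitSphere n))

/-- The linear span of the support of `μ`. -/
abbrev supportSpan : Submodule ℝ (AmbientSpace n) :=
  sphereSpan (μ : Measure (UnitSphere n)).support

/-- The cone over the support of `μ`, in the linear span of the support. -/
abbrev supportCone : Set (supportSpan μ) :=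
  subspaceCone (supportSpan μ) (μ : Measure (UnitSphere n)).support

/-- The Lebesgue measure on the linear span of the support of `μ`. -/
abbrev supportVolume : Measure (supportSpan μ) :=
  (stdOrthonormalBasis ℝ (supportSpan μ)).toBasis.addHaar

/-- `g` is a gauge whose power is the density of the cone measure of `μ`. -/
structure IsDensityGauge (g : supportSpan μ → ℝ) (m : ℕ) : Prop where
  isConcaveGauge : IsConcaveGauge g (supportCone μ)
  ne_zero : m ≠ 0
  one_le_finrank : 1 ≤ Module.finrank ℝ (supportSpan μ)
  finrank_add : n + 1 = Module.finrank ℝ (supportSpan μ) + m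
  comap_coneMeasure : (coneMeasure (μ : Measure (UnitSphere n))).comap
    (Subtype.val : supportSpan μ → AmbientSpace n) =
      (supportVolume μ).withDensity (gaugeDensity g (supportCone μ) m)

variable {μ} {g : supportSpan μ → ℝ} {m : ℕ} {f : UnitSphere n → ℝ≥0∞}

theorem nonempty_support : (μ : Measure (UnitSphere n)).support.Nonempty :=
  Measure.nonempty_support (IsProbabilityMeasure.ne_zero _)

theorem IsConvexelyDerived.exists_isDensityGauge (hμ : IsConvexelyDerived μ) {k : ℕ} (hkn : k < n)
    (hdim : HasSphericalDim (μ : Measure (UnitSphere n)).support k) :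
    ∃ g, IsDensityGauge μ g (n - k) := by
  have hd : Module.finrank ℝ (supportSpan μ) = k + 1 := hdim
  obtain ⟨g, hg, hΛ⟩ := hμ.isBrunnMinkowskiCone.exists_eq_withDensity_gaugeDensity
    (supportVolume μ) (m := n - k) (by rw [hd]; omega) (by omega)
  exact ⟨g, hg, by omega, by omega, by omega, hΛ⟩

namespace IsDensityGauge

theorem eq_map_withDensity (h : IsDensityGauge μ g m) :
    (μ : Measure (UnitSphere n)) = ((supportVolume μ).toSphere.withDensity
      fun θ => gaugeDensity g (supportCone μ) m θ).map (subsphereIncl (supportSpan μ)) := by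
  have hi := (isClosedEmbedding_subsphereIncl (supportSpan μ)).measurableEmbedding
  ext A hA
  rw [hi.map_apply, withDensity_apply _ (hi.measurable hA)]
  exact measure_eq_setLIntegral_toSphere h.comap_coneMeasure
    (h.isConcaveGauge.measurable_gaugeDensity m)
    (fun x t ht => h.isConcaveGauge.gaugeDensity_smul m x ht) h.one_le_finrank h.finrank_add hA

/-- The inclusion of the great subsphere is a measurable embedding, so the push-forward can be
cancelled and densities compared on the unit sphere of the span. -/
theorem eq_withDensity_iff (h : IsDensityGauge μ g m) :
    (μ : Measure (UnitSphere n)) = ((subsphereVolume (supportSpan μ)).restrict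
        (μ : Measure (UnitSphere n)).support).withDensity f ↔
      (supportVolume μ).toSphere.withDensity (fun θ => gaugeDensity g (supportCone μ) m θ) =
        ((supportVolume μ).toSphere.restrict (Subtype.val ⁻¹' supportCone μ)).withDensity
          (f ∘ subsphereIncl (supportSpan μ)) := by
  have hi := (isClosedEmbedding_subsphereIncl (supportSpan μ)).measurableEmbedding
  have hpre : subsphereIncl (supportSpan μ) ⁻¹' (μ : Measure (UnitSphere n)).support =
      Subtype.val ⁻¹' supportCone μ := Set.ext fun θ => subsphereIncl_mem_iff
  rw [withDensity_restrict_subsphereVolume, hpre]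
  nth_rewrite 1 [h.eq_map_withDensity]
  constructor
  · intro heq
    rw [← hi.comap_map ((supportVolume μ).toSphere.withDensity _), heq, hi.comap_map]
  · exact fun heq => by rw [heq]

/-- Passing to upper limits leaves the density unchanged on the relative interior, by continuity,
and alters it within the support only on the null boundary. The value 0 off the subsphere plays no
part. -/
theorem isSphericalDensity_extend (h : IsDensityGauge μ g m) :
    IsSphericalDensity μ (Function.extend (subsphereIncl (supportSpan μ))
      (gaugeDensityLimsup g (supportCone μ) m) 0) := by
  have hinj := (isClosedEmbedding_subsphereIncl (supportSpan μ)).injective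
  have hg := h.isConcaveGauge
  have hext : Function.extend (subsphereIncl (supportSpan μ))
      (gaugeDensityLimsup g (supportCone μ) m) 0 ∘ subsphereIncl (supportSpan μ) =
      gaugeDensityLimsup g (supportCone μ) m := Function.extend_comp hinj _ _
  have hnonempty := nonempty_support (μ := μ)
  refine ⟨?_, ?_, fun x hx => ?_⟩
  · rw [h.eq_withDensity_iff, hext, ← withDensity_indicator
      (measurable_subtype_coe hg.isClosed.measurableSet)]
    refine withDensity_congr_ae ?_
    have hnull := hg.toSphere_sdiff_interior (supportVolume μ)
    filter_upwards [measure_eq_zero_iff_ae_notMem.1 hnull] with θ hθ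
    by_cases hK : (θ : supportSpan μ) ∈ supportCone μ
    · have hint : (θ : supportSpan μ) ∈ interior (supportCone μ) := by
        by_contra hint
        exact hθ ⟨hK, hint⟩
      rw [Set.indicator_of_mem (show θ ∈ Subtype.val ⁻¹' supportCone μ from hK),
        hg.gaugeDensityLimsup_eq m hint]
    · rw [Set.indicator_of_notMem (show θ ∉ Subtype.val ⁻¹' supportCone μ from hK), gaugeDensity,
        Set.indicator_of_notMem fun hint => hK (interior_subset hint)]
  · rw [continuousOn_relInterior_iff hnonempty, hext]
    exact (hg.continuousOn_gaugeDensity m).congr fun θ hθ => hg.gaugeDensityLimsup_eq m hθ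
  · obtain ⟨θ, rfl⟩ := exists_subsphereIncl_eq hx
    rw [limsup_nhdsWithin_relInterior hnonempty, hext, hinj.extend_apply]
    refine limsup_congr ?_
    filter_upwards [self_mem_nhdsWithin] with y hy
    exact (hg.gaugeDensityLimsup_eq m hy).symm

/-- Two densities of the same measure agree almost everywhere; both are continuous on this open set,
and the spherical measure charges open sets, so they agree throughout it. -/
theorem eqOn_interior (h : IsDensityGauge μ g m) (hf : IsSphericalDensity μ f) :
    Set.EqOn (fun θ : Metric.sphere (0 : supportSpan μ) 1 => gaugeDensity g (supportCone μ) m θ)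
      (f ∘ subsphereIncl (supportSpan μ))
      (Subtype.val ⁻¹' interior (supportCone μ)) := by
  have hg := h.isConcaveGauge
  have hopen : IsOpen (Subtype.val ⁻¹' interior (supportCone μ) :
      Set (Metric.sphere (0 : supportSpan μ) 1)) := isOpen_interior.preimage continuous_subtype_val
  have hc := (continuousOn_relInterior_iff nonempty_support).1 hf.continuousOn
  have heq := congrArg (Measure.restrict · (Subtype.val ⁻¹' interior (supportCone μ)))
    (h.eq_withDensity_iff.1 hf.eq_withDensity)
  simp only [restrict_withDensity hopen.measurableSet,
    Measure.restrict_restrict hopen.measurableSet] at heq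
  rw [Set.inter_eq_left.2 (Set.preimage_mono interior_subset)] at heq
  exact Measure.eqOn_open_of_ae_eq ((withDensity_eq_iff_of_sigmaFinite
    ((hg.measurable_gaugeDensity m).comp measurable_subtype_coe).aemeasurable
    (hc.aemeasurable hopen.measurableSet)).1 heq) hopen (hg.continuousOn_gaugeDensity m) hc

theorem apply_eq_gaugeDensityLimsup (h : IsDensityGauge μ g m) (hf : IsSphericalDensity μ f)
    {θ : Metric.sphere (0 : supportSpan μ) 1} (hθ : (θ : supportSpan μ) ∈ supportCone μ) :
    f (subsphereIncl (supportSpan μ) θ) = gaugeDensityLimsup g (supportCone μ) m θ := by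
  rw [hf.eq_limsup _ (subsphereIncl_mem_iff.2 hθ), limsup_nhdsWithin_relInterior nonempty_support]
  refine limsup_congr ?_
  filter_upwards [self_mem_nhdsWithin] with y hy
  exact (h.eqOn_interior hf hy).symm

/-- Every admissible density equals `gaugeDensityLimsup` on the support. That function is bounded by
the m-th power of the peak value, and this bound is attained exactly at peaks, of which there is at
least one. -/
theorem isDensityMaxPoint_iff (h : IsDensityGauge μ g m) {p : UnitSphere n} :
    IsDensityMaxPoint μ p ↔ ∃ q : supportSpan μ, IsPeak g (supportCone μ) q ∧
      (q : AmbientSpace n) = p := by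
  have hg := h.isConcaveGauge
  constructor
  · rintro ⟨f, hf, hp, hmax⟩
    obtain ⟨θ, rfl⟩ := exists_subsphereIncl_eq hp
    obtain ⟨q, hq⟩ := hg.exists_isPeak
    refine ⟨θ, (hg.isPeak_iff h.ne_zero θ).2 ?_, rfl⟩
    have hqK := hg.isPeak_mem hq
    have hqs := (hg.isPeak_iff h.ne_zero ⟨q, mem_sphere_zero_iff_norm.2 hq.1⟩).1 hq
    have hle := hmax _ (subsphereIncl_mem_iff.2
      (show ((⟨q, mem_sphere_zero_iff_norm.2 hq.1⟩ : Metric.sphere (0 : supportSpan μ) 1) :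
        supportSpan μ) ∈ supportCone μ from hqK))
    rw [h.apply_eq_gaugeDensityLimsup hf (subsphereIncl_mem_iff.1 hp),
      h.apply_eq_gaugeDensityLimsup hf hqK] at hle
    exact hqs.trans hle
  · rintro ⟨q, hq, hqp⟩
    have hqK := hg.isPeak_mem hq
    obtain rfl : subsphereIncl (supportSpan μ) ⟨q, mem_sphere_zero_iff_norm.2 hq.1⟩ = p :=
      Subtype.ext hqp
    refine ⟨_, h.isSphericalDensity_extend, subsphereIncl_mem_iff.2 hqK, fun x hx => ?_⟩
    obtain ⟨θ, rfl⟩ := exists_subsphereIncl_eq hx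
    rw [h.apply_eq_gaugeDensityLimsup h.isSphericalDensity_extend (subsphereIncl_mem_iff.1 hx)]
    refine le_of_le_of_eq ?_ (h.apply_eq_gaugeDensityLimsup h.isSphericalDensity_extend hqK).symm
    exact (hg.gaugeDensityLimsup_le m θ).trans
      ((hg.isPeak_iff h.ne_zero ⟨q, mem_sphere_zero_iff_norm.2 hq.1⟩).1 hq)

theorem existsUnique_isDensityMaxPoint (h : IsDensityGauge μ g m) :
    ∃! p : UnitSphere n, IsDensityMaxPoint μ p := by
  obtain ⟨q, hq⟩ := h.isConcaveGauge.exists_isPeak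
  refine ⟨subsphereIncl (supportSpan μ) ⟨q, mem_sphere_zero_iff_norm.2 hq.1⟩,
    h.isDensityMaxPoint_iff.2 ⟨q, hq, rfl⟩, fun p hp => ?_⟩
  obtain ⟨q', hq', hqp⟩ := h.isDensityMaxPoint_iff.1 hp
  refine Subtype.ext ?_
  rw [← hqp, h.isConcaveGauge.isPeak_unique hq' hq]
  rfl

end IsDensityGauge

end density

/-! ### The mass of geodesic balls -/

theorem setLIntegral_cos_pow_mul_sin_pow (m j : ℕ) {ε : ℝ} (hε0 : 0 ≤ ε) (hε : ε ≤ Real.pi / 2) :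
    ∫⁻ t in Set.Ioo 0 ε, ENNReal.ofReal (Real.cos t) ^ m * ENNReal.ofReal (Real.sin t ^ j) =
      ENNReal.ofReal (∫ t in (0 : ℝ)..ε, Real.cos t ^ m * Real.sin t ^ j) := by
  have hcos : ∀ t ∈ Set.Ioo 0 ε, 0 ≤ Real.cos t := fun t ht =>
    Real.cos_nonneg_of_mem_Icc ⟨by linarith [ht.1, Real.pi_pos], by linarith [ht.2]⟩
  have hsin : ∀ t ∈ Set.Ioo 0 ε, 0 ≤ Real.sin t := fun t ht =>
    Real.sin_nonneg_of_nonneg_of_le_pi ht.1.le (by linarith [ht.2, Real.pi_pos])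
  have hint : IntegrableOn (fun t => Real.cos t ^ m * Real.sin t ^ j) (Set.Ioo 0 ε) :=
    ((by fun_prop : Continuous fun t => Real.cos t ^ m * Real.sin t ^ j).integrableOn_Icc
      (a := 0) (b := ε)).mono_set Set.Ioo_subset_Icc_self
  rw [intervalIntegral.integral_of_le hε0, integral_Ioc_eq_integral_Ioo,
    ofReal_integral_eq_lintegral_ofReal hint]
  · refine setLIntegral_congr_fun measurableSet_Ioo fun t ht => ?_
    rw [ENNReal.ofReal_mul (pow_nonneg (hcos t ht) m), ENNReal.ofReal_pow (hcos t ht)]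
  · filter_upwards [ae_restrict_mem measurableSet_Ioo] with t ht
    exact mul_nonneg (pow_nonneg (hcos t ht) m) (pow_nonneg (hsin t ht) j)

theorem measurableSet_geodesicBall {n : ℕ} (p : UnitSphere n) (ε : ℝ) :
    MeasurableSet (geodesicBall p ε) := by
  have : Continuous fun x : UnitSphere n =>
      InnerProductGeometry.angle (p : AmbientSpace n) (x : AmbientSpace n) := by
    simp only [InnerProductGeometry.angle, norm_unitSphere, mul_one, div_one]
    fun_prop
  exact (isOpen_lt this continuous_const).measurableSet

theorem mem_coneOver_univ {n : ℕ} (x : AmbientSpace n) : x ∈ coneOver Set.univ := by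
  rcases eq_or_ne x 0 with rfl | hx
  · exact zero_mem_coneOver ⟨⟨EuclideanSpace.single 0 1, by simp⟩, trivial⟩
  · refine ⟨‖x‖, norm_nonneg x, ⟨‖x‖⁻¹ • x, ?_⟩, trivial, ?_⟩
    · rw [mem_sphere_zero_iff_norm, norm_smul, norm_inv, norm_norm,
        inv_mul_cancel₀ (norm_ne_zero_iff.2 hx)]
    · exact (smul_inv_smul₀ (norm_ne_zero_iff.2 hx) x).symm

namespace IsDensityGauge

variable {n : ℕ} {μ : ProbabilityMeasure (UnitSphere n)} {g : supportSpan μ → ℝ} {m : ℕ}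

/-- The two sets can differ, for instance at the origin, but they agree on the interior of the cone,
outside which the density vanishes. -/
theorem indicator_subspaceCone_geodesicBall (h : IsDensityGauge μ g m) {p : UnitSphere n}
    {q : supportSpan μ} (hqp : (q : AmbientSpace n) = p) (ε : ℝ) :
    (subspaceCone (supportSpan μ) (geodesicBall p ε)).indicator
        (gaugeDensity g (supportCone μ) m) =
      {x | InnerProductGeometry.angle q x < ε}.indicator (gaugeDensity g (supportCone μ) m) := by
  funext x
  by_cases hx : x ∈ interior (supportCone μ)
  · have hx0 : 0 < ‖x‖ := norm_pos_iff.2 (h.isConcaveGauge.ne_zero hx)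
    have hu : ‖((‖x‖⁻¹ • x : supportSpan μ) : AmbientSpace n)‖ = 1 := by
      rw [← Submodule.coe_norm, norm_smul, norm_inv, norm_norm, inv_mul_cancel₀ hx0.ne']
    have hxu : (x : AmbientSpace n) = ‖x‖ • ((‖x‖⁻¹ • x : supportSpan μ) : AmbientSpace n) := by
      rw [← Submodule.coe_smul, smul_inv_smul₀ hx0.ne']
    have hmem : x ∈ subspaceCone (supportSpan μ) (geodesicBall p ε) ↔
        x ∈ {x | InnerProductGeometry.angle q x < ε} := by
      have hiff := smul_mem_coneOver_iff (S := geodesicBall p ε)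
        (x := ⟨_, mem_sphere_zero_iff_norm.2 hu⟩) hx0
      rw [← hxu] at hiff
      refine hiff.trans ?_
      rw [geodesicBall, Set.mem_ofPred_eq, Set.mem_ofPred_eq, ← hqp, Submodule.angle_coe,
        InnerProductGeometry.angle_smul_right_of_pos _ _ (inv_pos.2 hx0)]
    by_cases hxA : x ∈ {x | InnerProductGeometry.angle q x < ε}
    · rw [Set.indicator_of_mem hxA, Set.indicator_of_mem (hmem.2 hxA)]
    · rw [Set.indicator_of_notMem hxA, Set.indicator_of_notMem fun hA => hxA (hmem.1 hA)]
  · have hzero : gaugeDensity g (supportCone μ) m x = 0 := Set.indicator_of_notMem hx _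
    exact (Set.indicator_apply_eq_zero.2 fun _ => hzero).trans
      (Set.indicator_apply_eq_zero.2 fun _ => hzero).symm

/-- The comparison on the unit ball of the span is read on the sphere for the geodesic ball and for
the whole sphere, of mass 1; both readings carry the same radial factor, which cancels. -/
theorem lintegral_le_measure_geodesicBall_mul (h : IsDensityGauge μ g m)
    (hdim : 2 ≤ Module.finrank ℝ (supportSpan μ)) {p : UnitSphere n} (hp : IsDensityMaxPoint μ p)
    {ε : ℝ} (hε : ε ≤ Real.pi / 2) :
    (∫⁻ t in Set.Ioo 0 ε, ENNReal.ofReal (Real.cos t) ^ m *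
        ENNReal.ofReal (Real.sin t ^ (Module.finrank ℝ (supportSpan μ) - 2))) ≤
      (μ : Measure (UnitSphere n)) (geodesicBall p ε) *
        ∫⁻ t in Set.Ioo 0 (Real.pi / 2), ENNReal.ofReal (Real.cos t) ^ m *
          ENNReal.ofReal (Real.sin t ^ (Module.finrank ℝ (supportSpan μ) - 2)) := by
  obtain ⟨q, hq, hqp⟩ := h.isDensityMaxPoint_iff.1 hp
  have hball := measure_mul_eq_setLIntegral h.comap_coneMeasure (measurableSet_geodesicBall p ε)
  have huniv := measure_mul_eq_setLIntegral h.comap_coneMeasure MeasurableSet.univ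
  rw [h.indicator_subspaceCone_geodesicBall hqp] at hball
  have hcone : subspaceCone (supportSpan μ) (Set.univ : Set (UnitSphere n)) = Set.univ :=
    Set.eq_univ_of_forall fun x => mem_coneOver_univ (x : AmbientSpace n)
  rw [hcone, Set.indicator_univ, measure_univ, one_mul] at huniv
  have hκ0 := setLIntegral_Ioo_pow_ne_zero n
  have hκ1 := setLIntegral_Ioo_pow_ne_top n
  have hmain := h.isConcaveGauge.lintegral_ball_mul_le (supportVolume μ) hdim h.ne_zero hq hε
  rw [← hball, ← huniv, mul_comm ((μ : Measure (UnitSphere n)) (geodesicBall p ε)), mul_assoc] at hmain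
  exact (ENNReal.mul_le_mul_iff_right hκ0 hκ1).1 hmain

end IsDensityGauge

theorem mainTheorem6 (n k : ℕ) (hk : 1 ≤ k) (hkn : k < n)
    (μ : ProbabilityMeasure (UnitSphere n)) (hμ : IsConvexelyDerived μ)
    (hdim : HasSphericalDim (μ : Measure (UnitSphere n)).support k) :
    (∃! p : UnitSphere n, IsDensityMaxPoint μ p) ∧
    ∀ p : UnitSphere n, IsDensityMaxPoint μ p → ∀ ε : ℝ, 0 < ε → ε ≤ Real.pi / 2 →
      (∫ t in (0 : ℝ)..ε, Real.cos t ^ (n - k) * Real.sin t ^ (k - 1)) /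
          (∫ t in (0 : ℝ)..(Real.pi / 2), Real.cos t ^ (n - k) * Real.sin t ^ (k - 1)) ≤
        (μ : Measure (UnitSphere n)).real (geodesicBall p ε) := by
  obtain ⟨g, hg⟩ := hμ.exists_isDensityGauge hkn hdim
  refine ⟨hg.existsUnique_isDensityMaxPoint, fun p hp ε hε0 hε => ?_⟩
  have hd : Module.finrank ℝ (supportSpan μ) = k + 1 := hdim
  -- The hypothesis k ≥ 1 makes the span at least two-dimensional, as polar coordinates around p
  -- require.
  have hle := hg.lintegral_le_measure_geodesicBall_mul (by rw [hd]; omega) hp hε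
  have hpi : 0 ≤ Real.pi / 2 := by positivity
  rw [hd, show k + 1 - 2 = k - 1 by omega, setLIntegral_cos_pow_mul_sin_pow _ _ hε0.le hε,
    setLIntegral_cos_pow_mul_sin_pow _ _ hpi le_rfl, ← ofReal_measureReal,
    ← ENNReal.ofReal_mul measureReal_nonneg] at hle
  have hJ : 0 ≤ ∫ t in (0 : ℝ)..(Real.pi / 2), Real.cos t ^ (n - k) * Real.sin t ^ (k - 1) := by
    refine intervalIntegral.integral_nonneg hpi fun t ht => mul_nonneg (pow_nonneg ?_ _)
      (pow_nonneg ?_ _)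
    · exact Real.cos_nonneg_of_mem_Icc ⟨by linarith [ht.1], ht.2⟩
    · exact Real.sin_nonneg_of_nonneg_of_le_pi ht.1 (by linarith [ht.2])
  refine div_le_of_le_mul₀ hJ measureReal_nonneg ?_
  exact (ENNReal.ofReal_le_ofReal_iff (mul_nonneg measureReal_nonneg hJ)).1 hle
end
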